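/- **Proposition.** Let $u,v,w,\ell_1,\ell_2,\ell_3\in\mathbb C$ and put $\mathbf u=(u_1,u_2,v_1,v_2,w_1,w_2)$ with $u_1=\frac u{\kappa}+\ell_1$, $u_2=\frac u{\kappa}-1-\ell_1$, $v_1=\frac v{\kappa}+\ell_2$, $v_2=\frac v{\kappa}-1-\ell_2$, $w_1=\frac w{\kappa}+\ell_3$, $w_2=\frac w{\kappa}-1-\ell_3$, where $\kappa=1$ in cases (o), (q) below and $\kappa=2\eta$ in case (e). Let $s_i$ ($1\le i\le5$) exchange the entries in positions $i,i+1$ of a vector of six parameters, and for such a vector $\mathbf p$ let $\mathcal S_i(\mathbf p)=\mathcal S_i(p_i-p_{i+1})$, where $\mathcal S_1(a),\mathcal S_3(a),\mathcal S_5(a)$ are the operator $W(a)$ in the variable $z_1,z_2,z_3$ respectively, and $\mathcal S_2(a),\mathcal S_4(a)$ are the operator $X(a)$ below in $(z_1,z_2)$, respectively with $(z_1,z_2)$ replaced by $(z_2,z_3)$: * (o, no deformation) $W(a)=z^{-a}\dfrac{\Gamma(z\partial+1)}{\Gamma(z\partial+1-a)}$, $\ X(a)=(z_2-z_1)^a=z_2^a\,(1-z_1/z_2)^a$,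 the last factor expanded in powers of $z_1/z_2$. * (q, quantum deformation) $q=e^h$, $\operatorname{Re}h<0$, $q^a=e^{ha}$, $(x;q^2)=\prod_{k\ge0}(1-xq^{2k})$, $$W(a)=q^{a^2/2}z^{-a}\frac{(q^{2-2a+2z\partial};q^2)}{(q^{2+2z\partial};q^2)}\,q^{-az\partial},\qquad X(a)=z_1^a\,\frac{(\frac{z_2}{z_1}q^{1-a};q^2)}{(\frac{z_2}{z_1}q^{1+a};q^2)},$$ the quotient in $W(a)$ expanded in powers of $q^{2z\partial}$. * (e, elliptic deformation) $\operatorname{Im}\tau>0$, $\operatorname{Im}\eta>0$, $\theta_1(z|\tau)=\sum_{n\in\mathbb Z}e^{\pi i(n+\frac12)^2\tau}e^{2\pi i(n+\frac12)(z+\frac12)}$, $[z]=\theta_1(2\eta z|\tau)$, $[z]_k=\prod_{j=0}^{k-1}[z+j]$, $[k]!=\prod_{j=1}^k[j]$ (so $[z]_0=[0]!=1$), $\eta$ generic in the sense that $[k]\ne0$ for every integer $k\ge1$, $\gamma(z)=\Gamma(\eta z|\tau,2\eta)$ with $\Gamma(z|\tau,\tau')=\prod_{n,m\ge0}\frac{1-e^{2\pi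 i(\tau(n+1)+\tau'(m+1)-z)}}{1-e^{2\pi i(\tau n+\tau'm+z)}}$, and $$W(a)=e^{2\pi i a\eta z+\pi i\eta a^2}\frac{\gamma(2z)}{\gamma(2z+2a)}\sum_{k\ge0}\frac{[-z-a+2k]\,[-z-a]_k\,[-a]_k}{[-z-a]\,[-z+1]_k\,[k]!}\,e^{(a-2k)\partial},$$ $$X(a)=e^{-2\pi i\eta az_1}\frac{\gamma(z_1+z_2+a+1)}{\gamma(z_1+z_2-a+1)}\,\frac{\gamma(z_1-z_2+a+1)}{\gamma(z_1-z_2-a+1)}.$$ Operators are understood as formal series: in case (o) series in monomials $z^\lambda$ with coefficients that are meromorphic functions of $(z_1\partial_1,z_2\partial_2,z_3\partial_3)$; in case (q) series in the dilatations $q^{\alpha_1z_1\partial_1+\alpha_2z_2\partial_2+\alpha_3z_3\partial_3}$ with coefficients that are meromorphic functions of $(\log z_1,\log z_2,\log z_3)$; in case (e) series in the shifts $e^{\alpha_1\partial_1+\alpha_2\partial_2+\alpha_3\partial_3}$ with coefficients that are meromorphic functions of $(z_1,z_2,z_3)$. They are composed termwise, and two of them are equal when all their coefficients are equal. Define $$\check{\mathcal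 R}_{12}(\mathbf u)=\mathcal S_2(s_1s_3s_2\mathbf u)\,\mathcal S_1(s_3s_2\mathbf u)\,\mathcal S_3(s_2\mathbf u)\,\mathcal S_2(\mathbf u),\qquad \check{\mathcal R}_{23}(\mathbf u)=\mathcal S_4(s_3s_5s_4\mathbf u)\,\mathcal S_3(s_5s_4\mathbf u)\,\mathcal S_5(s_4\mathbf u)\,\mathcal S_4(\mathbf u).$$ Apart from the spins, $\check{\mathcal R}_{12}(\mathbf u)$ depends only on $u-v$ and $\check{\mathcal R}_{23}(\mathbf u)$ only on $v-w$; they are written $\check{\mathcal R}_{12}(u-v)$ and $\check{\mathcal R}_{23}(v-w)$, and the same notation is used after permuting the pairs $(u,\ell_1),(v,\ell_2),(w,\ell_3)$ among the sites. Then in each of the three cases $$\check{\mathcal R}_{23}(u-v)\,\check{\mathcal R}_{12}(u-w)\,\check{\mathcal R}_{23}(v-w)=\check{\mathcal R}_{12}(v-w)\,\check{\mathcal R}_{23}(u-w)\,\check{\mathcal R}_{12}(u-v),$$ where the spins $\ell_1,\ell_2,\ell_3$ accompany $u,v,w$ respectively. -/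

import Mathlib

open scoped BigOperators
open MeasureTheory

noncomputable section

namespace YBPerm

/-! ## Formal series of translation operators in three complex variables -/

/-- A formal operator `∑ₙ cₙ(x) T_{β + ∑ᵢ nᵢ stepᵢ}`, `n ∈ ℕʳ`, in the variables `x ∈ ℂ³`, where
`cₙ(x)` is multiplication by a function and `T_v` is the translation
`(T_v F)(x) = F(x + v)`. -/
@[ext]
structure FormalOp (r : ℕ) (step : Fin r → Fin 3 → ℂ) where
  base : Fin 3 → ℂ
  coeff : (Fin r →₀ ℕ) → (Fin 3 → ℂ) → ℂ

namespace FormalOp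

variable {r : ℕ} {step : Fin r → Fin 3 → ℂ}

/-- The translation vector of the term with index `n`. -/
def disp (A : FormalOp r step) (n : Fin r →₀ ℕ) : Fin 3 → ℂ :=
  A.base + ∑ i, (n i : ℂ) • step i

/-- Composition of formal operators: from `T_v d(x) = d(x + v) T_v` one has
`(c(x) T_v) (d(x) T_w) = c(x) d(x + v) T_{v + w}`, and each coefficient of the product of two
series is a finite sum. -/
instance : Mul (FormalOp r step) where
  mul A B :=
    { base := A.base + B.base
      coeff := fun N x =>
        ∑ p ∈ Finset.HasAntidiagonal.antidiagonal N, A.coeff p.1 x * B.coeff p.2 (x + A.disp p.1) }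

/-- Equality of formal operators: the same translations with the same coefficients. All
coefficients in use are meromorphic functions, given by formulas that are meaningful off a
null set of poles; equality of meromorphic functions is equality almost everywhere. -/
def Eqv (A B : FormalOp r step) : Prop :=
  A.base = B.base ∧ ∀ n, ∀ᵐ x : Fin 3 → ℂ, A.coeff n x = B.coeff n x

/-- The series `∑ₖ cₖ(x) T_{β + k stepᵢ}` in one of the elementary steps. -/
def series (β : Fin 3 → ℂ) (i : Fin r) (c : ℕ → (Fin 3 → ℂ) → ℂ) : FormalOp r step where
  base := β
  coeff n x := if n = Finsupp.single i (n i) then c (n i) x else 0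

/-- The operator of multiplication by a function. -/
def mulFn (f : (Fin 3 → ℂ) → ℂ) : FormalOp r step where
  base := 0
  coeff n x := if n = 0 then f x else 0

/-- The translation operator `T_v`. -/
def transl (v : Fin 3 → ℂ) : FormalOp r step where
  base := v
  coeff n _ := if n = 0 then 1 else 0

/-- `Φ(T)` for the translation `T = T_{stepᵢ}` and a function `Φ` holomorphic near `0`, by the
Taylor expansion of `Φ` at `0`. -/
def taylor (i : Fin r) (Φ : ℂ → ℂ) : FormalOp r step :=
  series 0 i fun k _ => iteratedDeriv k Φ 0 / (k.factorial : ℂ)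

/-- Composition respects equality of formal operators. -/
theorem Eqv.mul {A A' B B' : FormalOp r step} (hA : A.Eqv A') (hB : B.Eqv B') :
    (A * B).Eqv (A' * B') := by
  have hd : ∀ n, A.disp n = A'.disp n := fun n => by simp [disp, hA.1]
  refine ⟨by change A.base + B.base = A'.base + B'.base; rw [hA.1, hB.1], fun N => ?_⟩
  have h : ∀ p ∈ Finset.HasAntidiagonal.antidiagonal N, ∀ᵐ x : Fin 3 → ℂ,
      A.coeff p.1 x * B.coeff p.2 (x + A.disp p.1)
        = A'.coeff p.1 x * B'.coeff p.2 (x + A'.disp p.1) := by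
    intro p _
    filter_upwards [hA.2 p.1,
      (measurePreserving_add_right volume (A.disp p.1)).quasiMeasurePreserving.ae (hB.2 p.2)]
      with x h1 h2
    rw [h1, h2, hd]
  filter_upwards [(Finset.HasAntidiagonal.antidiagonal N).eventually_all.2 h] with x hx
  exact Finset.sum_congr rfl hx

end FormalOp

/-- The vector `a eᵢ` of `ℂ³`. -/
def ax (i : Fin 3) (a : ℂ) : Fin 3 → ℂ := Pi.single i a

/-! ## Parameters, transpositions and the check R-operators -/

/-- The elementary transposition of the parameters in positions `i`, `i + 1`. -/
def s (i : Fin 5) (p : Fin 6 → ℂ) : Fin 6 → ℂ := p ∘ Equiv.swap i.castSucc i.succ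

/-- The five operators `S₁, …, S₅` (here numbered `0, …, 4`) as functions of one argument, from
the intertwiners `W j` at the sites `j` and the operators `X j` at the neighbouring sites
`j, j + 1`. -/
def fiveOps {A : Type} (W : Fin 3 → ℂ → A) (X : Fin 2 → ℂ → A) : Fin 5 → ℂ → A :=
  ![W 0, X 0, W 1, X 1, W 2]

/-- `Sᵢ(𝐮) = Sᵢ(𝐮ᵢ - 𝐮ᵢ₊₁)`. -/
def atPar {A : Type} (S : Fin 5 → ℂ → A) (i : Fin 5) (p : Fin 6 → ℂ) : A :=
  S i (p i.castSucc - p i.succ)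

/-- `S₂(s₁s₃s₂𝐮) S₁(s₃s₂𝐮) S₃(s₂𝐮) S₂(𝐮)`. -/
def R12 {A : Type} [Mul A] (S : Fin 5 → ℂ → A) (p : Fin 6 → ℂ) : A :=
  atPar S 1 (s 0 (s 2 (s 1 p))) * atPar S 0 (s 2 (s 1 p)) * atPar S 2 (s 1 p) * atPar S 1 p

/-- `S₄(s₃s₅s₄𝐮) S₃(s₅s₄𝐮) S₅(s₄𝐮) S₄(𝐮)`. -/
def R23 {A : Type} [Mul A] (S : Fin 5 → ℂ → A) (p : Fin 6 → ℂ) : A :=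
  atPar S 3 (s 2 (s 4 (s 3 p))) * atPar S 2 (s 4 (s 3 p)) * atPar S 4 (s 3 p) * atPar S 3 p

/-- The parameters `(u₁,u₂,v₁,v₂,w₁,w₂)` of three sites with spectral parameters `u, v, w` and
spins `ℓ₁, ℓ₂, ℓ₃`: `u₁ = u/κ + ℓ₁`, `u₂ = u/κ - 1 - ℓ₁`, and so on (`κ = 2η`). -/
def params (κ u v w l₁ l₂ l₃ : ℂ) : Fin 6 → ℂ :=
  ![u / κ + l₁, u / κ - 1 - l₁, v / κ + l₂, v / κ - 1 - l₂, w / κ + l₃, w / κ - 1 - l₃]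

/-- `Ř₁₂` as a function of the difference `x` of the spectral parameters and of the spins
`l, l'` carried by the parameters of the sites 1 and 2 on which it acts. -/
def check12 {A : Type} [Mul A] (S : Fin 5 → ℂ → A) (κ x l l' : ℂ) : A :=
  R12 S (params κ x 0 0 l l' 0)

/-- `Ř₂₃` as a function of the difference `x` of the spectral parameters and of the spins
`l, l'` carried by the parameters of the sites 2 and 3 on which it acts. -/
def check23 {A : Type} [Mul A] (S : Fin 5 → ℂ → A) (κ x l l' : ℂ) : A :=
  R23 S (params κ 0 x 0 0 l l')

/-- `Ř₁₂` at the parameters `𝐮` depends only on `u - v` and the two spins. -/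
theorem R12_params {A : Type} [Mul A] (S : Fin 5 → ℂ → A) (κ u v w l₁ l₂ l₃ : ℂ) :
    R12 S (params κ u v w l₁ l₂ l₃) = check12 S κ (u - v) l₁ l₂ := by
  unfold check12 R12
  congr 1
  · congr 1
    · congr 1
      all_goals
        unfold atPar
        congr 1
        simp [s, params, Equiv.swap_apply_def, Fin.ext_iff, sub_div]
        ring
    · unfold atPar
      congr 1
      simp [s, params, Equiv.swap_apply_def, Fin.ext_iff, sub_div]
      ring
  · unfold atPar
    congr 1
    simp [params, sub_div]
    ring

/-- `Ř₂₃` at the parameters `𝐮` depends only on `v - w` and the two spins. -/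
theorem R23_params {A : Type} [Mul A] (S : Fin 5 → ℂ → A) (κ u v w l₁ l₂ l₃ : ℂ) :
    R23 S (params κ u v w l₁ l₂ l₃) = check23 S κ (v - w) l₂ l₃ := by
  unfold check23 R23
  congr 1
  · congr 1
    · congr 1
      all_goals
        unfold atPar
        congr 1
        simp [s, params, Equiv.swap_apply_def, Fin.ext_iff, sub_div]
        ring
    · unfold atPar
      congr 1
      simp [s, params, Equiv.swap_apply_def, Fin.ext_iff, sub_div]
      ring
  · unfold atPar
    congr 1
    simp [params, sub_div]
    ring

/-- The permutation `s₂s₁s₃s₂` exchanges the pairs of parameters of the sites 1 and 2. -/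
theorem s_params12 (κ u v w l₁ l₂ l₃ : ℂ) :
    s 1 (s 0 (s 2 (s 1 (params κ u v w l₁ l₂ l₃)))) = params κ v u w l₂ l₁ l₃ := by
  funext i
  fin_cases i <;> simp [s, params, Equiv.swap_apply_def, Fin.ext_iff]

/-- The permutation `s₄s₃s₅s₄` exchanges the pairs of parameters of the sites 2 and 3. -/
theorem s_params23 (κ u v w l₁ l₂ l₃ : ℂ) :
    s 3 (s 2 (s 4 (s 3 (params κ u v w l₁ l₂ l₃)))) = params κ u w v l₁ l₃ l₂ := by
  funext i
  fin_cases i <;> simp [s, params, Equiv.swap_apply_def, Fin.ext_iff]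

/-! ## No deformation

Formal series in monomials `z^λ` with coefficients functions of `d = (z₁∂₁, z₂∂₂, z₃∂₃)`. The
variable `x ∈ ℂ³` is `d`; by `z^λ f(d) = f(d - λ) z^λ` the monomial `z^λ` is the translation
`T_{-λ}`. The two elementary steps are the monomials `z₁/z₂` and `z₂/z₃`. -/

def stepO (j : Fin 2) : Fin 3 → ℂ := -(ax j.castSucc 1 - ax j.succ 1)

abbrev OpO := FormalOp 2 stepO

/-- The operator of multiplication by `z^λ`. -/
def monomialO (l : Fin 3 → ℂ) : OpO := FormalOp.transl (-l)

/-- `W(a) = zᵢ^{-a} Γ(zᵢ∂ᵢ + 1) / Γ(zᵢ∂ᵢ + 1 - a)`. -/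
def WO (i : Fin 3) (a : ℂ) : OpO :=
  monomialO (ax i (-a)) *
    FormalOp.mulFn fun d => Complex.Gamma (d i + 1) / Complex.Gamma (d i + 1 - a)

/-- `(zⱼ₊₁ - zⱼ)^a = zⱼ₊₁^a (1 - zⱼ/zⱼ₊₁)^a`, the last factor being expanded in powers of
`zⱼ/zⱼ₊₁`. -/
def XO (j : Fin 2) (a : ℂ) : OpO :=
  monomialO (ax j.succ a) * FormalOp.taylor j fun t => (1 - t) ^ a

def SO : Fin 5 → ℂ → OpO := fiveOps WO XO

/-! ## Quantum deformation

Here `q = e^h` with `Re h < 0`, and `q^a = e^{h a}`. The variable `x ∈ ℂ³` is the logarithm of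
`z`, so `zᵢ = e^{xᵢ}`, `zᵢ^a = e^{a xᵢ}`, and `q^{α zᵢ∂ᵢ}` is the translation `xᵢ ↦ xᵢ + α h`.
The elementary steps are the operators `q^{2 zᵢ∂ᵢ}`. -/

/-- `q^a`. -/
def qpow (h a : ℂ) : ℂ := Complex.exp (h * a)

/-- The infinite product `(x; q²) = ∏ₖ (1 - x q^{2k})`. -/
def qPoch (h x : ℂ) : ℂ := ∏' k : ℕ, (1 - x * qpow h (2 * k))

def stepQ (h : ℂ) (i : Fin 3) : Fin 3 → ℂ := ax i (2 * h)

abbrev OpQ (h : ℂ) := FormalOp 3 (stepQ h)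

/-- `W(a) = q^{a²/2} zᵢ^{-a} (q^{2-2a+2zᵢ∂ᵢ}; q²) / (q^{2+2zᵢ∂ᵢ}; q²) q^{-a zᵢ∂ᵢ}`, the quotient
of infinite products being expanded in powers of `q^{2zᵢ∂ᵢ}`. -/
def WQ (h : ℂ) (i : Fin 3) (a : ℂ) : OpQ h :=
  FormalOp.mulFn (fun x => qpow h (a ^ 2 / 2) * Complex.exp (-a * x i)) *
    FormalOp.taylor i (fun t => qPoch h (qpow h (2 - 2 * a) * t) / qPoch h (qpow h 2 * t)) *
    FormalOp.transl (ax i (-a * h))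

/-- Multiplication by `zⱼ^a (q^{1-a} zⱼ₊₁/zⱼ; q²) / (q^{1+a} zⱼ₊₁/zⱼ; q²)`. -/
def XQ (h : ℂ) (j : Fin 2) (a : ℂ) : OpQ h :=
  FormalOp.mulFn fun x =>
    Complex.exp (a * x j.castSucc) *
      (qPoch h (Complex.exp (x j.succ - x j.castSucc) * qpow h (1 - a)) /
        qPoch h (Complex.exp (x j.succ - x j.castSucc) * qpow h (1 + a)))

def SQ (h : ℂ) : Fin 5 → ℂ → OpQ h := fiveOps (WQ h) (XQ h)

/-! ## Elliptic deformation

The variable `x ∈ ℂ³` is `z`; the elementary steps are the shifts `e^{-2∂ᵢ}`. -/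

/-- `θ₁(z|τ)`. -/
def theta1 (τ z : ℂ) : ℂ :=
  ∑' n : ℤ, Complex.exp (Real.pi * Complex.I * ((n : ℂ) + 1 / 2) ^ 2 * τ) *
    Complex.exp (2 * Real.pi * Complex.I * ((n : ℂ) + 1 / 2) * (z + 1 / 2))

/-- The elliptic gamma function `Γ(z|τ,τ')`. -/
def ellGamma (τ τ' z : ℂ) : ℂ :=
  ∏' p : ℕ × ℕ,
    (1 - Complex.exp (2 * Real.pi * Complex.I *
        (τ * ((p.1 : ℂ) + 1) + τ' * ((p.2 : ℂ) + 1) - z))) /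
      (1 - Complex.exp (2 * Real.pi * Complex.I * (τ * (p.1 : ℂ) + τ' * (p.2 : ℂ) + z)))

/-- `γ(z) = Γ(ηz|τ,2η)`. -/
def gam (τ η z : ℂ) : ℂ := ellGamma τ (2 * η) (η * z)

/-- The elliptic number `[z] = θ₁(2ηz|τ)`. -/
def ell (τ η z : ℂ) : ℂ := theta1 τ (2 * η * z)

/-- `[z]ₖ = [z][z+1]⋯[z+k-1]`. -/
def ellPoch (τ η z : ℂ) (k : ℕ) : ℂ := ∏ j ∈ Finset.range k, ell τ η (z + j)

/-- `[k]! = [1][2]⋯[k]`. -/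
def ellFact (τ η : ℂ) (k : ℕ) : ℂ := ∏ j ∈ Finset.range k, ell τ η ((j : ℂ) + 1)

def stepE (i : Fin 3) : Fin 3 → ℂ := ax i (-2)

abbrev OpE := FormalOp 3 stepE

/-- The coefficient of `e^{(a-2k)∂}` in the series for the intertwiner. -/
def coefE (τ η a : ℂ) (k : ℕ) (z : ℂ) : ℂ :=
  ell τ η (-z - a + 2 * k) * ellPoch τ η (-z - a) k * ellPoch τ η (-a) k /
    (ell τ η (-z - a) * ellPoch τ η (-z + 1) k * ellFact τ η k)

/-- `W(a) = e^{2πi a η zᵢ + πi η a²} γ(2zᵢ)/γ(2zᵢ+2a)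
  ∑ₖ [-zᵢ-a+2k][-zᵢ-a]ₖ[-a]ₖ / ([-zᵢ-a][-zᵢ+1]ₖ[k]!) e^{(a-2k)∂ᵢ}`. -/
def WE (τ η : ℂ) (i : Fin 3) (a : ℂ) : OpE :=
  FormalOp.mulFn (fun z =>
      Complex.exp (2 * Real.pi * Complex.I * a * η * z i + Real.pi * Complex.I * η * a ^ 2) *
        (gam τ η (2 * z i) / gam τ η (2 * z i + 2 * a))) *
    FormalOp.series (ax i a) i fun k z => coefE τ η a k (z i)

/-- Multiplication by `e^{-2πi η a zⱼ} γ(zⱼ+zⱼ₊₁+a+1)/γ(zⱼ+zⱼ₊₁-a+1) ·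
γ(zⱼ-zⱼ₊₁+a+1)/γ(zⱼ-zⱼ₊₁-a+1)`. -/
def XE (τ η : ℂ) (j : Fin 2) (a : ℂ) : OpE :=
  FormalOp.mulFn fun z =>
    Complex.exp (-2 * Real.pi * Complex.I * η * a * z j.castSucc) *
      (gam τ η (z j.castSucc + z j.succ + a + 1) / gam τ η (z j.castSucc + z j.succ - a + 1)) *
      (gam τ η (z j.castSucc - z j.succ + a + 1) / gam τ η (z j.castSucc - z j.succ - a + 1))

def SE (τ η : ℂ) : Fin 5 → ℂ → OpE := fiveOps (WE τ η) (XE τ η)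

/-! ## The Yang–Baxter relation -/

/-- `Ř₂₃(u-v) Ř₁₂(u-w) Ř₂₃(v-w) = Ř₁₂(v-w) Ř₂₃(u-w) Ř₁₂(u-v)`, with spins `l₁, l₂, l₃` attached
to the spectral parameters `u, v, w`. -/
def YangBaxter {r : ℕ} {step : Fin r → Fin 3 → ℂ} (S : Fin 5 → ℂ → FormalOp r step)
    (κ u v w l₁ l₂ l₃ : ℂ) : Prop :=
  FormalOp.Eqv
    (check23 S κ (u - v) l₁ l₂ * check12 S κ (u - w) l₁ l₃ * check23 S κ (v - w) l₂ l₃)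
    (check12 S κ (v - w) l₂ l₃ * check23 S κ (u - w) l₁ l₃ * check12 S κ (u - v) l₁ l₂)

end YBPerm

end

/-!
Both sides of the Yang–Baxter relation are products of the twelve operators `Sᵢ(𝐩)` along a reduced
word of one and the same permutation of the six parameters, so the relation follows from
commutativity of distant `Sᵢ` and the braid relations
`Sᵢ(a) Sᵢ₊₁(a + b) Sᵢ(b) = Sᵢ₊₁(b) Sᵢ(a + b) Sᵢ₊₁(a)`, applied in the quotient of the formal
operators by equality almost everywhere (`yangBaxter_of_eqv`). One `W` and one `X` enter each braid
relation, which is therefore a star-triangle relation for operators in one variable `z`, with the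
other variable `y` as a parameter.

Comparing coefficients, a star-triangle relation is a terminating summation formula: the
Pfaff–Saalschütz sum without deformation, its `q`-analogue, and the Frenkel–Turaev sum in the
elliptic case. All of them follow from a three-term identity for a bracket `[x]`, namely `x`,
`q^x - q^{-x}` and `θ₁(2ηx|τ)` respectively. Multiplying by one more factor and splitting it by the
three-term identity gives a Pascal recursion, and induction on the order gives the expansions
`poch_expansion` and `elliptic_expansion`, whence `gamma_star₁` and `gamma_star₂`,
`saalschutz_star`, and `elliptic_star`. The functions in `W` and `X` enter only through
`g(x + 1) = [x] g(x)` (`GammaLike`), and only at arguments off the zeros and poles, hence almost everywhere.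

The analytic input is as follows. Without deformation, it is the binomial series. In the quantum
case, the `q`-binomial theorem `qbinomSeries_eq` expands the quotient of infinite products. In the
elliptic case, `θ₁(x + y) θ₁(x - y)` is a `2 × 2` determinant of a function of `x` and a function of
`y` (`theta1_mul_theta1`), so the three-term identity is a Plücker relation; and the elliptic gamma
function satisfies `γ(2v + 2) ∼ [v] γ(2v)` (`exists_gamShift`) by the Jacobi triple product
(`tsum_jacobiTheta₂_term_eq`), whose constant need not be known.
-/

noncomputable section

namespace YBPerm

open Filter Topology

/-! ### The algebra of formal operators -/

namespace FormalOp

variable {r : ℕ} {step : Fin r → Fin 3 → ℂ}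

theorem base_mul (A B : FormalOp r step) : (A * B).base = A.base + B.base := rfl

theorem coeff_mul (A B : FormalOp r step) (N : Fin r →₀ ℕ) (x : Fin 3 → ℂ) :
    (A * B).coeff N x = ∑ p ∈ Finset.HasAntidiagonal.antidiagonal N,
      A.coeff p.1 x * B.coeff p.2 (x + A.disp p.1) := rfl

theorem disp_mul (A B : FormalOp r step) (m n : Fin r →₀ ℕ) :
    (A * B).disp (m + n) = A.disp m + B.disp n := by
  simp only [disp, base_mul, Finsupp.add_apply, Nat.cast_add, add_smul, Finset.sum_add_distrib]
  abel

protected theorem mul_assoc (A B C : FormalOp r step) : A * B * C = A * (B * C) := by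
  ext1
  · simp only [base_mul, add_assoc]
  funext N x
  simp only [coeff_mul, Finset.sum_mul, Finset.mul_sum, Finset.sum_sigma']
  apply Finset.sum_nbij' (fun ⟨⟨_i, j⟩, ⟨k, l⟩⟩ ↦ ⟨(k, l + j), (l, j)⟩)
    (fun ⟨⟨i, _j⟩, ⟨k, l⟩⟩ ↦ ⟨(i + k, l), (i, k)⟩)
  · rintro ⟨⟨i, j⟩, ⟨k, l⟩⟩ h
    simp only [Finset.mem_sigma, Finset.HasAntidiagonal.mem_antidiagonal] at h ⊢
    exact ⟨by rw [← h.1, ← h.2, add_assoc], trivial⟩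
  · rintro ⟨⟨i, j⟩, ⟨k, l⟩⟩ h
    simp only [Finset.mem_sigma, Finset.HasAntidiagonal.mem_antidiagonal] at h ⊢
    exact ⟨by rw [← h.1, ← h.2, add_assoc], trivial⟩
  · rintro ⟨⟨i, j⟩, ⟨k, l⟩⟩ h
    simp only [Finset.mem_sigma, Finset.HasAntidiagonal.mem_antidiagonal] at h
    obtain ⟨h1, rfl⟩ := h
    rfl
  · rintro ⟨⟨i, j⟩, ⟨k, l⟩⟩ h
    simp only [Finset.mem_sigma, Finset.HasAntidiagonal.mem_antidiagonal] at h
    obtain ⟨h1, rfl⟩ := h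
    rfl
  · rintro ⟨⟨i, j⟩, ⟨k, l⟩⟩ h
    simp only [Finset.mem_sigma, Finset.HasAntidiagonal.mem_antidiagonal] at h
    obtain ⟨h1, rfl⟩ := h
    simp only [disp_mul, mul_assoc, add_assoc]

theorem Eqv.equivalence : Equivalence (Eqv (r := r) (step := step)) where
  refl A := ⟨rfl, fun _ => .of_forall fun _ => rfl⟩
  symm h := ⟨h.1.symm, fun n => (h.2 n).mono fun _ h => h.symm⟩
  trans h h' := ⟨h.1.trans h'.1, fun n => by
    filter_upwards [h.2 n, h'.2 n] with x h1 h2 using h1.trans h2⟩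

/-- Equality of formal operators as a congruence for composition. -/
def eqvCon (r : ℕ) (step : Fin r → Fin 3 → ℂ) : Con (FormalOp r step) where
  r := Eqv
  iseqv := Eqv.equivalence
  mul' := Eqv.mul

instance : Semigroup (FormalOp r step) where
  mul_assoc := FormalOp.mul_assoc

theorem series_base (β : Fin 3 → ℂ) (i : Fin r) (c : ℕ → (Fin 3 → ℂ) → ℂ) :
    (series (step := step) β i c).base = β := rfl

theorem series_coeff_single (β : Fin 3 → ℂ) (i : Fin r) (c : ℕ → (Fin 3 → ℂ) → ℂ) (k : ℕ) (x) :
    (series (step := step) β i c).coeff (Finsupp.single i k) x = c k x := by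
  simp [series]

theorem disp_single (A : FormalOp r step) (i : Fin r) (k : ℕ) :
    A.disp (Finsupp.single i k) = A.base + (k : ℂ) • step i := by
  simp [disp, Finsupp.single_apply, ite_smul]

theorem series_mul (β β' : Fin 3 → ℂ) (i : Fin r) (c c' : ℕ → (Fin 3 → ℂ) → ℂ) :
    series (step := step) β i c * series β' i c' =
      series (β + β') i fun N x => ∑ p ∈ Finset.HasAntidiagonal.antidiagonal N,
        c p.1 x * c' p.2 (x + (β + (p.1 : ℂ) • step i)) := by
  ext1
  · rfl
  funext N x
  by_cases hN : N = Finsupp.single i (N i)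
  · rw [hN, series_coeff_single, coeff_mul, Finsupp.antidiagonal_single, Finset.sum_map]
    refine Finset.sum_congr rfl fun p _ => ?_
    simp only [Function.Embedding.coe_prodMap, Function.Embedding.coeFn_mk, Prod.map_fst,
      Prod.map_snd, series_coeff_single, disp_single, series_base]
  · rw [coeff_mul]
    trans 0
    · refine Finset.sum_eq_zero fun p hp => ?_
      rw [Finset.HasAntidiagonal.mem_antidiagonal] at hp
      by_cases h1 : p.1 = Finsupp.single i (p.1 i)
      · by_cases h2 : p.2 = Finsupp.single i (p.2 i)
        · refine absurd ?_ hN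
          rw [← hp, Finsupp.add_apply, Finsupp.single_add, ← h1, ← h2]
        · simp only [series, if_neg h2, mul_zero]
      · simp only [series, if_neg h1, zero_mul]
    · simp only [series, if_neg hN]

theorem mulFn_eq_series (i : Fin r) (f : (Fin 3 → ℂ) → ℂ) :
    mulFn (step := step) f = series 0 i fun k x => if k = 0 then f x else 0 := by
  ext1
  · rfl
  funext N x
  simp only [mulFn, series]
  by_cases h : N = 0
  · simp [h]
  · by_cases h2 : N = Finsupp.single i (N i)
    · have : N i ≠ 0 := fun h0 => h (by rw [h2, h0, Finsupp.single_zero])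
      rw [if_neg h, if_pos h2, if_neg this]
    · rw [if_neg h, if_neg h2]

theorem transl_eq_series (i : Fin r) (v : Fin 3 → ℂ) :
    transl (step := step) v = series v i fun k _ => if k = 0 then 1 else 0 := by
  ext1
  · rfl
  funext N x
  simp only [transl, series]
  by_cases h : N = 0
  · simp [h]
  · by_cases h2 : N = Finsupp.single i (N i)
    · have : N i ≠ 0 := fun h0 => h (by rw [h2, h0, Finsupp.single_zero])
      rw [if_neg h, if_pos h2, if_neg this]
    · rw [if_neg h, if_neg h2]

theorem mulFn_mul_series (f : (Fin 3 → ℂ) → ℂ) (β : Fin 3 → ℂ) (i : Fin r)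
    (c : ℕ → (Fin 3 → ℂ) → ℂ) :
    mulFn f * series (step := step) β i c = series β i fun k x => f x * c k x := by
  rw [mulFn_eq_series i, series_mul, zero_add]
  congr 1
  funext N x
  rw [Finset.sum_eq_single (0, N)]
  · simp
  · rintro ⟨m, n⟩ h1 h2
    have : m ≠ 0 := by
      rintro rfl
      simp_all
    simp [this]
  · simp

theorem series_mul_mulFn (f : (Fin 3 → ℂ) → ℂ) (β : Fin 3 → ℂ) (i : Fin r)
    (c : ℕ → (Fin 3 → ℂ) → ℂ) :
    series (step := step) β i c * mulFn f =
      series β i fun k x => c k x * f (x + (β + (k : ℂ) • step i)) := by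
  rw [mulFn_eq_series i, series_mul, add_zero]
  congr 1
  funext N x
  rw [Finset.sum_eq_single (N, 0)]
  · simp
  · rintro ⟨m, n⟩ h1 h2
    have : n ≠ 0 := by
      rintro rfl
      simp_all
    simp [this]
  · simp

theorem transl_mul_series (v β : Fin 3 → ℂ) (i : Fin r) (c : ℕ → (Fin 3 → ℂ) → ℂ) :
    transl v * series (step := step) β i c = series (v + β) i fun k x => c k (x + v) := by
  rw [transl_eq_series i, series_mul]
  congr 1
  funext N x
  rw [Finset.sum_eq_single (0, N)]
  · simp
  · rintro ⟨m, n⟩ h1 h2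
    have : m ≠ 0 := by
      rintro rfl
      simp_all
    simp [this]
  · simp

theorem series_mul_transl (v β : Fin 3 → ℂ) (i : Fin r) (c : ℕ → (Fin 3 → ℂ) → ℂ) :
    series (step := step) β i c * transl v = series (β + v) i c := by
  rw [transl_eq_series i, series_mul]
  congr 1
  funext N x
  rw [Finset.sum_eq_single (N, 0)]
  · simp
  · rintro ⟨m, n⟩ h1 h2
    have : n ≠ 0 := by
      rintro rfl
      simp_all
    simp [this]
  · simp

theorem mulFn_mul_mulFn (f g : (Fin 3 → ℂ) → ℂ) :
    mulFn (step := step) f * mulFn g = mulFn fun x => f x * g x := by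
  ext1
  · exact add_zero _
  funext N x
  rw [coeff_mul]
  by_cases hN : N = 0
  · simp [hN, mulFn, disp]
  · refine (Finset.sum_eq_zero fun p hp => ?_).trans (by simp [mulFn, hN])
    rw [Finset.HasAntidiagonal.mem_antidiagonal] at hp
    by_cases h1 : p.1 = 0
    · have h2 : p.2 ≠ 0 := fun h2 => hN (by rw [← hp, h1, h2, add_zero])
      simp [mulFn, h2]
    · simp [mulFn, h1]

theorem mulFn_comm (f g : (Fin 3 → ℂ) → ℂ) :
    mulFn (step := step) f * mulFn g = mulFn g * mulFn f := by
  rw [mulFn_mul_mulFn, mulFn_mul_mulFn]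
  congr 1
  funext x
  exact mul_comm _ _

theorem series_mul_mulFn_comm {f : (Fin 3 → ℂ) → ℂ} {β : Fin 3 → ℂ} {i : Fin r}
    (c : ℕ → (Fin 3 → ℂ) → ℂ) (h : ∀ (k : ℕ) x, f (x + (β + (k : ℂ) • step i)) = f x) :
    series (step := step) β i c * mulFn f = mulFn f * series β i c := by
  rw [series_mul_mulFn, mulFn_mul_series]
  congr 1
  funext k x
  rw [h, mul_comm]

/-- Two series commute when their terms commute. -/
theorem series_mul_comm {β β' : Fin 3 → ℂ} {i i' : Fin r} {c c' : ℕ → (Fin 3 → ℂ) → ℂ}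
    (h : ∀ m n x, c m x * c' n (x + (β + (m : ℂ) • step i)) =
      c' n x * c m (x + (β' + (n : ℂ) • step i'))) :
    (series (step := step) β i c * series β' i' c').Eqv (series β' i' c' * series β i c) := by
  refine ⟨add_comm _ _, fun N => .of_forall fun x => ?_⟩
  rw [coeff_mul, coeff_mul]
  refine Finset.sum_nbij' Prod.swap Prod.swap (fun p hp => ?_) (fun p hp => ?_) (fun _ _ => rfl)
    (fun _ _ => rfl) fun p _ => ?_
  · simpa [Finset.HasAntidiagonal.mem_antidiagonal, add_comm] using hp
  · simpa [Finset.HasAntidiagonal.mem_antidiagonal, add_comm] using hp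
  · simp only [Prod.fst_swap, Prod.snd_swap]
    by_cases h1 : p.1 = Finsupp.single i (p.1 i)
    · by_cases h2 : p.2 = Finsupp.single i' (p.2 i')
      · rw [h1, h2, series_coeff_single, series_coeff_single, series_coeff_single,
          series_coeff_single, disp_single, disp_single, series_base, series_base, h]
      · simp only [series, if_neg h2, mul_zero, zero_mul]
    · simp only [series, if_neg h1, mul_zero, zero_mul]

theorem series_eqv {β β' : Fin 3 → ℂ} {i : Fin r} {c c' : ℕ → (Fin 3 → ℂ) → ℂ} (hβ : β = β')
    (h : ∀ k, ∀ᵐ x : Fin 3 → ℂ, c k x = c' k x) :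
    (series (step := step) β i c).Eqv (series β' i c') := by
  refine ⟨hβ, fun N => ?_⟩
  filter_upwards [h (N i)] with x hx
  simp only [series, hx]

end FormalOp

/-! ### The Yang–Baxter relation from star-triangle and commutation relations -/

theorem R12_eq {A : Type} [Mul A] (S : Fin 5 → ℂ → A) (p : Fin 6 → ℂ) :
    R12 S p = S 1 (p 0 - p 3) * S 0 (p 0 - p 2) * S 2 (p 1 - p 3) * S 1 (p 1 - p 2) := by
  simp [R12, atPar, s, Equiv.swap_apply_def, Fin.ext_iff]

theorem R23_eq {A : Type} [Mul A] (S : Fin 5 → ℂ → A) (p : Fin 6 → ℂ) :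
    R23 S p = S 3 (p 2 - p 5) * S 2 (p 2 - p 4) * S 4 (p 3 - p 5) * S 3 (p 3 - p 4) := by
  simp [R23, atPar, s, Equiv.swap_apply_def, Fin.ext_iff]

/-- Both sides of the Yang–Baxter relation are reduced words for the permutation which reverses
the order of three pairs, so braid and commutation moves connect them. -/
theorem yangBaxter_of_braid {M : Type} [Semigroup M] (S : Fin 5 → ℂ → M)
    (comm : ∀ i j : Fin 5, i.val + 1 < j.val → ∀ a b, S i a * S j b = S j b * S i a)
    (braid : ∀ (i : Fin 4) (a b : ℂ),
      S i.castSucc a * S i.succ (a + b) * S i.castSucc b =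
        S i.succ b * S i.castSucc (a + b) * S i.succ a)
    (κ u v w l₁ l₂ l₃ : ℂ) :
    check23 S κ (u - v) l₁ l₂ * check12 S κ (u - w) l₁ l₃ * check23 S κ (v - w) l₂ l₃ =
      check12 S κ (v - w) l₂ l₃ * check23 S κ (u - w) l₁ l₃ * check12 S κ (u - v) l₁ l₂ := by
  have c (i j : Fin 5) (h : i.val + 1 < j.val) (a b : ℂ) (X : M) :
      S i a * (S j b * X) = S j b * (S i a * X) := by
    rw [← mul_assoc, comm i j h, mul_assoc]
  have t (i : Fin 4) (x y z : ℂ) (X : M) :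
      S i.castSucc (y - z) * (S i.succ (x - z) * (S i.castSucc (x - y) * X)) =
        S i.succ (x - y) * (S i.castSucc (x - z) * (S i.succ (y - z) * X)) := by
    have := braid i (y - z) (x - y)
    rw [show y - z + (x - y) = x - z by ring] at this
    simp only [← mul_assoc, this]
  have c02 := c 0 2 (by decide)
  have c03 := c 0 3 (by decide)
  have c04 := c 0 4 (by decide)
  have c13 := c 1 3 (by decide)
  have c14 := c 1 4 (by decide)
  have c24 := c 2 4 (by decide)
  have e13 := comm 1 3 (by decide)
  have t0 : ∀ (x y z : ℂ) (X : M), S 0 (y - z) * (S 1 (x - z) * (S 0 (x - y) * X)) =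
    S 1 (x - y) * (S 0 (x - z) * (S 1 (y - z) * X)) := t 0
  have t1 : ∀ (x y z : ℂ) (X : M), S 1 (y - z) * (S 2 (x - z) * (S 1 (x - y) * X)) =
    S 2 (x - y) * (S 1 (x - z) * (S 2 (y - z) * X)) := t 1
  have t2 : ∀ (x y z : ℂ) (X : M), S 2 (y - z) * (S 3 (x - z) * (S 2 (x - y) * X)) =
    S 3 (x - y) * (S 2 (x - z) * (S 3 (y - z) * X)) := t 2
  have t3 : ∀ (x y z : ℂ) (X : M), S 3 (y - z) * (S 4 (x - z) * (S 3 (x - y) * X)) =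
    S 4 (x - y) * (S 3 (x - z) * (S 4 (y - z) * X)) := t 3
  rw [← R23_params S κ w u v l₃ l₁ l₂, ← R12_params S κ u w v l₁ l₃ l₂,
    ← R23_params S κ u v w l₁ l₂ l₃, ← R12_params S κ v w u l₂ l₃ l₁,
    ← R23_params S κ v u w l₂ l₁ l₃, ← R12_params S κ u v w l₁ l₂ l₃]
  simp only [R12_eq, R23_eq]
  have hp (u v w l₁ l₂ l₃ : ℂ) : ∀ i, params κ u v w l₁ l₂ l₃ i =
    ![u / κ + l₁, u / κ - 1 - l₁, v / κ + l₂, v / κ - 1 - l₂, w / κ + l₃, w / κ - 1 - l₃] i :=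
      fun _ => rfl
  simp only [hp]
  simp only [Matrix.cons_val]
  generalize u / κ + l₁ = u₁
  generalize u / κ - 1 - l₁ = u₂
  generalize v / κ + l₂ = v₁
  generalize v / κ - 1 - l₂ = v₂
  generalize w / κ + l₃ = w₁
  generalize w / κ - 1 - l₃ = w₂
  simp only [mul_assoc]
  -- The eight braid moves `t` and the commutations `c` that connect the two reduced words.
  rw [← c13 (u₁ - w₂) (u₂ - v₁), ← c14 (u₁ - w₂) (u₂ - v₂), ← c03 (u₁ - w₁) (u₂ - v₁), c13 (u₂ -
    w₁) (v₁ - w₂), ← t2, c02 (u₁ - w₁) (v₁ - w₂), ← c24 (v₁ - w₂) (u₂ - v₂), ← t1, ← c13 (v₁ -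
    w₂) (u₁ - v₂), ← c04 (u₁ - w₁) (u₂ - v₂), ← t1, ← c13 (v₁ - w₁) (u₂ - w₂), ← c14 (v₁ - w₁)
    (u₂ - v₂), ← t0, ← c02 (v₁ - w₁) (u₁ - w₂), ← c03 (v₁ - w₁) (u₁ - v₂), c14 (u₂ - v₁) (v₂ -
    w₂), c24 (u₂ - w₁) (v₂ - w₂), ← t3, c03 (u₁ - v₁) (v₂ - w₂), c13 (u₁ - w₁) (v₂ - w₂), ← t2,
    e13 (u₂ - v₁) (v₂ - w₁), ← t2, ← c24 (v₂ - w₁) (u₂ - w₂), c02 (u₁ - v₁) (v₂ - w₁), ← t1, ←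
    c13 (v₂ - w₁) (u₁ - w₂), c04 (u₁ - v₁) (u₂ - w₂), c03 (u₁ - v₁) (u₂ - w₁), c14 (u₁ - v₂) (u₂
    - w₂), c13 (u₁ - v₂) (u₂ - w₁)]

/-- The Yang–Baxter relation for formal operators from the star-triangle relations and the
commutation relations of the intertwiners. -/
theorem yangBaxter_of_eqv {r : ℕ} {step : Fin r → Fin 3 → ℂ} (W : Fin 3 → ℂ → FormalOp r step)
    (X : Fin 2 → ℂ → FormalOp r step)
    (hWW : ∀ i j, i < j → ∀ a b, (W i a * W j b).Eqv (W j b * W i a))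
    (hXX : ∀ a b, (X 0 a * X 1 b).Eqv (X 1 b * X 0 a))
    (hWX : ∀ a b, (W 0 a * X 1 b).Eqv (X 1 b * W 0 a))
    (hXW : ∀ a b, (X 0 a * W 2 b).Eqv (W 2 b * X 0 a))
    (star₁ : ∀ j a b, (W j.castSucc a * X j (a + b) * W j.castSucc b).Eqv
      (X j b * W j.castSucc (a + b) * X j a))
    (star₂ : ∀ j a b, (X j a * W j.succ (a + b) * X j b).Eqv
      (W j.succ b * X j (a + b) * W j.succ a))
    (κ u v w l₁ l₂ l₃ : ℂ) : YangBaxter (fiveOps W X) κ u v w l₁ l₂ l₃ := by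
  let S : Fin 5 → ℂ → (FormalOp.eqvCon r step).Quotient := fun i a => (fiveOps W X i a : _)
  have h12 (κ x l l' : ℂ) : check12 S κ x l l' = (check12 (fiveOps W X) κ x l l' : _) := by
    simp only [check12, R12, atPar, S, Con.coe_mul]
  have h23 (κ x l l' : ℂ) : check23 S κ x l l' = (check23 (fiveOps W X) κ x l l' : _) := by
    simp only [check23, R23, atPar, S, Con.coe_mul]
  have := yangBaxter_of_braid S ?_ ?_ κ u v w l₁ l₂ l₃
  · simp only [h12, h23, ← Con.coe_mul] at this
    exact (FormalOp.eqvCon r step).eq.1 this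
  · intro i j hij a b
    refine (FormalOp.eqvCon r step).eq.2 ?_
    change (fiveOps W X i a * fiveOps W X j b).Eqv (fiveOps W X j b * fiveOps W X i a)
    match i, j, hij with
    | 0, 2, _ => exact hWW 0 1 (by decide) a b
    | 0, 3, _ => exact hWX a b
    | 0, 4, _ => exact hWW 0 2 (by decide) a b
    | 1, 3, _ => exact hXX a b
    | 1, 4, _ => exact hXW a b
    | 2, 4, _ => exact hWW 1 2 (by decide) a b
    | 3, ⟨j, hj⟩, h => exact absurd h (by simp; omega)
    | 4, ⟨j, hj⟩, h => exact absurd h (by simp; omega)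
  · intro i a b
    refine (FormalOp.eqvCon r step).eq.2 ?_
    match i with
    | 0 => exact star₁ 0 a b
    | 1 => exact star₂ 0 a b
    | 2 => exact star₁ 1 a b
    | 3 => exact star₂ 1 a b

/-! ### Shifted factorials and terminating summation formulas -/

/-- The shifted factorial `F(x) F(x+1) ⋯ F(x+k-1)`. -/
def poch (F : ℂ → ℂ) (x : ℂ) (k : ℕ) : ℂ := ∏ j ∈ Finset.range k, F (x + j)

section Poch

variable (F : ℂ → ℂ)

@[simp] theorem poch_zero (x : ℂ) : poch F x 0 = 1 := by simp [poch]

theorem poch_succ (x : ℂ) (k : ℕ) : poch F x (k + 1) = poch F x k * F (x + k) := by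
  simp [poch, Finset.prod_range_succ]

theorem poch_add (x : ℂ) (m n : ℕ) : poch F x (m + n) = poch F x m * poch F (x + m) n := by
  simp [poch, Finset.prod_range_add, add_assoc]

theorem poch_succ_left (x : ℂ) (k : ℕ) : poch F x (k + 1) = F x * poch F (x + 1) k := by
  rw [add_comm k 1, poch_add]
  simp [poch_succ]

variable {F}

theorem poch_reflect (hodd : ∀ x, F (-x) = -F x) (x : ℂ) (k : ℕ) :
    poch F x k = (-1) ^ k * poch F (1 - x - k) k := by
  simp only [poch]
  rw [← Finset.prod_range_reflect, ← Finset.card_range k, ← Finset.prod_const,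
    Finset.card_range, ← Finset.prod_mul_distrib]
  refine Finset.prod_congr rfl fun j hj => ?_
  have hj := Finset.mem_range.1 hj
  rw [neg_one_mul, ← hodd]
  congr 1
  rw [Nat.sub_sub, Nat.cast_sub (by omega)]
  push_cast
  ring

theorem poch_ne_zero {x : ℂ} {k : ℕ} (h : ∀ j < k, F (x + j) ≠ 0) : poch F x k ≠ 0 :=
  Finset.prod_ne_zero_iff.2 fun j hj => h j (Finset.mem_range.1 hj)

/-- A solution of `g(s + 1) = F(s) g(s)` is moved by shifted factorials. -/
theorem map_add_nat_eq_poch_mul {g : ℂ → ℂ} {s : ℂ}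
    (h : ∀ n : ℕ, g (s + n + 1) = F (s + n) * g (s + n)) (k : ℕ) :
    g (s + k) = poch F s k * g s := by
  induction k with
  | zero => simp
  | succ k ih => rw [poch_succ, Nat.cast_succ, ← add_assoc, h, ih]; ring

end Poch

/-- Summation over an antidiagonal of an array that satisfies a Pascal recursion. -/
theorem sum_antidiagonal_succ_of_pascal {C F G : ℕ → ℕ → ℂ}
    (h : ∀ m n, C (m + 1) (n + 1) = F (m + 1) n + G m (n + 1))
    (h₀ : ∀ n, C 0 (n + 1) = F 0 n) (h₁ : ∀ m, C (m + 1) 0 = G m 0) (N : ℕ) :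
    ∑ p ∈ Finset.HasAntidiagonal.antidiagonal (N + 1), C p.1 p.2 =
      ∑ p ∈ Finset.HasAntidiagonal.antidiagonal N, (F p.1 p.2 + G p.1 p.2) := by
  let F' : ℕ × ℕ → ℂ := fun p => if p.2 = 0 then 0 else F p.1 (p.2 - 1)
  let G' : ℕ × ℕ → ℂ := fun p => if p.1 = 0 then 0 else G (p.1 - 1) p.2
  have hC : ∀ p ∈ Finset.HasAntidiagonal.antidiagonal (N + 1), C p.1 p.2 = F' p + G' p := by
    rintro ⟨m, n⟩ hp
    rw [Finset.HasAntidiagonal.mem_antidiagonal] at hp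
    rcases m with _ | m <;> rcases n with _ | n
    · simp at hp
    · simp [F', G', h₀]
    · simp [F', G', h₁]
    · simp [F', G', h]
  rw [Finset.sum_congr rfl hC, Finset.sum_add_distrib, Finset.sum_add_distrib,
    Finset.Nat.sum_antidiagonal_succ (f := G'), Finset.Nat.sum_antidiagonal_succ' (f := F')]
  simp [F', G']

variable {F : ℂ → ℂ}

/-- The expansion of a shifted factorial of `c + y` in products of shifted factorials of `A + y`
(descending) and of `B + y` (ascending), for an odd function with the addition formula of `x` and
`sinh x`. Up to the change of parameters this is the (`q`-)Pfaff–Saalschütz sum; the coefficients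
obey a Pascal recursion. -/
theorem poch_expansion (hodd : ∀ x, F (-x) = -F x)
    (hF : ∀ p q r s, F (p - q) * F (r - s) - F (p - r) * F (q - s) + F (p - s) * F (q - r) = 0)
    (hk : ∀ k : ℕ, F (k + 1) ≠ 0) (A B c y : ℂ) (N : ℕ) :
    poch F (B - A) N * poch F (c + y) N = ∑ p ∈ Finset.HasAntidiagonal.antidiagonal N,
      (-1) ^ p.1 * (poch F 1 (p.1 + p.2) / (poch F 1 p.1 * poch F 1 p.2)) *
        (poch F (c - B) p.1 * poch F (c - A + p.1) p.2) *
        ((∏ i ∈ Finset.range p.1, F (A + y - i)) * poch F (B + y) p.2) := by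
  have hf : ∀ k, poch F 1 k ≠ 0 := fun k => poch_ne_zero fun j _ => by
    rw [add_comm]; exact hk j
  have hfs : ∀ k : ℕ, poch F 1 (k + 1) = poch F 1 k * F (k + 1) := fun k => by
    rw [poch_succ, add_comm (1 : ℂ)]
  let T : ℕ → ℕ → ℂ := fun m n =>
    (-1) ^ m * (poch F 1 (m + n) / (poch F 1 m * poch F 1 n)) *
        (poch F (c - B) m * poch F (c - A + m) n) *
        ((∏ i ∈ Finset.range m, F (A + y - i)) * poch F (B + y) n)
  change _ = ∑ p ∈ Finset.HasAntidiagonal.antidiagonal N, T p.1 p.2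
  induction N with
  | zero => simp [T]
  | succ N ih =>
    rw [sum_antidiagonal_succ_of_pascal
      (F := fun m n => T m n * (F (c - A + (m + n : ℕ) + m) * F (B + y + n)))
      (G := fun m n => T m n * (-(F (c - B + m) * F (A + y - m))))]
    · rw [poch_succ, poch_succ, mul_mul_mul_comm, ih, Finset.sum_mul]
      refine Finset.sum_congr rfl fun p hp => ?_
      rw [Finset.HasAntidiagonal.mem_antidiagonal] at hp
      rw [← mul_add, ← hp]
      congr 1
      have := hF (c + (p.1 + p.2 : ℕ)) (A - p.1) (B + p.2) (-y)
      push_cast at this ⊢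
      rw [show c - A + (p.1 + p.2 : ℂ) + p.1 = c + (p.1 + p.2) - (A - p.1) by ring,
        show B + y + p.2 = B + (p.2 : ℂ) - -y by ring,
        show c - B + p.1 = c + (p.1 + p.2 : ℂ) - (B + p.2) by ring,
        show A + y - p.1 = A - (p.1 : ℂ) - -y by ring,
        show c + y + (p.1 + p.2) = c + (p.1 + p.2 : ℂ) - -y by ring,
        show B - A + (p.1 + p.2) = -(A - (p.1 : ℂ) - (B + p.2)) by ring, hodd]
      linear_combination -this
    · intro m n
      -- The recursion is the addition formula after division by the common shifted factorials.
      have := hF 0 (m + n + 2 : ℂ) (n + 1) (-(c - A) - m)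
      rw [show (0 : ℂ) - (m + n + 2) = -((m + n + 1 : ℕ) + 1) by push_cast; ring,
        show (n + 1 : ℂ) - (-(c - A) - m) = c - A + (m + 1 : ℕ) + n by push_cast; ring,
        show (0 : ℂ) - (n + 1) = -(n + 1) by ring,
        show (m + n + 2 : ℂ) - (-(c - A) - m) = c - A + (m + 1 + n : ℕ) + (m + 1 : ℕ) by
          push_cast; ring,
        show (0 : ℂ) - (-(c - A) - m) = c - A + m by ring,
        show (m + n + 2 : ℂ) - (n + 1) = m + 1 by ring, hodd, hodd] at this
      have e1 : poch F (c - A + m) (n + 1) = F (c - A + m) * poch F (c - A + (m + 1 : ℕ)) n := by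
        rw [poch_succ_left]; push_cast; rw [add_assoc]
      have hm := hf m
      have hn := hf n
      have h1 := hk m
      have h2 := hk n
      simp only [T]
      rw [e1, show m + 1 + (n + 1) = m + n + 1 + 1 by ring, show m + 1 + n = m + n + 1 by ring,
        show m + (n + 1) = m + n + 1 by ring, hfs (m + n + 1), hfs m, hfs n,
        poch_succ F (c - B), poch_succ F (c - A + (m + 1 : ℕ)), poch_succ F (B + y),
        Finset.prod_range_succ, pow_succ]
      rw [show m + 1 + n = m + n + 1 by ring] at this
      generalize F (((m + n + 1 : ℕ) : ℂ) + 1) = f1 at *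
      generalize F (c - A + (m + 1 : ℕ) + n) = f2 at *
      generalize F (c - A + (m + n + 1 : ℕ) + (m + 1 : ℕ)) = f3 at *
      field_simp
      linear_combination (poch F 1 (m + n + 1) * poch F (c - B) m * F (c - B + m) *
        poch F (c - A + (m + 1 : ℕ)) n * (∏ i ∈ Finset.range m, F (A + y - i)) * F (A + y - m) *
        poch F (B + y) n * F (B + y + n)) * this
    · intro n
      have := hk n
      have hn := hf n
      simp only [T]
      rw [zero_add, hfs, zero_add, poch_succ F (c - A + (0 : ℕ)), poch_succ F (B + y)]
      simp only [Nat.cast_zero, add_zero, poch_zero, Finset.prod_range_zero, pow_zero]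
      field_simp
    · intro m
      have := hk m
      have hn := hf m
      simp only [T]
      rw [add_zero, hfs, add_zero, poch_succ F (c - B), Finset.prod_range_succ, pow_succ]
      simp only [poch_zero]
      field_simp

/-- The Pfaff–Saalschütz sum and its `q`-analogue, in the form in which they express a
star-triangle relation. -/
theorem saalschutz (hodd : ∀ x, F (-x) = -F x)
    (hF : ∀ p q r s, F (p - q) * F (r - s) - F (p - r) * F (q - s) + F (p - s) * F (q - r) = 0)
    (hk : ∀ k : ℕ, F (k + 1) ≠ 0) (α β t : ℂ) (N : ℕ) :
    poch F (α + β) N / poch F 1 N * poch F t N =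
      ∑ p ∈ Finset.HasAntidiagonal.antidiagonal N,
        poch F α p.1 / poch F 1 p.1 * (poch F β p.2 / poch F 1 p.2) *
          (poch F (t - β) p.1 * poch F (t + α + p.1) p.2) := by
  have hf : ∀ k, poch F 1 k ≠ 0 := fun k => poch_ne_zero fun j _ => by
    rw [add_comm]; exact hk j
  have key := poch_expansion hodd hF hk (β - t) (1 - t - α - N) (1 - t - N) 0 N
  have hl : poch F (α + β) N / poch F 1 N * poch F t N =
      poch F (1 - t - α - N - (β - t)) N * poch F (1 - t - N + 0) N / poch F 1 N := by
    rw [poch_reflect hodd (α + β), poch_reflect hodd t,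
      show 1 - t - α - N - (β - t) = 1 - (α + β) - N by ring, add_zero]
    have : ((-1 : ℂ) ^ N) * (-1) ^ N = 1 := by rw [← mul_pow]; simp
    linear_combination (poch F (1 - (α + β) - N) N * poch F (1 - t - N) N / poch F 1 N) * this
  rw [hl, key, Finset.sum_div]
  refine Finset.sum_congr rfl fun p hp => ?_
  rw [Finset.HasAntidiagonal.mem_antidiagonal] at hp
  obtain ⟨m, n⟩ := p
  simp only at hp ⊢
  subst hp
  have e1 : ∏ i ∈ Finset.range m, F (β - t + 0 - i) = (-1) ^ m * poch F (t - β) m := by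
    rw [poch, ← Finset.card_range m, ← Finset.prod_const, Finset.card_range,
      ← Finset.prod_mul_distrib]
    refine Finset.prod_congr rfl fun j _ => ?_
    rw [neg_one_mul, ← hodd]
    ring_nf
  have e2 : poch F (1 - t - α - (m + n : ℕ) + 0) n = (-1) ^ n * poch F (t + α + m) n := by
    rw [poch_reflect hodd]; push_cast; ring_nf
  have e3 : poch F (1 - t - (m + n : ℕ) - (β - t) + m) n = (-1) ^ n * poch F β n := by
    rw [poch_reflect hodd]; push_cast; ring_nf
  rw [e1, e2, e3, show 1 - t - ((m + n : ℕ) : ℂ) - (1 - t - α - (m + n : ℕ)) = α by ring]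
  have h1 : ((-1 : ℂ) ^ m) * (-1) ^ m = 1 := by rw [← mul_pow]; simp
  have h2 : ((-1 : ℂ) ^ n) * (-1) ^ n = 1 := by rw [← mul_pow]; simp
  have := hf m
  have := hf n
  have := hf (m + n)
  field_simp
  linear_combination (poch F α m * poch F β n * poch F (t - β) m * poch F (t + α + m) n) *
    (((-1 : ℂ) ^ n) ^ 2 * h1 + h2)

/-- The sum of `saalschutz` with the two indices exchanged. -/
theorem saalschutz' (hodd : ∀ x, F (-x) = -F x)
    (hF : ∀ p q r s, F (p - q) * F (r - s) - F (p - r) * F (q - s) + F (p - s) * F (q - r) = 0)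
    (hk : ∀ k : ℕ, F (k + 1) ≠ 0) (α β t : ℂ) (N : ℕ) :
    poch F (α + β) N / poch F 1 N * poch F t N =
      ∑ p ∈ Finset.HasAntidiagonal.antidiagonal N,
        poch F α p.1 / poch F 1 p.1 * (poch F β p.2 / poch F 1 p.2) *
          (poch F (t - α) p.2 * poch F (t + β + p.2) p.1) := by
  rw [add_comm, saalschutz hodd hF hk, ← Finset.Nat.sum_antidiagonal_swap]
  refine Finset.sum_congr rfl fun p _ => ?_
  simp only [Prod.fst_swap, Prod.snd_swap]
  ring

/-- The rational-function identity behind one step of the recursion in `elliptic_expansion`. -/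
theorem pascal_step (σ f a₁ a₂ b₁ b₂ x₁ y₁ P₁ P₂ P₃ P₄ : ℂ)
    {fm fn f₁ f₂ f₃ f₄ f₅ f₆ f₇ x₂ y₂ x₃ x₄ y₃ y₄ : ℂ}
    (h₅ : f₅ ≠ 0) (h₆ : f₆ ≠ 0) (h₂ : f₂ ≠ 0) (h₃ : f₃ ≠ 0)
    (h : f₁ * x₂ * y₂ * f₄ - f₆ * y₃ * x₄ * f₃ - f₅ * x₃ * y₄ * f₂ = 0) :
    σ * -1 * (f * f₁ / (fm * f₅ * (fn * f₆))) *
        (a₁ * x₁ * (a₂ * x₂) * (b₁ * y₁ * (b₂ * y₂))) / (f₂ * (f₇ * f₃)) *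
        (P₁ * P₃ * (P₂ * P₄)) * f₄ =
      σ * -1 * (f / (fm * f₅ * fn)) * (a₁ * a₂ * (b₁ * y₁ * (y₃ * b₂))) / (f₂ * f₇) *
        (P₁ * P₃ * P₂) * (x₄ * x₁ * P₄) +
      σ * (f / (fm * (fn * f₆))) * (a₁ * x₁ * (x₃ * a₂) * (b₁ * b₂)) / (f₇ * f₃) *
        (P₁ * (P₂ * P₄)) * -(y₄ * y₁ * P₃) := by
  have e₁ : f₆ * f₆⁻¹ * (f₃ * f₃⁻¹) = 1 := by rw [mul_inv_cancel₀ h₆, mul_inv_cancel₀ h₃, one_mul]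
  have e₂ : f₅ * f₅⁻¹ * (f₂ * f₂⁻¹) = 1 := by rw [mul_inv_cancel₀ h₅, mul_inv_cancel₀ h₂, one_mul]
  linear_combination
    (-(σ * f * a₁ * a₂ * b₁ * b₂ * x₁ * y₁ * (P₁ * P₂ * P₃ * P₄) /
      (fm * fn * f₅ * f₆ * f₂ * f₃ * f₇)))
      * h
    + (σ * -1 * (f / (fm * f₅ * fn)) * (a₁ * a₂ * (b₁ * y₁ * (y₃ * b₂))) / (f₂ * f₇) *
        (P₁ * P₃ * P₂) * (x₄ * x₁ * P₄)) * e₁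
    + (σ * (f / (fm * (fn * f₆))) * (a₁ * x₁ * (x₃ * a₂) * (b₁ * b₂)) / (f₇ * f₃) *
        (P₁ * (P₂ * P₄)) * -(y₄ * y₁ * P₃)) * e₂

/-- The expansion of `∏ [c+i+y][c+i-y]` in products of the same type with `A` and `B` in place of
`c`, for an odd function `[x]` with the three-term addition formula of the theta function. It is
the Frenkel–Turaev sum of a terminating very-well-poised balanced elliptic hypergeometric series;
the coefficients obey a Pascal recursion, which is again the addition formula. -/
theorem elliptic_expansion (hodd : ∀ x, F (-x) = -F x)
    (hF : ∀ p q r s, F (p + q) * F (p - q) * (F (r + s) * F (r - s))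
      - F (p + r) * F (p - r) * (F (q + s) * F (q - s))
      + F (p + s) * F (p - s) * (F (q + r) * F (q - r)) = 0)
    (hk : ∀ k : ℕ, F (k + 1) ≠ 0) (A B c y : ℂ) (hAB : ∀ j : ℤ, F (B - A + j) ≠ 0) (N : ℕ) :
    poch F (A + B) N * ∏ i ∈ Finset.range N, (F (c + i + y) * F (c + i - y)) =
      ∑ p ∈ Finset.HasAntidiagonal.antidiagonal N,
      (-1) ^ p.1 * (poch F 1 (p.1 + p.2) / (poch F 1 p.1 * poch F 1 p.2)) *
        (poch F (c - A) p.2 * poch F (c + A + p.1) p.2 *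
          (poch F (c - B) p.1 * poch F (c + B + p.2) p.1)) *
        (F (B - A + p.2 - p.1) / poch F (B - A - p.1) (p.1 + p.2 + 1)) *
        ((∏ i ∈ Finset.range p.1, (F (A + i + y) * F (A + i - y))) *
          ∏ i ∈ Finset.range p.2, (F (B + i + y) * F (B + i - y))) := by
  have hf : ∀ k, poch F 1 k ≠ 0 := fun k => poch_ne_zero fun j _ => by
    rw [add_comm]; exact hk j
  have hfs : ∀ k : ℕ, poch F 1 (k + 1) = poch F 1 k * F (k + 1) := fun k => by
    rw [poch_succ, add_comm (1 : ℂ)]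
  have hd : ∀ m k : ℕ, poch F (B - A - m) k ≠ 0 := fun m k => poch_ne_zero fun j _ => by
    have := hAB (j - m)
    push_cast at this
    rwa [show B - A - m + j = B - A + (j - m : ℂ) by ring]
  let K : ℕ → ℕ → ℂ := fun m n =>
    (-1) ^ m * (poch F 1 (m + n) / (poch F 1 m * poch F 1 n)) *
        (poch F (c - A) n * poch F (c + A + m) n *
          (poch F (c - B) m * poch F (c + B + n) m)) / poch F (B - A - m) (m + n + 1) *
        ((∏ i ∈ Finset.range m, (F (A + i + y) * F (A + i - y))) *
          ∏ i ∈ Finset.range n, (F (B + i + y) * F (B + i - y)))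
  trans ∑ p ∈ Finset.HasAntidiagonal.antidiagonal N, K p.1 p.2 * F (B - A + p.2 - p.1)
  swap
  · exact Finset.sum_congr rfl fun p _ => by simp only [K]; ring
  induction N with
  | zero => simp [K, poch_succ, show F (B - A) ≠ 0 by simpa using hAB 0]
  | succ N ih =>
    rw [sum_antidiagonal_succ_of_pascal (C := fun m n => K m n * F (B - A + n - m))
      (F := fun m n => K m n * (F (c + (m + n : ℕ) + (A + m)) * F (c + (m + n : ℕ) - (A + m)) *
        (F (B + n + y) * F (B + n - y))))
      (G := fun m n => K m n * -(F (c + (m + n : ℕ) + (B + n)) * F (c + (m + n : ℕ) - (B + n)) *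
        (F (A + m + y) * F (A + m - y))))]
    · rw [poch_succ, Finset.prod_range_succ, mul_mul_mul_comm, ih, Finset.sum_mul]
      refine Finset.sum_congr rfl fun p hp => ?_
      rw [Finset.HasAntidiagonal.mem_antidiagonal] at hp
      rw [← mul_add, ← hp, mul_assoc]
      congr 1
      have := hF (c + (p.1 + p.2 : ℕ)) y (A + p.1) (B + p.2)
      rw [show A + p.1 + (B + p.2) = A + B + (p.1 + p.2 : ℕ) by push_cast; ring,
        show A + p.1 - (B + p.2) = -(B - A + p.2 - p.1) by ring,
        show y - (A + p.1) = -(A + p.1 - y) by ring, show y - (B + p.2) = -(B + p.2 - y) by ring,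
        add_comm y, add_comm y, hodd, hodd, hodd] at this
      linear_combination -this
    · intro m n
      -- The half-sums are chosen to produce the arguments `m + 1`, `n + 1`, `m + n + 2` and
      -- `B - A + n - m`, the last factor being the very-well-poised one.
      have := hF ((c + B + 2 * (m + n + 1) + 1) / 2) ((c + B - 1) / 2) ((c + B + 2 * n + 1) / 2)
        ((2 * (c + A) - (c + B) + 2 * m + 1) / 2)
      rw [show (c + B + 2 * (m + n + 1 : ℂ) + 1) / 2 + (c + B - 1) / 2 =
          c + B + (n + 1 : ℕ) + m by push_cast; ring,
        show (c + B + 2 * (m + n + 1 : ℂ) + 1) / 2 - (c + B - 1) / 2 = (m + n + 1 : ℕ) + 1 by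
          push_cast; ring,
        show (c + B + 2 * n + 1 : ℂ) / 2 + (2 * (c + A) - (c + B) + 2 * m + 1) / 2 =
          c + A + (m + 1 : ℕ) + n by push_cast; ring,
        show (c + B + 2 * n + 1 : ℂ) / 2 - (2 * (c + A) - (c + B) + 2 * m + 1) / 2 =
          B - A + (n + 1 : ℕ) - (m + 1 : ℕ) by push_cast; ring,
        show (c + B + 2 * (m + n + 1) + 1 : ℂ) / 2 + (c + B + 2 * n + 1) / 2 =
          c + (m + n + 1 : ℕ) + (B + (n + 1 : ℕ)) by push_cast; ring,
        show (c + B + 2 * (m + n + 1) + 1 : ℂ) / 2 - (c + B + 2 * n + 1) / 2 = m + 1 by ring,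
        show (c + B - 1 : ℂ) / 2 + (2 * (c + A) - (c + B) + 2 * m + 1) / 2 = c + A + m by ring,
        show (c + B - 1 : ℂ) / 2 - (2 * (c + A) - (c + B) + 2 * m + 1) / 2 =
          B - A - (m + 1 : ℕ) by push_cast; ring,
        show (c + B + 2 * (m + n + 1) + 1 : ℂ) / 2 +
          (2 * (c + A) - (c + B) + 2 * m + 1) / 2 = c + (m + n + 1 : ℕ) + (A + (m + 1 : ℕ)) by
            push_cast; ring,
        show (c + B + 2 * (m + n + 1) + 1 : ℂ) / 2 -
          (2 * (c + A) - (c + B) + 2 * m + 1) / 2 = B - A + (n + 1 : ℕ) by push_cast; ring,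
        show (c + B - 1 : ℂ) / 2 + (c + B + 2 * n + 1) / 2 = c + B + n by ring,
        show (c + B - 1 : ℂ) / 2 - (c + B + 2 * n + 1) / 2 = -(n + 1) by ring, hodd] at this
      have e1 : poch F (c + A + m) (n + 1) = F (c + A + m) * poch F (c + A + (m + 1 : ℕ)) n := by
        rw [poch_succ_left]; push_cast; rw [add_assoc (c + A)]
      have e2 : poch F (c + B + n) (m + 1) = F (c + B + n) * poch F (c + B + (n + 1 : ℕ)) m := by
        rw [poch_succ_left]; push_cast; rw [add_assoc (c + B)]
      have e3 (k : ℕ) : poch F (B - A - (m + 1 : ℕ)) (k + 1) =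
          F (B - A - (m + 1 : ℕ)) * poch F (B - A - m) k := by
        rw [poch_succ_left]; push_cast
        rw [show B - A - (m + 1) + 1 = B - A - (m : ℂ) by ring]
      have e4 : F (B - A - m + (m + n + 1 : ℕ)) = F (B - A + (n + 1 : ℕ)) := by
        congr 1; push_cast; ring
      have e5 : F (c + (m + n + 1 : ℕ) - (A + (m + 1 : ℕ))) = F (c - A + n) := by
        congr 1; push_cast; ring
      have e6 : F (c + (m + n + 1 : ℕ) - (B + (n + 1 : ℕ))) = F (c - B + m) := by
        congr 1; push_cast; ring
      have h1 := hk m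
      have h2 := hk n
      have h4 : F (B - A - (m + 1 : ℕ)) ≠ 0 := by
        have := hAB (-(m + 1 : ℕ)); rwa [Int.cast_neg, Int.cast_natCast, ← sub_eq_add_neg] at this
      have h5 : F (B - A + (n + 1 : ℕ)) ≠ 0 := by
        have := hAB (n + 1 : ℕ); rwa [Int.cast_natCast] at this
      simp only [K]
      rw [show m + 1 + (n + 1) = m + n + 1 + 1 by ring, show m + 1 + n = m + n + 1 by ring,
        show m + (n + 1) = m + n + 1 by ring, e1, e2, e3, e3, poch_succ F (B - A - m) (m + n + 1),
        e4, e5, e6, hfs (m + n + 1), hfs m, hfs n, poch_succ F (c - B), poch_succ F (c - A),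
        poch_succ F (c + A + (m + 1 : ℕ)), poch_succ F (c + B + (n + 1 : ℕ)),
        Finset.prod_range_succ, Finset.prod_range_succ, pow_succ]
      exact pascal_step _ _ _ _ _ _ _ _ _ _ _ _ h1 h2 h4 h5 (by linear_combination this)
    · intro n
      have h1 := hk n
      have hn := hf n
      have h2 : poch F (B - A) (n + 1) ≠ 0 := by simpa using hd 0 (n + 1)
      have h3 : F (B - A + (n + 1 : ℕ)) ≠ 0 := by
        have := hAB (n + 1 : ℕ); rwa [Int.cast_natCast] at this
      simp only [K]
      rw [zero_add, zero_add, hfs, Finset.prod_range_succ _ n]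
      simp only [Nat.cast_zero, add_zero, sub_zero, poch_zero, Finset.prod_range_zero, pow_zero]
      rw [poch_succ F (B - A) (n + 1), poch_succ F (c - A), poch_succ F (c + A),
        show c + n + A = c + A + n by ring, show c + n - A = c - A + n by ring]
      field_simp
    · intro m
      have h1 := hk m
      have hm := hf m
      have h2 := hd m (m + 1)
      have h3 : F (B - A - (m + 1 : ℕ)) ≠ 0 := by
        have := hAB (-(m + 1 : ℕ)); rwa [Int.cast_neg, Int.cast_natCast, ← sub_eq_add_neg] at this
      have e3 : poch F (B - A - (m + 1 : ℕ)) (m + 1 + 1) =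
          F (B - A - (m + 1 : ℕ)) * poch F (B - A - m) (m + 1) := by
        rw [poch_succ_left]; push_cast
        rw [show B - A - (m + 1) + 1 = B - A - (m : ℂ) by ring]
      simp only [K]
      rw [add_zero, add_zero, hfs, Finset.prod_range_succ _ m]
      simp only [Nat.cast_zero, add_zero, poch_zero, Finset.prod_range_zero, pow_succ]
      rw [e3, poch_succ F (c - B), poch_succ F (c + B),
        show c + m + B = c + B + m by ring, show c + m - B = c - B + m by ring]
      field_simp

/-! ### Star-triangle relations for functions -/

variable {F g g₁ g₂ : ℂ → ℂ}

/-- The functional equation `g(s + 1) = F(s) g(s)` and non-vanishing on the coset `x + ℤ`. -/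
def GammaLike (F g : ℂ → ℂ) (x : ℂ) : Prop :=
  ∀ j : ℤ, g (x + j) ≠ 0 ∧ g (x + j + 1) = F (x + j) * g (x + j)

theorem GammaLike.map_add (h : GammaLike F g x) (j : ℤ) (k : ℕ) :
    g (x + j + k) = poch F (x + j) k * g (x + j) :=
  map_add_nat_eq_poch_mul (fun n => by
    have := (h (j + n)).2
    push_cast at this
    rwa [← add_assoc] at this) k

theorem GammaLike.ne_zero {x : ℂ} (h : GammaLike F g x) (j : ℤ) : g (x + j) ≠ 0 := (h j).1

/-- The quotient `g(s + (1 + a)/2) / g(s + (1 - a)/2)`, to which the multiplication operators of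
the star-triangle relations reduce. -/
def gratio (g : ℂ → ℂ) (a s : ℂ) : ℂ := g (s + (1 + a) / 2) / g (s + (1 - a) / 2)

theorem gratio_mul_gratio {a b s : ℂ} (hQ : GammaLike F g (s + (1 + b) / 2))
    (hR : GammaLike F g (s + (1 - b) / 2)) (N : ℕ) :
    gratio g b s * gratio g a (s + (a + b) / 2 - N) =
      poch F (s + (1 + b) / 2 - N) N *
        (g (s + (1 + b) / 2 + a - N) / g (s + (1 - b) / 2)) := by
  have h1 := hQ.map_add (-N) N
  have h2 := hQ.ne_zero (-N)
  have h3 := hR.ne_zero 0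
  push_cast at h1 h2 h3
  rw [neg_add_cancel_right] at h1
  rw [← sub_eq_add_neg] at h1 h2
  rw [add_zero] at h3
  unfold gratio
  rw [show s + (a + b) / 2 - N + (1 - a) / 2 = s + (1 + b) / 2 - N by ring,
    show s + (a + b) / 2 - N + (1 + a) / 2 = s + (1 + b) / 2 + a - N by ring, h1]
  generalize g (s + (1 + b) / 2 - N) = u at *
  generalize g (s + (1 - b) / 2) = v at *
  generalize g (s + (1 + b) / 2 + a - N) = w at *
  generalize poch F (s + (1 + b) / 2 - N) N = p
  field_simp

theorem gratio_add {a b s : ℂ} (hP : GammaLike F g (s + (1 + b) / 2 + a))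
    (hR : GammaLike F g (s + (1 - b) / 2)) (m n : ℕ) :
    gratio g (a + b) (s + a / 2 - m) =
      poch F (s + (1 + b) / 2 + a - (m + n : ℕ)) n * poch F (s + (1 - b) / 2 - m) m *
        (g (s + (1 + b) / 2 + a - (m + n : ℕ)) / g (s + (1 - b) / 2)) := by
  have h1 := hP.map_add (-(m + n : ℕ)) n
  have h2 := hR.map_add (-m) m
  have h3 := hR.ne_zero (-m)
  have h4 := hR.ne_zero 0
  push_cast at h1 h2 h3 h4 ⊢
  rw [neg_add_cancel_right] at h2
  rw [← sub_eq_add_neg] at h1 h2 h3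
  rw [add_zero] at h4
  rw [show s + (1 + b) / 2 + a - (m + n : ℂ) + n = s + (1 + b) / 2 + a - m by ring] at h1
  unfold gratio
  rw [show s + a / 2 - m + (1 + (a + b)) / 2 = s + (1 + b) / 2 + a - m by ring,
    show s + a / 2 - m + (1 - (a + b)) / 2 = s + (1 - b) / 2 - m by ring, h1]
  rw [h2] at h4 ⊢
  have h5 := left_ne_zero_of_mul h4
  generalize g (s + (1 - b) / 2 - m) = u at *
  generalize poch F (s + (1 - b) / 2 - m) m = p at *
  generalize g (s + (1 + b) / 2 + a - (m + n)) = v at *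
  generalize poch F (s + (1 + b) / 2 + a - (m + n)) n = q at *
  field_simp

/-- The star-triangle relation for a bracket with the addition formula of `x` or `sinh x`. -/
theorem saalschutz_star (hodd : ∀ x, F (-x) = -F x)
    (hF : ∀ p q r s, F (p - q) * F (r - s) - F (p - r) * F (q - s) + F (p - s) * F (q - r) = 0)
    (hk : ∀ k : ℕ, F (k + 1) ≠ 0) {a b s : ℂ} (hP : GammaLike F g (s + (1 + b) / 2 + a))
    (hQ : GammaLike F g (s + (1 + b) / 2)) (hR : GammaLike F g (s + (1 - b) / 2)) (N : ℕ) :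
    gratio g b s * (poch F (-(a + b)) N / poch F 1 N) * gratio g a (s + (a + b) / 2 - N) =
      ∑ p ∈ Finset.HasAntidiagonal.antidiagonal N,
        poch F (-a) p.1 / poch F 1 p.1 * gratio g (a + b) (s + a / 2 - p.1) *
          (poch F (-b) p.2 / poch F 1 p.2) := by
  rw [mul_right_comm, gratio_mul_gratio hQ hR,
    mul_right_comm, mul_comm (poch F (s + (1 + b) / 2 - N) N),
    neg_add, saalschutz' hodd hF hk, Finset.sum_mul]
  refine Finset.sum_congr rfl fun p hp => ?_
  rw [Finset.HasAntidiagonal.mem_antidiagonal] at hp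
  rw [gratio_add hP hR p.1 p.2, hp, ← hp]
  push_cast
  rw [show s + (1 + b) / 2 - (p.1 + p.2 : ℂ) - -a = s + (1 + b) / 2 + a - (p.1 + p.2) by ring,
    show s + (1 + b) / 2 - (p.1 + p.2 : ℂ) + -b + p.2 = s + (1 - b) / 2 - p.1 by ring]
  ring

/-- The coefficients of the elliptic intertwiner, for a general bracket. -/
def coefW (F : ℂ → ℂ) (a : ℂ) (k : ℕ) (z : ℂ) : ℂ :=
  F (-z - a + 2 * k) * poch F (-z - a) k * poch F (-a) k /
    (F (-z - a) * poch F (-z + 1) k * poch F 1 k)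

/-- The coefficients of `elliptic_expansion`, for the parameters of the star-triangle relation, as
products of coefficients of the intertwiner. -/
theorem expansion_coeff_eq (hodd : ∀ x, F (-x) = -F x) (hk : ∀ k : ℕ, F (k + 1) ≠ 0)
    {a b z : ℂ} (hz : ∀ j : ℤ, F (z + j) ≠ 0) (hza : ∀ j : ℤ, F (z + a + j) ≠ 0)
    (hzab : ∀ j : ℤ, F (z + a + b + j) ≠ 0) (m n : ℕ) :
    (-1) ^ (m + n) * (F (-z - (a + b) + 2 * (m + n : ℕ)) * poch F (-z - (a + b)) (m + n)) /
        (F (-z - (a + b)) * poch F (-z + 1) (m + n) * poch F 1 (m + n)) *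
      ((-1) ^ m * (poch F 1 (m + n) / (poch F 1 m * poch F 1 n)) *
        (poch F (z - (m + n : ℕ)) n * poch F (b + 1 - (m + n : ℕ) + m) n *
          (poch F (-a) m * poch F (z + a + b + 1 - 2 * (m + n : ℕ) + n) m)) *
        (F (z + a - (m + n : ℕ) + n - m) / poch F (z + a - (m + n : ℕ) - m) (m + n + 1))) =
    coefW F a m z * coefW F b n (z + a - 2 * m) *
      (poch F (z + a + b - 2 * m) (2 * m) / poch F (z + a - 2 * m) (2 * m)) := by
  have hf : ∀ k, poch F 1 k ≠ 0 := fun k => poch_ne_zero fun j _ => by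
    rw [add_comm]; exact hk j
  have hneg : ∀ {u : ℂ}, F u ≠ 0 → F (-u) ≠ 0 := fun h => by rw [hodd]; exact neg_ne_zero.2 h
  set x := -z - (a + b) with hx
  set w := -z - a with hw
  have hxj : ∀ j : ℕ, F (x + j) ≠ 0 := fun j => by
    have := hneg (hzab (-j)); push_cast at this
    rwa [show x + j = -(z + a + b + -j) by rw [hx]; ring]
  have hwj : ∀ j : ℕ, F (w + j) ≠ 0 := fun j => by
    have := hneg (hza (-j)); push_cast at this; rwa [show w + j = -(z + a + -j) by rw [hw]; ring]
  have hzj : ∀ j : ℕ, F (1 - z + j) ≠ 0 := fun j => by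
    have := hneg (hz (-(j + 1))); push_cast at this
    rwa [show 1 - z + j = -(z + -(j + 1)) by ring]
  have e1 : poch F (z - (m + n : ℕ)) n = (-1) ^ n * poch F (1 - z + m) n := by
    rw [poch_reflect hodd]; push_cast; ring_nf
  have e2 : poch F (b + 1 - (m + n : ℕ) + m) n = (-1) ^ n * poch F (-b) n := by
    rw [poch_reflect hodd]; push_cast; ring_nf
  have e3 : poch F (z + a + b + 1 - 2 * (m + n : ℕ) + n) m =
      (-1) ^ m * poch F (x + (m + n : ℕ)) m := by
    rw [poch_reflect hodd, hx]; push_cast; ring_nf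
  have e4 : F (z + a - (m + n : ℕ) + n - m) = -F (w + (2 * m : ℕ)) := by
    rw [← hodd, hw]; push_cast; ring_nf
  have e5 : poch F (z + a - (m + n : ℕ) - m) (m + n + 1) =
      (-1) ^ (m + n + 1) * poch F (w + m) (m + n + 1) := by
    rw [poch_reflect hodd, hw]; push_cast; ring_nf
  have e6 : poch F (z + a + b - 2 * m) (2 * m) = poch F (x + 1) (2 * m) := by
    rw [poch_reflect hodd, hx, pow_mul]; push_cast; ring_nf
  have e7 : poch F (z + a - 2 * m) (2 * m) = poch F (w + 1) (2 * m) := by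
    rw [poch_reflect hodd, hw, pow_mul]; push_cast; ring_nf
  have e8 : poch F x (m + n) * poch F (x + (m + n : ℕ)) m =
      poch F x (2 * m) * poch F (x + (2 * m : ℕ)) n := by
    rw [← poch_add, ← poch_add]; ring_nf
  have e9 : F x * poch F (x + 1) (2 * m) = poch F x (2 * m) * F (x + (2 * m : ℕ)) := by
    rw [← poch_succ_left, poch_succ]
  have e10 : F w * (poch F (w + 1) (2 * m) * poch F (w + 1 + (2 * m : ℕ)) n) =
      poch F w m * poch F (w + m) (m + n + 1) := by
    rw [← poch_add, ← poch_add, ← poch_succ_left]; ring_nf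
  have e11 : poch F (1 - z) (m + n) = poch F (1 - z) m * poch F (1 - z + m) n := poch_add ..
  unfold coefW
  rw [e1, e2, e3, e4, e5, e6, e7, show -z + 1 = 1 - z by ring, e11,
    show -(z + a - 2 * m) - b + 2 * n = x + 2 * (m + n : ℕ) by rw [hx]; push_cast; ring,
    show -(z + a - 2 * m) - b = x + (2 * m : ℕ) by rw [hx]; push_cast; ring,
    show -(z + a - 2 * m) + 1 = w + 1 + (2 * m : ℕ) by rw [hw]; push_cast; ring]
  rw [← hw, show w + 2 * (m : ℂ) = w + (2 * m : ℕ) by push_cast; ring]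
  have n1 : F x ≠ 0 := by simpa using hxj 0
  have n2 : F w ≠ 0 := by simpa using hwj 0
  have n3 : poch F (1 - z) m ≠ 0 := poch_ne_zero fun j _ => hzj j
  have n4 : poch F (1 - z + m) n ≠ 0 := poch_ne_zero fun j _ => by
    have := hzj (m + j); push_cast at this; rwa [← add_assoc] at this
  have n5 : poch F (w + m) (m + n + 1) ≠ 0 := poch_ne_zero fun j _ => by
    have := hwj (m + j); push_cast at this; rwa [← add_assoc] at this
  have n6 : F (x + (2 * m : ℕ)) ≠ 0 := hxj _
  have n7 : poch F (w + 1) (2 * m) ≠ 0 := poch_ne_zero fun j _ => by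
    have := hwj (1 + j); push_cast at this; rwa [← add_assoc] at this
  have n8 : poch F (w + 1 + (2 * m : ℕ)) n ≠ 0 := poch_ne_zero fun j _ => by
    have := hwj (1 + 2 * m + j); push_cast at this ⊢; rwa [← add_assoc, ← add_assoc] at this
  have n9 : poch F w m ≠ 0 := poch_ne_zero fun j _ => hwj j
  have e9' := eq_div_of_mul_eq n1 ((mul_comm _ _).trans e9)
  have e10' := eq_div_of_mul_eq n9 ((mul_comm _ _).trans e10.symm)
  rw [e10', e9', show (-1 : ℂ) ^ (m + n + 1) = -((-1) ^ m * (-1) ^ n) by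
    rw [pow_succ, pow_add]; ring,
    pow_add (-1 : ℂ) m n]
  have n10 := hf m
  have n11 := hf n
  have n12 := hf (m + n)
  generalize F (x + (2 * m : ℕ)) = F₁ at *
  generalize F (w + (2 * m : ℕ)) = F₂ at *
  generalize F (x + 2 * (m + n : ℕ)) = F₃ at *
  generalize F x = F₄ at *
  generalize F w = F₅ at *
  generalize poch F (1 - z) m = p₁ at *
  generalize poch F (1 - z + m) n = p₂ at *
  generalize poch F (w + 1) (2 * m) = p₃ at *
  generalize poch F (w + 1 + (2 * m : ℕ)) n = p₄ at *
  generalize poch F w m = p₅ at *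
  generalize poch F x (2 * m) = p₆ at *
  generalize poch F (x + (2 * m : ℕ)) n = p₇ at *
  generalize poch F x (m + n) = p₈ at *
  generalize poch F (x + (m + n : ℕ)) m = p₉ at *
  generalize poch F 1 m = q₁ at *
  generalize poch F 1 n = q₂ at *
  generalize poch F 1 (m + n) = q₃ at *
  generalize poch F (-a) m = q₄ at *
  generalize poch F (-b) n = q₅ at *
  clear e1 e2 e3 e4 e5 e6 e7 e9 e10 e9' e10' e11 hx hw hxj hwj hzj hz hza hzab hk hneg hf n5
  clear_value x w
  rcases neg_one_pow_eq_or ℂ m with h | h <;> rcases neg_one_pow_eq_or ℂ n with h' | h' <;>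
  · rw [h, h']
    field_simp
    linear_combination (F₃ * q₅ * q₄ * F₂) * e8

theorem GammaLike.bracket_ne_zero {x : ℂ} (h : GammaLike F g x) (j : ℤ) : F (x + j) ≠ 0 := by
  have h1 := (h (j + 1)).1
  push_cast at h1
  rw [← add_assoc, (h j).2] at h1
  exact left_ne_zero_of_mul h1

/-- The star-triangle relation for a bracket with the addition formula of the theta function. -/
theorem elliptic_star (hodd : ∀ x, F (-x) = -F x)
    (hF : ∀ p q r s, F (p + q) * F (p - q) * (F (r + s) * F (r - s))
      - F (p + r) * F (p - r) * (F (q + s) * F (q - s))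
      + F (p + s) * F (p - s) * (F (q + r) * F (q - r)) = 0)
    (hk : ∀ k : ℕ, F (k + 1) ≠ 0) {a b y z : ℂ} (hz : GammaLike F g z)
    (hza : GammaLike F g (z + a)) (hzab : GammaLike F g (z + a + b))
    (hP₁ : GammaLike F g₁ ((z + y) / 2 + (1 + b) / 2 + a))
    (hQ₁ : GammaLike F g₁ ((z + y) / 2 + (1 + b) / 2))
    (hR₁ : GammaLike F g₁ ((z + y) / 2 + (1 - b) / 2))
    (hP₂ : GammaLike F g₂ ((z - y) / 2 + (1 + b) / 2 + a))
    (hQ₂ : GammaLike F g₂ ((z - y) / 2 + (1 + b) / 2))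
    (hR₂ : GammaLike F g₂ ((z - y) / 2 + (1 - b) / 2)) (N : ℕ) :
    gratio g₁ b ((z + y) / 2) * gratio g₂ b ((z - y) / 2) *
        (g z / g (z + (a + b)) * coefW F (a + b) N z) *
        (gratio g₁ a ((z + y) / 2 + (a + b) / 2 - N) *
          gratio g₂ a ((z - y) / 2 + (a + b) / 2 - N)) =
      ∑ p ∈ Finset.HasAntidiagonal.antidiagonal N,
        g z / g (z + a) * coefW F a p.1 z *
          (gratio g₁ (a + b) ((z + y) / 2 + a / 2 - p.1) *
            gratio g₂ (a + b) ((z - y) / 2 + a / 2 - p.1)) *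
          (g (z + a - 2 * p.1) / g (z + a - 2 * p.1 + b) * coefW F b p.2 (z + a - 2 * p.1)) := by
  set A := -z / 2 + (1 + b) / 2 with hA
  set B := z / 2 + (1 + b) / 2 + a - N with hB
  set c := z / 2 + (1 + b) / 2 - N with hc
  set G₁ := g₁ ((z + y) / 2 + (1 + b) / 2 + a - N) / g₁ ((z + y) / 2 + (1 - b) / 2) with hG₁
  set G₂ := g₂ ((z - y) / 2 + (1 + b) / 2 + a - N) / g₂ ((z - y) / 2 + (1 - b) / 2) with hG₂
  have hBA : B - A = z + a - N := by rw [hB, hA]; ring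
  have key := elliptic_expansion hodd hF hk A B c (y / 2) (fun j => by
    have := hza.bracket_ne_zero (j - N)
    push_cast at this
    rwa [hBA, show z + a - N + j = z + a + (j - N : ℂ) by ring]) N
  have prod_eq (x u₁ u₂ : ℂ) (n : ℕ) (h₁ : u₁ = x + y / 2) (h₂ : u₂ = x - y / 2) :
      ∏ i ∈ Finset.range n, (F (x + i + y / 2) * F (x + i - y / 2)) =
        poch F u₁ n * poch F u₂ n := by
    rw [Finset.prod_mul_distrib, poch, poch]
    congr 1 <;> refine Finset.prod_congr rfl fun i _ => ?_
    · rw [h₁]; ring_nf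
    · rw [h₂]; ring_nf
  have hl : gratio g₁ b ((z + y) / 2) * gratio g₂ b ((z - y) / 2) *
        (g z / g (z + (a + b)) * coefW F (a + b) N z) *
        (gratio g₁ a ((z + y) / 2 + (a + b) / 2 - N) *
          gratio g₂ a ((z - y) / 2 + (a + b) / 2 - N)) =
      (-1) ^ N * (F (-z - (a + b) + 2 * N) * poch F (-z - (a + b)) N) /
        (F (-z - (a + b)) * poch F (-z + 1) N * poch F 1 N) *
        (poch F (A + B) N * ∏ i ∈ Finset.range N, (F (c + i + y / 2) * F (c + i - y / 2))) *
        (G₁ * G₂ * (g z / g (z + (a + b)))) := by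
    rw [prod_eq c ((z + y) / 2 + (1 + b) / 2 - N) ((z - y) / 2 + (1 + b) / 2 - N) N
      (by rw [hc]; ring) (by rw [hc]; ring)]
    have h1 := gratio_mul_gratio (a := a) hQ₁ hR₁ N
    have h2 := gratio_mul_gratio (a := a) hQ₂ hR₂ N
    rw [← hG₁] at h1
    rw [← hG₂] at h2
    have e : poch F (A + B) N = (-1) ^ N * poch F (-(a + b)) N := by
      rw [poch_reflect hodd, hA, hB]; ring_nf
    have s : (-1 : ℂ) ^ N * (-1) ^ N = 1 := by rw [← mul_pow]; simp
    rw [e, coefW]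
    calc _ = g z / g (z + (a + b)) * (F (-z - (a + b) + 2 * N) * poch F (-z - (a + b)) N *
          poch F (-(a + b)) N / (F (-z - (a + b)) * poch F (-z + 1) N * poch F 1 N)) *
          ((gratio g₁ b ((z + y) / 2) * gratio g₁ a ((z + y) / 2 + (a + b) / 2 - N)) *
          (gratio g₂ b ((z - y) / 2) * gratio g₂ a ((z - y) / 2 + (a + b) / 2 - N))) := by ring
      _ = g z / g (z + (a + b)) * (F (-z - (a + b) + 2 * N) * poch F (-z - (a + b)) N *
          poch F (-(a + b)) N / (F (-z - (a + b)) * poch F (-z + 1) N * poch F 1 N)) *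
          ((poch F ((z + y) / 2 + (1 + b) / 2 - N) N * G₁) *
          (poch F ((z - y) / 2 + (1 + b) / 2 - N) N * G₂)) * ((-1) ^ N * (-1) ^ N) := by
            rw [h1, h2, s, mul_one]
      _ = _ := by ring
  rw [hl, key, Finset.mul_sum, Finset.sum_mul]
  refine Finset.sum_congr rfl fun p hp => ?_
  rw [Finset.HasAntidiagonal.mem_antidiagonal] at hp
  obtain ⟨m, n⟩ := p
  simp only at hp ⊢
  subst hp
  rw [gratio_add hP₁ hR₁ m n, gratio_add hP₂ hR₂ m n, ← hG₁, ← hG₂,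
    prod_eq B ((z + y) / 2 + (1 + b) / 2 + a - (m + n : ℕ))
      ((z - y) / 2 + (1 + b) / 2 + a - (m + n : ℕ)) n (by rw [hB]; ring) (by rw [hB]; ring),
    prod_eq A (1 - ((z - y) / 2 + (1 - b) / 2 - m) - m) (1 - ((z + y) / 2 + (1 - b) / 2 - m) - m) m
      (by rw [hA]; ring) (by rw [hA]; ring),
    poch_reflect hodd ((z - y) / 2 + (1 - b) / 2 - m),
    poch_reflect hodd ((z + y) / 2 + (1 - b) / 2 - m)]
  have s : (-1 : ℂ) ^ m * (-1) ^ m = 1 := by rw [← mul_pow]; simp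
  have hc1 := expansion_coeff_eq hodd hk hz.bracket_ne_zero hza.bracket_ne_zero
    hzab.bracket_ne_zero m n
  rw [← show c - A = z - (m + n : ℕ) by rw [hc, hA]; ring,
    ← show c + A = b + 1 - (m + n : ℕ) by rw [hc, hA]; ring,
    ← show c - B = -a by rw [hc, hB]; ring,
    ← show c + B = z + a + b + 1 - 2 * (m + n : ℕ) by rw [hc, hB]; ring, ← hBA] at hc1
  have hg1 := hza.map_add (-(2 * m : ℕ)) (2 * m)
  have hg2 := hzab.map_add (-(2 * m : ℕ)) (2 * m)
  have hg3 := hza.ne_zero (-(2 * m : ℕ))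
  have hg4 := hzab.ne_zero (-(2 * m : ℕ))
  have hg5 := hza.ne_zero 0
  have hg6 := hzab.ne_zero 0
  push_cast at hg1 hg2 hg3 hg4 hg5 hg6
  rw [neg_add_cancel_right, ← sub_eq_add_neg] at hg1 hg2
  rw [← sub_eq_add_neg] at hg3 hg4
  rw [add_zero] at hg5 hg6
  rw [show z + a - 2 * (m : ℂ) + b = z + a + b - 2 * m by ring,
    show z + (a + b) = z + a + b by ring]
  have hg : g z / g (z + a + b) *
      (poch F (z + a + b - 2 * m) (2 * m) / poch F (z + a - 2 * m) (2 * m)) =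
      g z / g (z + a) * (g (z + a - 2 * m) / g (z + a + b - 2 * m)) := by
    rw [hg1] at hg5
    rw [hg2] at hg6
    rw [hg1, hg2]
    have := left_ne_zero_of_mul hg5
    have := left_ne_zero_of_mul hg6
    generalize poch F (z + a + b - 2 * m) (2 * m) = p₁ at *
    generalize poch F (z + a - 2 * m) (2 * m) = p₂ at *
    generalize g (z + a + b - 2 * m) = p₃ at *
    generalize g (z + a - 2 * m) = p₄ at *
    field_simp
  set p₁ := poch F ((z + y) / 2 + (1 + b) / 2 + a - (m + n : ℕ)) n
  set p₂ := poch F ((z - y) / 2 + (1 + b) / 2 + a - (m + n : ℕ)) n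
  set p₃ := poch F (1 - ((z - y) / 2 + (1 - b) / 2 - m) - m) m
  set p₄ := poch F (1 - ((z + y) / 2 + (1 - b) / 2 - m) - m) m
  linear_combination (p₁ * p₂ * p₃ * p₄ * G₁ * G₂ * (g z / g (z + a + b))) * hc1
    + (coefW F a m z * coefW F b n (z + a - 2 * m) * p₁ * p₂ * p₃ * p₄ * G₁ * G₂) * hg
    - (coefW F a m z * coefW F b n (z + a - 2 * m) * p₁ * p₂ * p₃ * p₄ * G₁ * G₂ *
      (g z / g (z + a)) * (g (z + a - 2 * m) / g (z + a + b - 2 * m))) * s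

/-! ### Genericity -/

/-- A nonzero linear form almost surely avoids a countable set. -/
theorem ae_linear_ne {L : (Fin 3 → ℂ) →ₗ[ℂ] ℂ} (hL : L ≠ 0) {ι : Type} [Countable ι] (c : ι → ℂ) :
    ∀ᵐ x : Fin 3 → ℂ, ∀ i, L x ≠ c i := by
  rw [ae_all_iff]
  intro i
  rw [ae_iff]
  simp only [not_not]
  rcases Set.eq_empty_or_nonempty {x | L x = c i} with h | ⟨x₀, h₀⟩
  · rw [h, measure_empty]
  have h₀ : L x₀ = c i := h₀
  have : {x | L x = c i} = (fun x => -x₀ + x) ⁻¹' (LinearMap.ker L).restrictScalars ℝ := by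
    ext x
    simp [h₀, neg_add_eq_zero, eq_comm (a := L x)]
  rw [this, measure_preimage_add]
  refine Measure.addHaar_submodule _ _ fun h => hL ?_
  rw [Submodule.restrictScalars_eq_top_iff] at h
  exact LinearMap.ker_eq_top.1 h

theorem ae_coord_ne (i : Fin 3) {ι : Type} [Countable ι] (c : ι → ℂ) :
    ∀ᵐ x : Fin 3 → ℂ, ∀ k, x i ≠ c k := by
  refine ae_linear_ne (L := LinearMap.proj i) (fun h => ?_) c
  simpa using LinearMap.congr_fun h (Pi.single i 1)

theorem ae_coord_add_ne {i j : Fin 3} (hij : i ≠ j) {ι : Type} [Countable ι] (c : ι → ℂ) :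
    ∀ᵐ x : Fin 3 → ℂ, ∀ k, x i + x j ≠ c k := by
  refine ae_linear_ne
    (L := (LinearMap.proj i : (Fin 3 → ℂ) →ₗ[ℂ] ℂ) + LinearMap.proj j) (fun h => ?_) c
  simpa [Pi.single_apply, hij.symm] using LinearMap.congr_fun h (Pi.single i 1)

theorem ae_coord_sub_ne {i j : Fin 3} (hij : i ≠ j) {ι : Type} [Countable ι] (c : ι → ℂ) :
    ∀ᵐ x : Fin 3 → ℂ, ∀ k, x i - x j ≠ c k := by
  refine ae_linear_ne
    (L := (LinearMap.proj i : (Fin 3 → ℂ) →ₗ[ℂ] ℂ) - LinearMap.proj j) (fun h => ?_) c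
  simpa [Pi.single_apply, hij.symm] using LinearMap.congr_fun h (Pi.single i 1)

theorem castSucc_ne_succ (j : Fin 2) : j.castSucc ≠ j.succ := (Fin.castSucc_lt_succ (i := j)).ne

/-! ### No deformation -/

theorem poch_id_one (k : ℕ) : poch id 1 k = (k.factorial : ℂ) := by
  induction k with
  | zero => simp
  | succ k ih => rw [poch_succ, ih, Nat.factorial_succ]; push_cast; simp only [id]; ring

theorem iteratedDeriv_one_sub_cpow (a : ℂ) (k : ℕ) {t : ℂ} (ht : 1 - t ∈ Complex.slitPlane) :
    iteratedDeriv k (fun t : ℂ => (1 - t) ^ a) t = poch id (-a) k * (1 - t) ^ (a - k) := by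
  induction k generalizing t with
  | zero => simp
  | succ k ih =>
    have hU : ∀ᶠ u in nhds t, 1 - u ∈ Complex.slitPlane :=
      (continuous_const.sub continuous_id).continuousAt.eventually_mem
        (Complex.isOpen_slitPlane.mem_nhds ht)
    have h1 : iteratedDeriv k (fun t : ℂ => (1 - t) ^ a) =ᶠ[nhds t]
        fun t => poch id (-a) k * (1 - t) ^ (a - k) := hU.mono fun u hu => ih hu
    have h2 : HasDerivAt (fun t : ℂ => (1 - t) ^ (a - k))
        ((a - k) * (1 - t) ^ (a - k - 1) * (-1)) t :=
      ((hasDerivAt_id t).const_sub 1).cpow_const ht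
    rw [iteratedDeriv_succ, h1.deriv_eq, (h2.const_mul _).deriv, poch_succ]
    push_cast
    rw [← sub_sub]
    simp only [id]
    ring

/-- The operator `(zⱼ₊₁ - zⱼ)^a` as a binomial series. -/
theorem XO_eq (j : Fin 2) (a : ℂ) :
    XO j a = FormalOp.series (-ax j.succ a) j fun k _ => poch id (-a) k / poch id 1 k := by
  rw [XO, monomialO, FormalOp.taylor, FormalOp.transl_mul_series, add_zero]
  congr 1
  funext k x
  rw [iteratedDeriv_one_sub_cpow a k (by simp), poch_id_one]
  simp

theorem ax_apply_self (i : Fin 3) (a : ℂ) : ax i a i = a := by simp [ax]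

theorem ax_apply_of_ne {i k : Fin 3} (h : k ≠ i) (a : ℂ) : ax i a k = 0 := by simp [ax, h]

theorem ax_add (i : Fin 3) (a b : ℂ) : ax i (a + b) = ax i a + ax i b := Pi.single_add ..

theorem ax_neg (i : Fin 3) (a : ℂ) : ax i (-a) = -ax i a := Pi.single_neg ..

/-- The coefficient of the translation `d ↦ d + a` in the intertwiner. -/
def gammaRatio (a d : ℂ) : ℂ := Complex.Gamma (d + a + 1) / Complex.Gamma (d + 1)

theorem WO_eq_series (i : Fin 3) (a : ℂ) (k : Fin 2) :
    WO i a = FormalOp.series (ax i a) k fun n d => if n = 0 then gammaRatio a (d i) else 0 := by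
  rw [WO, monomialO, ax_neg, neg_neg, FormalOp.mulFn_eq_series k, FormalOp.transl_mul_series,
    add_zero]
  congr 1
  funext n d
  have h : d i + a + 1 - a = d i + 1 := by ring
  simp [gammaRatio, ax, h]

theorem WO_eq_mul (i : Fin 3) (a : ℂ) :
    WO i a = FormalOp.mulFn (fun d => gammaRatio a (d i)) * FormalOp.transl (ax i a) := by
  rw [WO_eq_series i a 0, FormalOp.mulFn_eq_series 0, FormalOp.series_mul_transl, zero_add]

theorem WO_mul_series (i : Fin 3) (a : ℂ) (β : Fin 3 → ℂ) (k : Fin 2)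
    (c : ℕ → (Fin 3 → ℂ) → ℂ) :
    WO i a * FormalOp.series β k c = FormalOp.series (ax i a + β) k fun n x =>
      gammaRatio a (x i) * c n (x + ax i a) := by
  rw [WO_eq_mul, FormalOp.mul_assoc, FormalOp.transl_mul_series, FormalOp.mulFn_mul_series]

theorem series_mul_WO (i : Fin 3) (a : ℂ) (β : Fin 3 → ℂ) (k : Fin 2)
    (c : ℕ → (Fin 3 → ℂ) → ℂ) :
    FormalOp.series β k c * WO i a = FormalOp.series (β + ax i a) k fun n x =>
      c n x * gammaRatio a ((x + (β + (n : ℂ) • stepO k)) i) := by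
  rw [WO_eq_mul, ← FormalOp.mul_assoc, FormalOp.series_mul_mulFn, FormalOp.series_mul_transl]

theorem gammaLike_Gamma {x : ℂ} (h : ∀ j : ℤ, x ≠ j) : GammaLike id Complex.Gamma x := by
  intro j
  have h0 : x + j ≠ 0 := fun h0 => h (-j) (by push_cast; exact eq_neg_of_add_eq_zero_left h0)
  refine ⟨Complex.Gamma_ne_zero fun m hm => h (-m - j) ?_, Complex.Gamma_add_one _ h0⟩
  push_cast
  rw [← hm]; ring

theorem id_plucker (p q r s : ℂ) :
    id (p - q) * id (r - s) - id (p - r) * id (q - s) + id (p - s) * id (q - r) = 0 := by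
  simp only [id]; ring

/-- `∂^a x^{a+b} ∂^b = x^b ∂^{a+b} x^a` on the level of coefficients: the Pfaff–Saalschütz sum. -/
theorem gamma_star₁ (a b d : ℂ) (hd : ∀ j : ℤ, d ≠ j) (hda : ∀ j : ℤ, d + a ≠ j)
    (hdab : ∀ j : ℤ, d + a + b ≠ j) (N : ℕ) :
    gammaRatio a d * (poch id (-(a + b)) N / poch id 1 N) * gammaRatio b (d + a - N) =
      ∑ p ∈ Finset.HasAntidiagonal.antidiagonal N, poch id (-b) p.1 / poch id 1 p.1 *
        gammaRatio (a + b) (d - p.1) * (poch id (-a) p.2 / poch id 1 p.2) := by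
  have g0 := gammaLike_Gamma hd
  have g1 := gammaLike_Gamma hda
  have g2 := gammaLike_Gamma hdab
  have key := saalschutz' (F := id) (fun x => rfl) id_plucker
    (fun k => Nat.cast_add_one_ne_zero k) (-b) (-a) (d + a - N + 1) N
  have h1 := g1.map_add (1 - N) N
  have h2 := g1.ne_zero (1 - N)
  have h3 := g0.ne_zero 1
  push_cast at h1 h2 h3
  rw [show d + a + (1 - N : ℂ) = d + a - N + 1 by ring] at h1 h2
  rw [show d + a - N + 1 + N = d + a + 1 by ring] at h1
  have hl : gammaRatio a d * (poch id (-(a + b)) N / poch id 1 N) * gammaRatio b (d + a - N) =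
      poch id (-b + -a) N / poch id 1 N * poch id (d + a - N + 1) N *
        (Complex.Gamma (d + a - N + b + 1) / Complex.Gamma (d + 1)) := by
    rw [gammaRatio, gammaRatio, h1, show -(a + b) = -b + -a by ring]
    field_simp
  rw [hl, key, Finset.sum_mul]
  refine Finset.sum_congr rfl fun p hp => ?_
  rw [Finset.HasAntidiagonal.mem_antidiagonal] at hp
  obtain ⟨m, n⟩ := p
  simp only at hp ⊢
  subst hp
  have h4 := g2.map_add (1 - (m + n : ℕ)) n
  have h5 := g0.map_add (1 - m) m
  have h6 := g0.ne_zero (1 - m)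
  push_cast at h4 h5 h6 ⊢
  rw [show d + a + b + (1 - (m + n : ℂ)) = d + a - (m + n) + b + 1 by ring,
    show d + a - (m + n) + b + 1 + n = d - m + (a + b) + (1 : ℂ) by ring] at h4
  rw [show d + (1 - m : ℂ) = d - m + 1 by ring] at h5 h6
  rw [show d - m + 1 + m = d + (1 : ℂ) by ring] at h5
  rw [h5] at h3 ⊢
  have h7 := left_ne_zero_of_mul h3
  rw [gammaRatio, h4, show d + a - (m + n : ℂ) + 1 - -b = d + a - (m + n) + b + 1 by ring,
    show d + a - (m + n : ℂ) + 1 + -a + n = d - m + 1 by ring]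
  generalize poch id (d - m + 1) m = p₁ at *
  generalize Complex.Gamma (d - m + 1) = p₂ at *
  field_simp

theorem gamma_star₂ (a b d : ℂ) (hd : ∀ j : ℤ, d ≠ j) (hda : ∀ j : ℤ, d + -a ≠ j)
    (hdb : ∀ j : ℤ, d + b ≠ j) (N : ℕ) :
    gammaRatio b d * (poch id (-(a + b)) N / poch id 1 N) * gammaRatio a (d - a + N) =
      ∑ p ∈ Finset.HasAntidiagonal.antidiagonal N, poch id (-a) p.1 / poch id 1 p.1 *
        gammaRatio (a + b) (d - a + p.1) * (poch id (-b) p.2 / poch id 1 p.2) := by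
  have g0 := gammaLike_Gamma hd
  have g1 := gammaLike_Gamma hda
  have g2 := gammaLike_Gamma hdb
  have key := saalschutz (F := id) (fun x => rfl) id_plucker
    (fun k => Nat.cast_add_one_ne_zero k) (-a) (-b) (d + 1) N
  have h1 := g0.map_add 1 N
  have h3 := g0.ne_zero 1
  push_cast at h1 h3
  have hl : gammaRatio b d * (poch id (-(a + b)) N / poch id 1 N) * gammaRatio a (d - a + N) =
      poch id (-a + -b) N / poch id 1 N * poch id (d + 1) N *
        (Complex.Gamma (d + b + 1) / Complex.Gamma (d - a + N + 1)) := by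
    rw [gammaRatio, gammaRatio, show d - a + N + a + 1 = d + 1 + N by ring, h1,
      show -(a + b) = -a + -b by ring]
    field_simp
  rw [hl, key, Finset.sum_mul]
  refine Finset.sum_congr rfl fun p hp => ?_
  rw [Finset.HasAntidiagonal.mem_antidiagonal] at hp
  obtain ⟨m, n⟩ := p
  simp only at hp ⊢
  subst hp
  have h4 := g2.map_add 1 m
  have h5 := g1.map_add (1 + m) n
  have h6 := g1.ne_zero (1 + m + n)
  push_cast at h4 h5 h6 ⊢
  rw [show d + -a + (1 + m + n : ℂ) = d + -a + (1 + m) + n by ring, h5] at h6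
  have h7 := left_ne_zero_of_mul h6
  have h8 := right_ne_zero_of_mul h6
  rw [gammaRatio, show d - a + m + (a + b) + (1 : ℂ) = d + b + 1 + m by ring, h4,
    show d - a + (m + n) + (1 : ℂ) = d + -a + (1 + m) + n by ring, h5,
    show d - a + m + (1 : ℂ) = d + -a + (1 + m) by ring,
    show d + 1 - -b = d + b + 1 by ring, show d + 1 + -a + m = d + -a + (1 + m : ℂ) by ring]
  generalize poch id (d + -a + (1 + m)) n = p₁ at *
  generalize Complex.Gamma (d + -a + (1 + m)) = p₂ at *
  field_simp

theorem stepO_castSucc (j : Fin 2) : stepO j j.castSucc = -1 := by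
  simp [stepO, ax, (castSucc_ne_succ j)]

theorem stepO_succ (j : Fin 2) : stepO j j.succ = 1 := by
  simp [stepO, ax, (castSucc_ne_succ j).symm]

theorem ae_coord_add_ne_int (i : Fin 3) (a : ℂ) :
    ∀ᵐ x : Fin 3 → ℂ, ∀ j : ℤ, x i + a ≠ j := by
  filter_upwards [ae_coord_ne i fun j : ℤ => (j : ℂ) - a] with x hx j h
  exact hx j (by rw [← h]; ring)

theorem star₁_O (j : Fin 2) (a b : ℂ) :
    (WO j.castSucc a * XO j (a + b) * WO j.castSucc b).Eqv
      (XO j b * WO j.castSucc (a + b) * XO j a) := by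
  simp only [XO_eq, WO_mul_series, series_mul_WO, FormalOp.series_mul]
  refine FormalOp.series_eqv (by rw [ax_add, ax_add]; abel) fun N => ?_
  filter_upwards [ae_coord_add_ne_int j.castSucc 0, ae_coord_add_ne_int j.castSucc a,
    ae_coord_add_ne_int j.castSucc (a + b)] with x h0 h1 h2
  have := gamma_star₁ a b (x j.castSucc) (by simpa using h0) h1 (by simpa [add_assoc] using h2) N
  simp only [Pi.add_apply, Pi.smul_apply, Pi.neg_apply, ax_apply_self, stepO_castSucc,
    ax_apply_of_ne (castSucc_ne_succ j), smul_eq_mul]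
  convert this using 2
  · congr 1; ring
  · congr 2; ring_nf

theorem star₂_O (j : Fin 2) (a b : ℂ) :
    (XO j a * WO j.succ (a + b) * XO j b).Eqv (WO j.succ b * XO j (a + b) * WO j.succ a) := by
  simp only [XO_eq, WO_mul_series, series_mul_WO, FormalOp.series_mul]
  refine FormalOp.series_eqv (by rw [ax_add]; abel) fun N => ?_
  filter_upwards [ae_coord_add_ne_int j.succ 0, ae_coord_add_ne_int j.succ (-a),
    ae_coord_add_ne_int j.succ b] with x h0 h1 h2
  have := (gamma_star₂ a b (x j.succ) (by simpa using h0) h1 h2 N).symm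
  simp only [Pi.add_apply, Pi.smul_apply, Pi.neg_apply, ax_apply_self, stepO_succ, smul_eq_mul]
  convert this using 2
  · congr 2; ring_nf
  · congr 1; ring

theorem yangBaxter_O (u v w l₁ l₂ l₃ : ℂ) : YangBaxter SO 1 u v w l₁ l₂ l₃ := by
  refine yangBaxter_of_eqv WO XO (fun i j hij a b => ?_) (fun a b => ?_) (fun a b => ?_)
    (fun a b => ?_) star₁_O star₂_O 1 u v w l₁ l₂ l₃
  · rw [WO_eq_series i a 0, WO_eq_series j b 0]
    refine FormalOp.series_mul_comm fun m n x => ?_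
    by_cases hm : m = 0 <;> by_cases hn : n = 0 <;>
      simp [hm, hn, ax_apply_of_ne hij.ne, ax_apply_of_ne hij.ne', mul_comm]
  · rw [XO_eq, XO_eq]
    exact FormalOp.series_mul_comm fun m n x => mul_comm _ _
  · rw [WO_eq_series 0 a 0, XO_eq]
    refine FormalOp.series_mul_comm fun m n x => ?_
    simp [stepO, ax, mul_comm]
  · rw [WO_eq_series 2 b 0, XO_eq]
    refine FormalOp.series_mul_comm fun m n x => ?_
    simp [stepO, ax, mul_comm]

/-! ### Infinite products and the `q`-binomial theorem -/

/-- The infinite product `∏ₖ (1 - x Qᵏ)`. -/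
def infPoch (Q x : ℂ) : ℂ := ∏' k : ℕ, (1 - x * Q ^ k)

section InfPoch

variable {Q : ℂ}

theorem summable_norm_mul_pow (hQ : ‖Q‖ < 1) (x : ℂ) : Summable fun k : ℕ => ‖-(x * Q ^ k)‖ := by
  simp only [norm_neg, norm_mul, norm_pow]
  exact (summable_geometric_of_lt_one (norm_nonneg _) hQ).mul_left _

theorem multipliable_infPoch (hQ : ‖Q‖ < 1) (x : ℂ) : Multipliable fun k : ℕ => 1 - x * Q ^ k := by
  simpa only [sub_eq_add_neg] using multipliable_one_add_of_summable (summable_norm_mul_pow hQ x)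

theorem infPoch_eq_mul (hQ : ‖Q‖ < 1) (x : ℂ) : infPoch Q x = (1 - x) * infPoch Q (x * Q) := by
  have h : Multipliable fun k : ℕ => 1 - x * Q ^ (k + 1) := by
    simpa only [pow_succ', ← mul_assoc] using multipliable_infPoch hQ (x * Q)
  have h' := tprod_eq_zero_mul' (f := fun k : ℕ => 1 - x * Q ^ k) h
  simp only [pow_zero, mul_one, pow_succ', ← mul_assoc] at h'
  exact h'

theorem infPoch_ne_zero (hQ : ‖Q‖ < 1) {x : ℂ} (hx : ∀ k : ℕ, x * Q ^ k ≠ 1) :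
    infPoch Q x ≠ 0 := by
  have := tprod_one_add_ne_zero_of_summable (f := fun k : ℕ => -(x * Q ^ k))
    (fun k h => hx k (by linear_combination -h)) (summable_norm_mul_pow hQ x)
  simp only [← sub_eq_add_neg] at this
  exact this

theorem infPoch_ne_zero_of_norm_lt (hQ : ‖Q‖ < 1) {x : ℂ} (hx : ‖x‖ < 1) : infPoch Q x ≠ 0 := by
  refine infPoch_ne_zero hQ fun k h => ?_
  have h1 : ‖x * Q ^ k‖ = 1 := by rw [h, norm_one]
  rw [norm_mul, norm_pow] at h1
  have := mul_le_of_le_one_right (norm_nonneg x) (pow_le_one₀ (norm_nonneg Q) hQ.le : ‖Q‖ ^ k ≤ 1)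
  linarith

theorem tendsto_infPoch (hQ : ‖Q‖ < 1) (x : ℂ) :
    Tendsto (fun n => ∏ k ∈ Finset.range n, (1 - x * Q ^ k)) atTop (𝓝 (infPoch Q x)) :=
  (multipliable_infPoch hQ x).hasProd.tendsto_prod_nat

theorem one_sub_pow_succ_ne_zero (hQ : ‖Q‖ < 1) (k : ℕ) : 1 - Q ^ (k + 1) ≠ 0 := by
  intro h
  have h1 : ‖Q ^ (k + 1)‖ = 1 := by rw [← sub_eq_zero.1 h, norm_one]
  rw [norm_pow] at h1
  exact (pow_lt_one₀ (norm_nonneg Q) hQ (Nat.succ_ne_zero k)).ne h1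

/-- The coefficients of the expansion of `(αt; Q) / (ρt; Q)` in powers of `t`. -/
def qbinomCoeff (Q α ρ : ℂ) (k : ℕ) : ℂ :=
  ∏ j ∈ Finset.range k, (ρ - α * Q ^ j) / (1 - Q ^ (j + 1))

theorem qbinomCoeff_succ (hQ : ‖Q‖ < 1) (α ρ : ℂ) (k : ℕ) :
    qbinomCoeff Q α ρ (k + 1) * (1 - Q ^ (k + 1)) = qbinomCoeff Q α ρ k * (ρ - α * Q ^ k) := by
  have := one_sub_pow_succ_ne_zero hQ k
  rw [qbinomCoeff, Finset.prod_range_succ, ← qbinomCoeff]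
  field_simp

theorem tendsto_pow_zero (hQ : ‖Q‖ < 1) : Tendsto (fun k : ℕ => Q ^ k) atTop (𝓝 0) :=
  tendsto_pow_atTop_nhds_zero_of_norm_lt_one hQ

theorem summable_qbinom (hQ : ‖Q‖ < 1) {α ρ t : ℂ} (hρ : ‖ρ * t‖ < 1) :
    Summable fun k : ℕ => qbinomCoeff Q α ρ k * t ^ k := by
  obtain ⟨r, hr, hr1⟩ := exists_between hρ
  refine summable_of_ratio_norm_eventually_le hr1 ?_
  have h1 : Tendsto (fun k : ℕ => ‖(ρ - α * Q ^ k) / (1 - Q ^ (k + 1)) * t‖) atTop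
      (𝓝 ‖(ρ - α * 0) / (1 - 0) * t‖) := by
    have h := tendsto_pow_zero hQ
    exact (((tendsto_const_nhds.sub (tendsto_const_nhds.mul h)).div
      (tendsto_const_nhds.sub ((tendsto_add_atTop_iff_nat 1).2 h)) (by simp)).mul_const t).norm
  rw [mul_zero, sub_zero, sub_zero, div_one] at h1
  filter_upwards [h1.eventually_lt_const hr] with k hk
  rw [qbinomCoeff, Finset.prod_range_succ, ← qbinomCoeff, pow_succ]
  calc _ = ‖(ρ - α * Q ^ k) / (1 - Q ^ (k + 1)) * t‖ * ‖qbinomCoeff Q α ρ k * t ^ k‖ := by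
        rw [← norm_mul]; congr 1; ring
    _ ≤ _ := by gcongr

/-- The `q`-binomial series as a function. -/
def qbinomSeries (Q α ρ t : ℂ) : ℂ := ∑' k : ℕ, qbinomCoeff Q α ρ k * t ^ k

theorem qbinomSeries_functional (hQ : ‖Q‖ < 1) {α ρ t : ℂ} (hρ : ‖ρ * t‖ < 1) :
    (1 - ρ * t) * qbinomSeries Q α ρ t = (1 - α * t) * qbinomSeries Q α ρ (t * Q) := by
  have hρ' : ‖ρ * (t * Q)‖ < 1 := by
    rw [← mul_assoc, norm_mul]
    exact mul_lt_one_of_nonneg_of_lt_one_left (norm_nonneg _) hρ hQ.le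
  have s1 := summable_qbinom (α := α) hQ hρ
  have s2 := summable_qbinom (α := α) hQ hρ'
  have e1 : qbinomSeries Q α ρ t - qbinomSeries Q α ρ (t * Q) =
      ∑' k : ℕ, qbinomCoeff Q α ρ k * t ^ k * (1 - Q ^ k) := by
    rw [qbinomSeries, qbinomSeries, ← s1.tsum_sub s2]
    exact tsum_congr fun k => by rw [mul_pow]; ring
  have s3 : Summable fun k : ℕ => qbinomCoeff Q α ρ k * t ^ k * (1 - Q ^ k) :=
    (s1.sub s2).congr fun k => by rw [mul_pow]; ring
  have e2 : ∑' k : ℕ, qbinomCoeff Q α ρ k * t ^ k * (1 - Q ^ k) =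
      ρ * t * qbinomSeries Q α ρ t - α * t * qbinomSeries Q α ρ (t * Q) := by
    rw [s3.tsum_eq_zero_add, qbinomSeries, qbinomSeries, ← tsum_mul_left, ← tsum_mul_left,
      ← (s1.mul_left _).tsum_sub (s2.mul_left _)]
    simp only [pow_zero, sub_self, mul_zero, zero_add]
    refine tsum_congr fun k => ?_
    rw [mul_right_comm, qbinomCoeff_succ hQ, mul_pow]
    ring
  linear_combination e1 + e2

theorem hasFPowerSeriesAt_qbinomSeries (hQ : ‖Q‖ < 1) {α ρ : ℂ} (hρ : ‖ρ‖ < 1) :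
    HasFPowerSeriesAt (qbinomSeries Q α ρ)
      (FormalMultilinearSeries.ofScalars ℂ (qbinomCoeff Q α ρ)) 0 := by
  rw [hasFPowerSeriesAt_iff]
  filter_upwards [Metric.ball_mem_nhds (0 : ℂ) one_pos] with t ht
  rw [mem_ball_zero_iff] at ht
  have h : ‖ρ * t‖ < 1 := by
    rw [norm_mul]; exact mul_lt_one_of_nonneg_of_lt_one_left (norm_nonneg _) hρ ht.le
  simp only [FormalMultilinearSeries.coeff_ofScalars, zero_add, smul_eq_mul]
  simp only [mul_comm (t ^ _)]
  exact (summable_qbinom hQ h).hasSum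

/-- The `q`-binomial theorem. -/
theorem qbinomSeries_eq (hQ : ‖Q‖ < 1) {α ρ t : ℂ} (hρ : ‖ρ‖ < 1) (ht : ‖t‖ < 1) :
    qbinomSeries Q α ρ t = infPoch Q (α * t) / infPoch Q (ρ * t) := by
  have hρt (n : ℕ) : ‖ρ * (t * Q ^ n)‖ < 1 := by
    rw [norm_mul, norm_mul, norm_pow]
    have h1 : ‖t‖ * ‖Q‖ ^ n ≤ 1 :=
      mul_le_one₀ ht.le (by positivity) (pow_le_one₀ (norm_nonneg _) hQ.le)
    exact mul_lt_one_of_nonneg_of_lt_one_left (norm_nonneg _) hρ h1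
  have hne : infPoch Q (ρ * t) ≠ 0 :=
    infPoch_ne_zero_of_norm_lt hQ (by simpa using hρt 0)
  -- Iterating the functional equation moves `t` to `0`, where the series is `1`.
  have iter (n : ℕ) : (∏ k ∈ Finset.range n, (1 - ρ * t * Q ^ k)) * qbinomSeries Q α ρ t =
      (∏ k ∈ Finset.range n, (1 - α * t * Q ^ k)) * qbinomSeries Q α ρ (t * Q ^ n) := by
    induction n with
    | zero => simp
    | succ n ih =>
      have := qbinomSeries_functional (α := α) hQ (hρt n)
      rw [Finset.prod_range_succ, Finset.prod_range_succ, mul_right_comm, ih, pow_succ,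
        ← mul_assoc t]
      linear_combination (∏ k ∈ Finset.range n, (1 - α * t * Q ^ k)) * this
  have hc : Tendsto (fun n : ℕ => qbinomSeries Q α ρ (t * Q ^ n)) atTop (𝓝 1) := by
    have h1 := (hasFPowerSeriesAt_qbinomSeries (α := α) hQ hρ).continuousAt.tendsto
    have h0 : qbinomSeries Q α ρ 0 = 1 := by
      rw [qbinomSeries, tsum_eq_single 0 fun k hk => by simp [hk]]
      simp [qbinomCoeff]
    rw [h0] at h1
    exact h1.comp (by simpa using (tendsto_pow_zero hQ).const_mul t)
  have l1 := (tendsto_infPoch hQ (ρ * t)).mul_const (qbinomSeries Q α ρ t)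
  have l2 := (tendsto_infPoch hQ (α * t)).mul hc
  rw [eq_div_iff hne, mul_comm]
  simpa using tendsto_nhds_unique l1 (l2.congr fun n => (iter n).symm)

theorem iteratedDeriv_qbinom (hQ : ‖Q‖ < 1) {α ρ : ℂ} (hρ : ‖ρ‖ < 1) (k : ℕ) :
    iteratedDeriv k (fun t => infPoch Q (α * t) / infPoch Q (ρ * t)) 0 / (k.factorial : ℂ) =
      qbinomCoeff Q α ρ k := by
  have h1 : HasFPowerSeriesAt (fun t => infPoch Q (α * t) / infPoch Q (ρ * t))
      (FormalMultilinearSeries.ofScalars ℂ (qbinomCoeff Q α ρ)) 0 := by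
    refine (hasFPowerSeriesAt_qbinomSeries hQ hρ).congr ?_
    filter_upwards [Metric.ball_mem_nhds (0 : ℂ) one_pos] with t ht
    exact qbinomSeries_eq hQ hρ (mem_ball_zero_iff.1 ht)
  have h2 := h1.analyticAt.hasFPowerSeriesAt
  have h3 := congrArg (fun p => FormalMultilinearSeries.coeff p k)
    (h2.eq_formalMultilinearSeries h1)
  simpa only [FormalMultilinearSeries.coeff_ofScalars] using h3

end InfPoch

/-! ### Quantum deformation -/

/-- The `q`-number `q^x - q^{-x}`. -/
def qnum (h x : ℂ) : ℂ := qpow h x - qpow h (-x)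

theorem qpow_add (h a b : ℂ) : qpow h (a + b) = qpow h a * qpow h b := by
  rw [qpow, mul_add, Complex.exp_add, qpow, qpow]

theorem qpow_neg (h a : ℂ) : qpow h (-a) = (qpow h a)⁻¹ := by
  rw [qpow, mul_neg, Complex.exp_neg, qpow]

theorem qpow_ne_zero (h a : ℂ) : qpow h a ≠ 0 := Complex.exp_ne_zero _

theorem qpow_two_mul_nat (h : ℂ) (k : ℕ) : qpow h (2 * k) = qpow h 2 ^ k := by
  rw [qpow, qpow, ← Complex.exp_nat_mul]; ring_nf

theorem qPoch_eq (h x : ℂ) : qPoch h x = infPoch (qpow h 2) x := by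
  simp only [qPoch, infPoch, qpow_two_mul_nat]

theorem qnum_neg (h x : ℂ) : qnum h (-x) = -qnum h x := by
  rw [qnum, qnum, neg_neg, neg_sub]

theorem qnum_plucker (h p q r s : ℂ) :
    qnum h (p - q) * qnum h (r - s) - qnum h (p - r) * qnum h (q - s) +
      qnum h (p - s) * qnum h (q - r) = 0 := by
  have := qpow_ne_zero h p
  have := qpow_ne_zero h q
  have := qpow_ne_zero h r
  have := qpow_ne_zero h s
  simp only [qnum, sub_eq_add_neg, qpow_add, qpow_neg]
  field_simp
  ring

theorem norm_qpow_two_lt {h : ℂ} (hh : h.re < 0) : ‖qpow h 2‖ < 1 := by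
  rw [qpow, Complex.norm_exp, Real.exp_lt_one_iff]
  simp; linarith

theorem one_sub_qpow (h x : ℂ) : 1 - qpow h (2 * x) = -qpow h x * qnum h x := by
  rw [qnum, two_mul, qpow_add, qpow_neg]
  have := qpow_ne_zero h x
  field_simp
  ring

theorem qnum_succ_ne_zero {h : ℂ} (hh : h.re < 0) (k : ℕ) : qnum h (k + 1) ≠ 0 := by
  have h1 := one_sub_pow_succ_ne_zero (norm_qpow_two_lt hh) k
  rw [← qpow_two_mul_nat, one_sub_qpow] at h1
  simpa using right_ne_zero_of_mul h1

/-- The expansion coefficients of the intertwiner in terms of `q`-numbers. -/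
theorem qbinomCoeff_eq {h : ℂ} (hh : h.re < 0) (a : ℂ) (k : ℕ) :
    qbinomCoeff (qpow h 2) (qpow h (2 - 2 * a)) (qpow h 2) k =
      qpow h (k * (1 - a)) * (poch (qnum h) (-a) k / poch (qnum h) 1 k) := by
  induction k with
  | zero => simp [qbinomCoeff, qpow]
  | succ k ih =>
    rw [qbinomCoeff, Finset.prod_range_succ, ← qbinomCoeff, ih, poch_succ, poch_succ]
    have h1 : qpow h 2 - qpow h (2 - 2 * a) * qpow h 2 ^ k =
        -(qpow h 2 * qpow h (-a + k)) * qnum h (-a + k) := by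
      rw [← qpow_two_mul_nat, sub_eq_add_neg 2 (2 * a), qpow_add h 2, mul_assoc,
        ← qpow_add h (-(2 * a)),
        show -(2 * a) + 2 * (k : ℂ) = 2 * (-a + k) by ring]
      linear_combination qpow h 2 * one_sub_qpow h (-a + k)
    have h2 : 1 - qpow h 2 ^ (k + 1) = -qpow h (1 + k) * qnum h (1 + k) := by
      rw [← qpow_two_mul_nat, ← one_sub_qpow]; push_cast; ring_nf
    have h3 : qnum h (1 + k) ≠ 0 := by rw [add_comm]; exact qnum_succ_ne_zero hh k
    have h4 : qpow h (-a + k) * qpow h 2 = qpow h (1 - a) * qpow h (1 + k) := by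
      rw [← qpow_add, ← qpow_add]; ring_nf
    have h5 : qpow h ((k + 1 : ℕ) * (1 - a)) = qpow h (k * (1 - a)) * qpow h (1 - a) := by
      rw [← qpow_add]; push_cast; ring_nf
    have h6 := qpow_ne_zero h (1 + k)
    rw [h1, h2, h5, show -(qpow h 2 * qpow h (-a + k)) * qnum h (-a + k) /
      (-qpow h (1 + k) * qnum h (1 + k)) = qpow h (1 - a) * (qnum h (-a + k) / qnum h (1 + k)) by
        rw [mul_comm (qpow h 2), h4]
        generalize qpow h (1 + k) = u at *
        generalize qnum h (1 + k) = v at *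
        field_simp]
    rw [mul_div_mul_comm]
    ring

/-- The multiplication operator of the star-triangle relation, as a function of the logarithm `z`
of the variable on which the intertwiner acts and of the logarithm `y` of the other one. -/
def phiQ (h c : ℂ) (g : ℂ → ℂ) (a y z : ℂ) : ℂ :=
  Complex.exp (a * (z + y) / 2 + c * a) * gratio g a ((y - z) / (2 * h))

/-- The coefficients of the intertwiner. -/
def coefQ (h a : ℂ) (k : ℕ) (z : ℂ) : ℂ :=
  qpow h (a ^ 2 / 2) * Complex.exp (-a * z) *
    (qpow h (k * (1 - a)) * (poch (qnum h) (-a) k / poch (qnum h) 1 k))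

theorem star_Q {h : ℂ} (hh : h.re < 0) (c : ℂ) {g : ℂ → ℂ} {a b y z : ℂ}
    (hP : GammaLike (qnum h) g ((y - z) / (2 * h) + (1 + b) / 2 + a))
    (hQ : GammaLike (qnum h) g ((y - z) / (2 * h) + (1 + b) / 2))
    (hR : GammaLike (qnum h) g ((y - z) / (2 * h) + (1 - b) / 2)) (N : ℕ) :
    phiQ h c g b y z * coefQ h (a + b) N z * phiQ h c g a y (z - (a + b) * h + 2 * h * N) =
      ∑ p ∈ Finset.HasAntidiagonal.antidiagonal N,
        coefQ h a p.1 z * phiQ h c g (a + b) y (z - a * h + 2 * h * p.1) *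
          coefQ h b p.2 (z - a * h + 2 * h * p.1) := by
  have h0 : h ≠ 0 := fun h0 => by simp [h0] at hh
  have key := saalschutz_star (qnum_neg h) (qnum_plucker h) (qnum_succ_ne_zero hh) hP hQ hR N
  have es (u : ℂ) (m : ℕ) :
      (y - (z - u * h + 2 * h * m)) / (2 * h) = (y - z) / (2 * h) + u / 2 - m := by
    field_simp; ring
  simp only [phiQ, coefQ, es, qpow]
  have hl : Complex.exp (b * (z + y) / 2 + c * b) * (Complex.exp (h * ((a + b) ^ 2 / 2)) *
      Complex.exp (-(a + b) * z) * Complex.exp (h * (N * (1 - (a + b))))) *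
      Complex.exp (a * (z - (a + b) * h + 2 * h * N + y) / 2 + c * a) =
      Complex.exp ((a + b) * (y - z) / 2 + c * (a + b) + h * (b * (a + b) / 2 + N * (1 - b))) := by
    simp only [← Complex.exp_add]
    congr 1
    ring
  trans Complex.exp ((a + b) * (y - z) / 2 + c * (a + b) + h * (b * (a + b) / 2 + N * (1 - b))) *
    (gratio g b ((y - z) / (2 * h)) *
      (poch (qnum h) (-(a + b)) N / poch (qnum h) 1 N) *
      gratio g a ((y - z) / (2 * h) + (a + b) / 2 - N))
  · rw [← hl]; ring
  rw [key, Finset.mul_sum]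
  refine Finset.sum_congr rfl fun p hp => ?_
  rw [Finset.HasAntidiagonal.mem_antidiagonal] at hp
  obtain ⟨m, n⟩ := p
  simp only at hp ⊢
  subst hp
  have hr : Complex.exp (h * (a ^ 2 / 2)) * Complex.exp (-a * z) *
      Complex.exp (h * (m * (1 - a))) *
      Complex.exp ((a + b) * (z - a * h + 2 * h * m + y) / 2 + c * (a + b)) *
      (Complex.exp (h * (b ^ 2 / 2)) * Complex.exp (-b * (z - a * h + 2 * h * m)) *
        Complex.exp (h * (n * (1 - b)))) =
      Complex.exp ((a + b) * (y - z) / 2 + c * (a + b) +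
        h * (b * (a + b) / 2 + (m + n : ℕ) * (1 - b))) := by
    simp only [← Complex.exp_add]
    congr 1
    push_cast
    ring
  rw [← hr]
  ring

/-- The solution of `g(u + 1) = (q^u - q^{-u}) g(u)` built from `1 / (q^{2u}; q²)`. -/
def gQ₁ (h u : ℂ) : ℂ :=
  Complex.exp (-(h * (u ^ 2 - u) / 2) - Real.pi * Complex.I * u) /
    infPoch (qpow h 2) (qpow h (2 * u))

/-- The solution of `g(u + 1) = (q^u - q^{-u}) g(u)` built from `(q^{2 - 2u}; q²)`. -/
def gQ₂ (h u : ℂ) : ℂ :=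
  Complex.exp (h * (u ^ 2 - u) / 2) * infPoch (qpow h 2) (qpow h (2 - 2 * u))

theorem gammaLike_gQ₁ {h : ℂ} (hh : h.re < 0) {u : ℂ}
    (hu : ∀ j : ℤ, qpow h (2 * (u + j)) ≠ 1) : GammaLike (qnum h) (gQ₁ h) u := by
  have hQ := norm_qpow_two_lt hh
  have hne (j : ℤ) : infPoch (qpow h 2) (qpow h (2 * (u + j))) ≠ 0 :=
    infPoch_ne_zero hQ fun k => by
      rw [← qpow_two_mul_nat, ← qpow_add]
      have := hu (j + k)
      push_cast at this
      rwa [show 2 * (u + j) + 2 * (k : ℂ) = 2 * (u + (j + k)) by ring]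
  intro j
  refine ⟨div_ne_zero (Complex.exp_ne_zero _) (hne j), ?_⟩
  have h1 := infPoch_eq_mul hQ (qpow h (2 * (u + j)))
  rw [← qpow_add, show 2 * (u + j) + 2 = 2 * (u + j + 1) by ring, one_sub_qpow] at h1
  have h2 := hne j
  rw [h1] at h2
  have h3 : Complex.exp (-(h * ((u + j + 1) ^ 2 - (u + j + 1)) / 2) -
      Real.pi * Complex.I * (u + j + 1)) * -qpow h (u + j) =
      Complex.exp (-(h * ((u + j) ^ 2 - (u + j)) / 2) - Real.pi * Complex.I * (u + j)) := by
    rw [mul_neg, qpow, ← Complex.exp_add, ← mul_neg_one, ← Complex.exp_pi_mul_I, ← Complex.exp_add]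
    congr 1
    ring
  rw [gQ₁, gQ₁, h1, ← h3]
  have h4 := right_ne_zero_of_mul h2
  have h5 := left_ne_zero_of_mul h2
  have h6 := qpow_ne_zero h (u + j)
  have h7 := right_ne_zero_of_mul h5
  generalize qpow h (u + j) = x₁ at *
  generalize qnum h (u + j) = x₂ at *
  generalize infPoch (qpow h 2) (qpow h (2 * (u + j + 1))) = x₃ at *
  field_simp

theorem gammaLike_gQ₂ {h : ℂ} (hh : h.re < 0) {u : ℂ}
    (hu : ∀ j : ℤ, qpow h (2 * (u + j)) ≠ 1) : GammaLike (qnum h) (gQ₂ h) u := by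
  have hQ := norm_qpow_two_lt hh
  have hne (j : ℤ) : infPoch (qpow h 2) (qpow h (2 - 2 * (u + j))) ≠ 0 :=
    infPoch_ne_zero hQ fun k h0 => by
      rw [← qpow_two_mul_nat, ← qpow_add] at h0
      refine hu (j - k - 1) ?_
      rw [← inv_eq_one, ← qpow_neg, ← h0]
      congr 1
      push_cast
      ring
  intro j
  refine ⟨mul_ne_zero (Complex.exp_ne_zero _) (hne j), ?_⟩
  have h1 := infPoch_eq_mul hQ (qpow h (2 - 2 * (u + j + 1)))
  rw [← qpow_add, show 2 - 2 * (u + j + 1) + 2 = 2 - 2 * (u + j) by ring,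
    show 2 - 2 * (u + j + 1) = 2 * -(u + j) by ring, one_sub_qpow, qnum_neg] at h1
  have h3 : Complex.exp (h * ((u + j + 1) ^ 2 - (u + j + 1)) / 2) * qpow h (-(u + j)) =
      Complex.exp (h * ((u + j) ^ 2 - (u + j)) / 2) := by
    rw [qpow, ← Complex.exp_add]
    congr 1
    ring
  rw [gQ₂, gQ₂, show 2 - 2 * (u + j + 1) = 2 * -(u + j) by ring, h1, ← h3]
  ring

theorem XQ_eq_castSucc {h : ℂ} (hh : h.re < 0) (j : Fin 2) (a : ℂ) :
    XQ h j a = FormalOp.mulFn fun x =>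
      phiQ h (Real.pi * Complex.I) (gQ₁ h) a (x j.succ) (x j.castSucc) := by
  have h0 : h ≠ 0 := fun h0 => by simp [h0] at hh
  unfold XQ
  congr 1
  funext x
  set z := x j.castSucc
  set y := x j.succ
  rw [qPoch_eq, qPoch_eq, phiQ, gratio, gQ₁, gQ₁]
  have e (v : ℂ) : qpow h (2 * ((y - z) / (2 * h) + v / 2)) =
      Complex.exp (y - z) * qpow h v := by
    rw [qpow, qpow, ← Complex.exp_add]; congr 1; field_simp
  have he : Complex.exp (a * z) = Complex.exp (a * (z + y) / 2 + Real.pi * Complex.I * a) *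
      (Complex.exp (-(h * (((y - z) / (2 * h) + (1 + a) / 2) ^ 2 -
        ((y - z) / (2 * h) + (1 + a) / 2)) / 2) -
        Real.pi * Complex.I * ((y - z) / (2 * h) + (1 + a) / 2)) /
      Complex.exp (-(h * (((y - z) / (2 * h) + (1 - a) / 2) ^ 2 -
        ((y - z) / (2 * h) + (1 - a) / 2)) / 2) -
        Real.pi * Complex.I * ((y - z) / (2 * h) + (1 - a) / 2))) := by
    rw [← Complex.exp_sub, ← Complex.exp_add]
    congr 1
    field_simp
    ring
  rw [e, e, he, div_div_div_eq]
  ring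

theorem XQ_eq_succ {h : ℂ} (hh : h.re < 0) (j : Fin 2) (a : ℂ) :
    XQ h j a = FormalOp.mulFn fun x => phiQ h 0 (gQ₂ h) a (x j.castSucc) (x j.succ) := by
  have h0 : h ≠ 0 := fun h0 => by simp [h0] at hh
  unfold XQ
  congr 1
  funext x
  set y := x j.castSucc
  set z := x j.succ
  rw [qPoch_eq, qPoch_eq, phiQ, gratio, gQ₂, gQ₂]
  have e (v w : ℂ) (hw : v + w = 2) : qpow h (2 - 2 * ((y - z) / (2 * h) + v / 2)) =
      Complex.exp (z - y) * qpow h w := by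
    rw [qpow, qpow, ← Complex.exp_add, eq_sub_of_add_eq hw]; congr 1; field_simp; ring
  rw [e (1 + a) (1 - a) (by ring), e (1 - a) (1 + a) (by ring), mul_div_mul_comm,
    ← Complex.exp_sub, ← mul_assoc, ← Complex.exp_add]
  congr 2
  field_simp
  ring

theorem WQ_eq {h : ℂ} (hh : h.re < 0) (i : Fin 3) (a : ℂ) :
    WQ h i a = FormalOp.series (ax i (-a * h)) i fun k x => coefQ h a k (x i) := by
  have hQ := norm_qpow_two_lt hh
  simp only [WQ, FormalOp.taylor, qPoch_eq]
  rw [FormalOp.mulFn_mul_series, FormalOp.series_mul_transl, zero_add]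
  congr 1
  funext k x
  rw [iteratedDeriv_qbinom hQ hQ, qbinomCoeff_eq hh, coefQ]

theorem ae_gammaLike_Q {h : ℂ} (hh : h.re < 0) {i k : Fin 3} (hik : i ≠ k) (c : ℂ) :
    ∀ᵐ x : Fin 3 → ℂ, GammaLike (qnum h) (gQ₁ h) ((x i - x k) / (2 * h) + c) ∧
      GammaLike (qnum h) (gQ₂ h) ((x i - x k) / (2 * h) + c) := by
  have h0 : h ≠ 0 := fun h0 => by simp [h0] at hh
  filter_upwards [ae_coord_sub_ne hik fun p : ℤ × ℤ =>
    p.1 * (2 * Real.pi * Complex.I) - 2 * h * (c + p.2)] with x hx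
  have (j : ℤ) : qpow h (2 * ((x i - x k) / (2 * h) + c + j)) ≠ 1 := fun h1 => by
    rw [qpow, Complex.exp_eq_one_iff] at h1
    obtain ⟨n, hn⟩ := h1
    refine hx (n, j) ?_
    rw [← hn]
    field_simp
    ring
  exact ⟨gammaLike_gQ₁ hh this, gammaLike_gQ₂ hh this⟩

theorem star₁_Q {h : ℂ} (hh : h.re < 0) (j : Fin 2) (a b : ℂ) :
    (WQ h j.castSucc a * XQ h j (a + b) * WQ h j.castSucc b).Eqv
      (XQ h j b * WQ h j.castSucc (a + b) * XQ h j a) := by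
  simp only [XQ_eq_castSucc hh, WQ_eq hh, FormalOp.series_mul_mulFn, FormalOp.mulFn_mul_series,
    FormalOp.series_mul]
  refine FormalOp.series_eqv (by rw [← ax_add]; congr 1; ring) fun N => ?_
  have hne := (castSucc_ne_succ j).symm
  filter_upwards [ae_gammaLike_Q hh hne ((1 + b) / 2 + a), ae_gammaLike_Q hh hne ((1 + b) / 2),
    ae_gammaLike_Q hh hne ((1 - b) / 2)] with x h1 h2 h3
  have := (star_Q hh (Real.pi * Complex.I) (by simpa only [add_assoc] using h1.1) h2.1 h3.1 N).symm
  simp only [Pi.add_apply, Pi.smul_apply, ax_apply_self, stepQ, ax_apply_of_ne hne, smul_eq_mul,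
    mul_zero, add_zero]
  convert this using 2
  · congr 2 <;> ring_nf
  · congr 1; ring

theorem star₂_Q {h : ℂ} (hh : h.re < 0) (j : Fin 2) (a b : ℂ) :
    (XQ h j a * WQ h j.succ (a + b) * XQ h j b).Eqv
      (WQ h j.succ b * XQ h j (a + b) * WQ h j.succ a) := by
  simp only [XQ_eq_succ hh, WQ_eq hh, FormalOp.series_mul_mulFn, FormalOp.mulFn_mul_series,
    FormalOp.series_mul]
  refine FormalOp.series_eqv (by rw [← ax_add]; congr 1; ring) fun N => ?_
  have hne := castSucc_ne_succ j
  filter_upwards [ae_gammaLike_Q hh hne ((1 + a) / 2 + b), ae_gammaLike_Q hh hne ((1 + a) / 2),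
    ae_gammaLike_Q hh hne ((1 - a) / 2)] with x h1 h2 h3
  have := star_Q hh 0 (by simpa only [add_assoc] using h1.2) h2.2 h3.2 N
  simp only [Pi.add_apply, Pi.smul_apply, ax_apply_self, stepQ, ax_apply_of_ne hne, smul_eq_mul,
    mul_zero, add_zero]
  rw [add_comm b a] at this
  convert this using 2
  · congr 1; ring
  · congr 2 <;> ring_nf

theorem yangBaxter_Q {h : ℂ} (hh : h.re < 0) (u v w l₁ l₂ l₃ : ℂ) :
    YangBaxter (SQ h) 1 u v w l₁ l₂ l₃ := by
  refine yangBaxter_of_eqv (WQ h) (XQ h) (fun i j hij a b => ?_) (fun a b => ?_) (fun a b => ?_)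
    (fun a b => ?_) (star₁_Q hh) (star₂_Q hh) 1 u v w l₁ l₂ l₃
  · rw [WQ_eq hh, WQ_eq hh]
    refine FormalOp.series_mul_comm fun m n x => ?_
    simp [stepQ, ax_apply_of_ne hij.ne, ax_apply_of_ne hij.ne', mul_comm]
  · rw [XQ, XQ, FormalOp.mulFn_comm]
    exact FormalOp.Eqv.equivalence.refl _
  · rw [WQ_eq hh, XQ, FormalOp.series_mul_mulFn_comm]
    · exact FormalOp.Eqv.equivalence.refl _
    · intro k x
      simp [stepQ, ax]
  · rw [WQ_eq hh, XQ, FormalOp.series_mul_mulFn_comm]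
    · exact FormalOp.Eqv.equivalence.refl _
    · intro k x
      simp [stepQ, ax]

/-! ### The theta function -/

/-- The terms of the series for `θ₁` are terms of the Jacobi theta series. -/
theorem theta1_term_eq (τ z : ℂ) (n : ℤ) :
    Complex.exp (Real.pi * Complex.I * ((n : ℂ) + 1 / 2) ^ 2 * τ) *
      Complex.exp (2 * Real.pi * Complex.I * ((n : ℂ) + 1 / 2) * (z + 1 / 2)) =
    Complex.exp (Real.pi * Complex.I * (τ / 4 + z + 1 / 2)) *
      jacobiTheta₂_term n (z + 1 / 2 + τ / 2) τ := by
  rw [jacobiTheta₂_term, ← Complex.exp_add, ← Complex.exp_add]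
  congr 1
  ring

theorem summable_theta1 {τ : ℂ} (hτ : 0 < τ.im) (z : ℂ) :
    Summable fun n : ℤ => Complex.exp (Real.pi * Complex.I * ((n : ℂ) + 1 / 2) ^ 2 * τ) *
      Complex.exp (2 * Real.pi * Complex.I * ((n : ℂ) + 1 / 2) * (z + 1 / 2)) := by
  simp only [theta1_term_eq]
  exact ((summable_jacobiTheta₂_term_iff _ _).2 hτ).mul_left _

/-- The index `n` of the series corresponds to the index `-1 - n` at the opposite argument. -/
theorem theta1_neg (τ z : ℂ) : theta1 τ (-z) = -theta1 τ z := by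
  rw [theta1, theta1, ← (Equiv.subLeft (-1 : ℤ)).tsum_eq, ← tsum_neg]
  refine tsum_congr fun n => ?_
  rw [Equiv.subLeft_apply, neg_eq_neg_one_mul (_ * _), ← Complex.exp_pi_mul_I, ← Complex.exp_add,
    ← Complex.exp_add, ← Complex.exp_add, Complex.exp_eq_exp_iff_exists_int]
  refine ⟨-n - 1, ?_⟩
  push_cast
  ring

/-- The term of index `a` of the theta series `∑ exp(πi τ a²/2 + 2πi a x)`, whose even and odd parts
are the entries of the determinant in `theta1_mul_theta1`. -/
def thetaTerm (τ : ℂ) (a : ℤ) (x : ℂ) : ℂ :=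
  Complex.exp (Real.pi * Complex.I * τ * (a : ℂ) ^ 2 / 2 + 2 * Real.pi * Complex.I * a * x)

theorem summable_norm_thetaTerm_even {τ : ℂ} (hτ : 0 < τ.im) (x : ℂ) :
    Summable fun k : ℤ => ‖thetaTerm τ (2 * k) x‖ := by
  have h : Summable fun k : ℤ => jacobiTheta₂_term k (2 * x) (2 * τ) :=
    (summable_jacobiTheta₂_term_iff _ _).2 (by simpa using hτ)
  refine h.norm.congr fun k => ?_
  rw [thetaTerm, jacobiTheta₂_term]
  congr 2
  push_cast
  ring

theorem summable_norm_thetaTerm_odd {τ : ℂ} (hτ : 0 < τ.im) (x : ℂ) :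
    Summable fun k : ℤ => ‖thetaTerm τ (2 * k + 1) x‖ := by
  have h : Summable fun k : ℤ => Complex.exp (Real.pi * Complex.I * τ / 2 +
      2 * Real.pi * Complex.I * x) * jacobiTheta₂_term k (2 * x + τ) (2 * τ) :=
    ((summable_jacobiTheta₂_term_iff _ _).2 (by simpa using hτ)).mul_left _
  refine h.norm.congr fun k => ?_
  rw [thetaTerm, jacobiTheta₂_term, ← Complex.exp_add]
  congr 2
  push_cast
  ring

/-- A double sum over `ℤ × ℤ` splits according to the parity of the sum of the two indices. -/
theorem tsum_eq_add_of_parity {F G H : ℤ × ℤ → ℂ} (hG : Summable G) (hH : Summable H)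
    (h₁ : ∀ k l, F (k + l, k - l - 1) = G (k, l)) (h₂ : ∀ k l, F (k + l, k - l) = H (k, l)) :
    ∑' p, F p = ∑' p, G p + ∑' p, H p := by
  let e₁ : ℤ × ℤ → ℤ × ℤ := fun p => (p.1 + p.2, p.1 - p.2 - 1)
  let e₂ : ℤ × ℤ → ℤ × ℤ := fun p => (p.1 + p.2, p.1 - p.2)
  have he₁ : Function.Injective e₁ := fun p q h => by
    simp only [e₁, Prod.mk.injEq] at h
    ext <;> omega
  have he₂ : Function.Injective e₂ := fun p q h => by
    simp only [e₂, Prod.mk.injEq] at h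
    ext <;> omega
  have hc : IsCompl (Set.range e₁) (Set.range e₂) := by
    constructor
    · rw [Set.disjoint_left]
      rintro _ ⟨p, rfl⟩ ⟨q, hq⟩
      simp only [e₁, e₂, Prod.mk.injEq] at hq
      omega
    · rw [codisjoint_iff]
      change Set.range e₁ ∪ Set.range e₂ = Set.univ
      rw [Set.eq_univ_iff_forall]
      rintro ⟨m, n⟩
      rcases Int.even_or_odd' (m + n) with ⟨k, hk | hk⟩
      · exact Or.inr ⟨(k, m - k), by simp only [e₂, Prod.mk.injEq]; omega⟩
      · exact Or.inl ⟨(k + 1, m - k - 1), by simp only [e₁, Prod.mk.injEq]; omega⟩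
  have s₁ : HasSum (F ∘ e₁) (∑' p, G p) := by
    rw [show F ∘ e₁ = G from funext fun p => h₁ p.1 p.2]
    exact hG.hasSum
  have s₂ : HasSum (F ∘ e₂) (∑' p, H p) := by
    rw [show F ∘ e₂ = H from funext fun p => h₂ p.1 p.2]
    exact hH.hasSum
  exact (HasSum.add_isCompl hc (he₁.hasSum_range_iff.2 s₁) (he₂.hasSum_range_iff.2 s₂)).tsum_eq

/-- The product `θ₁(x+y) θ₁(x-y)` is a `2 × 2` determinant, which is why `θ₁` has a three-term
addition formula. In the double series one takes the sum and the difference of the two summation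
indices as new indices; they have opposite parity. -/
theorem theta1_mul_theta1 {τ : ℂ} (hτ : 0 < τ.im) (x y : ℂ) :
    theta1 τ (x + y) * theta1 τ (x - y) =
      (∑' k, thetaTerm τ (2 * k) x) * (∑' k, thetaTerm τ (2 * k + 1) y) -
        (∑' k, thetaTerm τ (2 * k + 1) x) * (∑' k, thetaTerm τ (2 * k) y) := by
  have s₁ := summable_mul_of_summable_norm (summable_norm_thetaTerm_even hτ x)
    (summable_norm_thetaTerm_odd hτ y)
  have s₂ := summable_mul_of_summable_norm (summable_norm_thetaTerm_odd hτ x)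
    (summable_norm_thetaTerm_even hτ y)
  rw [theta1, theta1,
    tsum_mul_tsum_of_summable_norm (summable_theta1 hτ _).norm (summable_theta1 hτ _).norm,
    tsum_mul_tsum_of_summable_norm (summable_norm_thetaTerm_even hτ x)
      (summable_norm_thetaTerm_odd hτ y),
    tsum_mul_tsum_of_summable_norm (summable_norm_thetaTerm_odd hτ x)
      (summable_norm_thetaTerm_even hτ y), sub_eq_add_neg (tsum _), ← tsum_neg]
  refine tsum_eq_add_of_parity s₁ s₂.neg (fun k l => ?_) (fun k l => ?_)
  · simp only [thetaTerm, ← Complex.exp_add]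
    rw [Complex.exp_eq_exp_iff_exists_int]
    refine ⟨k, ?_⟩
    push_cast
    ring
  · simp only [thetaTerm]
    rw [neg_eq_neg_one_mul, ← Complex.exp_pi_mul_I]
    simp only [← Complex.exp_add]
    rw [Complex.exp_eq_exp_iff_exists_int]
    refine ⟨k, ?_⟩
    push_cast
    ring

/-- The three-term addition formula is the Plücker relation for `2 × 2` determinants. -/
theorem theta1_plucker {τ : ℂ} (hτ : 0 < τ.im) (p q r s : ℂ) :
    theta1 τ (p + q) * theta1 τ (p - q) * (theta1 τ (r + s) * theta1 τ (r - s))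
      - theta1 τ (p + r) * theta1 τ (p - r) * (theta1 τ (q + s) * theta1 τ (q - s))
      + theta1 τ (p + s) * theta1 τ (p - s) * (theta1 τ (q + r) * theta1 τ (q - r)) = 0 := by
  simp only [theta1_mul_theta1 hτ]
  ring

/-! ### The product formula for the theta function -/

/-- The finite form of Euler's expansion of the infinite product, with `Q`-binomial coefficients. -/
theorem prod_one_sub_mul_pow {Q : ℂ} (hQ : ‖Q‖ < 1) (N : ℕ) (x : ℂ) :
    ∏ k ∈ Finset.range N, (1 - x * Q ^ k) =
      ∑ p ∈ Finset.HasAntidiagonal.antidiagonal N,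
        (∏ k ∈ Finset.range (p.1 + p.2), (1 - Q ^ (k + 1))) /
          ((∏ k ∈ Finset.range p.1, (1 - Q ^ (k + 1))) *
            ∏ k ∈ Finset.range p.2, (1 - Q ^ (k + 1))) * (Q ^ p.1.choose 2 * (-x) ^ p.1) := by
  set f : ℕ → ℂ := fun n => ∏ k ∈ Finset.range n, (1 - Q ^ (k + 1)) with hf
  have hfs (n : ℕ) : f (n + 1) = f n * (1 - Q ^ (n + 1)) := Finset.prod_range_succ ..
  have hf1 (n : ℕ) : 1 - Q ^ (n + 1) ≠ 0 := one_sub_pow_succ_ne_zero hQ n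
  have hf0 (n : ℕ) : f n ≠ 0 := Finset.prod_ne_zero_iff.2 fun k _ => hf1 k
  have hc (n : ℕ) : (n + 1).choose 2 = n + n.choose 2 := by
    rw [Nat.choose_succ_succ' n 1, Nat.choose_one_right]
  change _ = ∑ p ∈ Finset.HasAntidiagonal.antidiagonal N,
    f (p.1 + p.2) / (f p.1 * f p.2) * (Q ^ p.1.choose 2 * (-x) ^ p.1)
  induction N generalizing x with
  | zero => simp [hf]
  | succ N ih =>
    rw [sum_antidiagonal_succ_of_pascal
      (C := fun m n => f (m + n) / (f m * f n) * (Q ^ m.choose 2 * (-x) ^ m))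
      (F := fun m n => Q ^ m * (f (m + n) / (f m * f n) * (Q ^ m.choose 2 * (-x) ^ m)))
      (G := fun m n => -x * Q ^ m * (f (m + n) / (f m * f n) * (Q ^ m.choose 2 * (-x) ^ m)))]
    · have h := ih (x * Q)
      have e : ∏ k ∈ Finset.range (N + 1), (1 - x * Q ^ k) =
          (∏ k ∈ Finset.range N, (1 - x * Q * Q ^ k)) * (1 - x) := by
        rw [Finset.prod_range_succ']
        simp only [pow_zero, mul_one, pow_succ', mul_assoc]
      rw [e, h, Finset.sum_mul]
      refine Finset.sum_congr rfl fun p _ => ?_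
      rw [← neg_mul, mul_pow]
      ring
    · intro m n
      have h1 := hf0 m
      have h2 := hf0 n
      have h3 := hf1 m
      have h4 := hf1 n
      rw [show m + 1 + (n + 1) = m + n + 1 + 1 by ring, show m + 1 + n = m + n + 1 by ring,
        show m + (n + 1) = m + n + 1 by ring, hfs (m + n + 1), hfs m, hfs n, hc,
        pow_add Q m (m.choose 2),
        pow_succ (-x)]
      have h5 : Q ^ (m + n + 1 + 1) = Q ^ (m + 1) * Q ^ (n + 1) := by ring
      rw [h5]
      generalize Q ^ (m + 1) = q₁ at *
      generalize Q ^ (n + 1) = q₂ at *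
      field_simp
      ring
    · intro n
      have h2 := hf0 n
      have h4 := hf0 (n + 1)
      have : f 0 = 1 := by simp [hf]
      simp [this, h2, h4]
    · intro m
      have h1 := hf0 m
      have h2 := hf0 (m + 1)
      have : f 0 = 1 := by simp [hf]
      simp only [add_zero, this, mul_one, div_self h1, div_self h2, hc]
      ring

/-- The factor split off when `N` factors are reversed in `finite_triple_product`. -/
theorem prod_neg_exp (τ z : ℂ) (N : ℕ) :
    ∏ k ∈ Finset.range N, -Complex.exp (2 * Real.pi * Complex.I * (z - (k + 1) * τ)) =
      Complex.exp (Real.pi * Complex.I * (N * (1 + 2 * z) - N * (N + 1) * τ)) := by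
  induction N with
  | zero => simp
  | succ N ih =>
    rw [Finset.prod_range_succ, ih, neg_eq_neg_one_mul, ← Complex.exp_pi_mul_I, ← Complex.exp_add,
      ← Complex.exp_add]
    congr 1
    push_cast
    ring

/-- The finite form of the Jacobi triple product: the expansion of a product of `2N` factors, the
first `N` of which are reversed by `1 - u = -u (1 - u⁻¹)`. -/
theorem finite_triple_product {τ : ℂ} (hτ : ‖Complex.exp (2 * Real.pi * Complex.I * τ)‖ < 1)
    (z : ℂ) (N : ℕ) :
    (∏ k ∈ Finset.range N, (1 - Complex.exp (2 * Real.pi * Complex.I * z) *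
        Complex.exp (2 * Real.pi * Complex.I * τ) ^ k)) *
      (∏ k ∈ Finset.range N, (1 - Complex.exp (2 * Real.pi * Complex.I * (τ - z)) *
        Complex.exp (2 * Real.pi * Complex.I * τ) ^ k)) =
      ∑ p ∈ Finset.HasAntidiagonal.antidiagonal (2 * N),
        (∏ k ∈ Finset.range (p.1 + p.2),
            (1 - Complex.exp (2 * Real.pi * Complex.I * τ) ^ (k + 1))) /
          ((∏ k ∈ Finset.range p.1, (1 - Complex.exp (2 * Real.pi * Complex.I * τ) ^ (k + 1))) *
            ∏ k ∈ Finset.range p.2, (1 - Complex.exp (2 * Real.pi * Complex.I * τ) ^ (k + 1))) *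
          jacobiTheta₂_term (p.1 - N) (z + 1 / 2 - τ / 2) τ := by
  set D := Complex.exp (Real.pi * Complex.I * (N * (1 + 2 * z) - N * (N + 1) * τ)) with hD
  have hD0 : D ≠ 0 := Complex.exp_ne_zero _
  have key := prod_one_sub_mul_pow hτ (2 * N)
    (Complex.exp (2 * Real.pi * Complex.I * (z - N * τ)))
  refine mul_left_cancel₀ hD0 ?_
  trans ∏ k ∈ Finset.range (2 * N), (1 - Complex.exp (2 * Real.pi * Complex.I * (z - N * τ)) *
    Complex.exp (2 * Real.pi * Complex.I * τ) ^ k)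
  · rw [two_mul N, Finset.prod_range_add, mul_left_comm, mul_comm]
    congr 1
    · rw [hD, ← prod_neg_exp, ← Finset.prod_mul_distrib, ← Finset.prod_range_reflect]
      refine Finset.prod_congr rfl fun k hk => ?_
      rw [Finset.mem_range] at hk
      obtain ⟨m, rfl⟩ := Nat.exists_eq_add_of_lt hk
      rw [show k + m + 1 - 1 - k = m by omega, mul_sub, mul_one, ← Complex.exp_nat_mul,
        ← Complex.exp_nat_mul, ← Complex.exp_add, ← Complex.exp_add, neg_mul, ← Complex.exp_add]
      have h1 : 2 * Real.pi * Complex.I * (z - ((m : ℂ) + 1) * τ) +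
          (2 * Real.pi * Complex.I * (τ - z) + m * (2 * Real.pi * Complex.I * τ)) = 0 := by ring
      have h2 : 2 * Real.pi * Complex.I * (z - (k + m + 1 : ℕ) * τ) +
          (k : ℂ) * (2 * Real.pi * Complex.I * τ) =
          2 * Real.pi * Complex.I * (z - ((m : ℂ) + 1) * τ) := by push_cast; ring
      rw [h1, h2, Complex.exp_zero]
      ring
    · refine Finset.prod_congr rfl fun k _ => ?_
      rw [← Complex.exp_nat_mul, ← Complex.exp_nat_mul, ← Complex.exp_add, ← Complex.exp_add]
      congr 2
      push_cast
      ring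
  rw [key, Finset.mul_sum]
  refine Finset.sum_congr rfl fun p _ => ?_
  rw [mul_left_comm D]
  congr 1
  rw [neg_eq_neg_one_mul, ← Complex.exp_pi_mul_I, ← Complex.exp_add, ← Complex.exp_nat_mul,
    ← Complex.exp_nat_mul, ← Complex.exp_add, hD, jacobiTheta₂_term, ← Complex.exp_add,
    Nat.cast_choose_two]
  congr 1
  push_cast
  ring

theorem norm_exp_two_pi_lt {τ : ℂ} (hτ : 0 < τ.im) :
    ‖Complex.exp (2 * Real.pi * Complex.I * τ)‖ < 1 := by
  have := UpperHalfPlane.norm_exp_two_pi_I_lt_one ⟨τ, hτ⟩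
  exact this

/-- The Jacobi triple product, as the limit of `finite_triple_product` by dominated convergence. -/
theorem tsum_jacobiTheta₂_term_eq {τ : ℂ} (hτ : 0 < τ.im) (z : ℂ) :
    infPoch (Complex.exp (2 * Real.pi * Complex.I * τ)) (Complex.exp (2 * Real.pi * Complex.I * z))
      * infPoch (Complex.exp (2 * Real.pi * Complex.I * τ))
        (Complex.exp (2 * Real.pi * Complex.I * (τ - z))) =
      (infPoch (Complex.exp (2 * Real.pi * Complex.I * τ))
        (Complex.exp (2 * Real.pi * Complex.I * τ)))⁻¹ *
          jacobiTheta₂ (z + 1 / 2 - τ / 2) τ := by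
  have hP := norm_exp_two_pi_lt hτ
  have hfin := finite_triple_product hP z
  set P := Complex.exp (2 * Real.pi * Complex.I * τ)
  set t : ℤ → ℂ := fun l => jacobiTheta₂_term l (z + 1 / 2 - τ / 2) τ with ht
  have hts : Summable t := (summable_jacobiTheta₂_term_iff _ _).2 hτ
  set f : ℕ → ℂ := fun n => ∏ k ∈ Finset.range n, (1 - P ^ (k + 1)) with hf
  have hf0 (n : ℕ) : f n ≠ 0 :=
    Finset.prod_ne_zero_iff.2 fun k _ => one_sub_pow_succ_ne_zero hP k
  have hfl : Tendsto f atTop (𝓝 (infPoch P P)) := by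
    simpa only [← pow_succ'] using tendsto_infPoch hP P
  have hne : infPoch P P ≠ 0 := infPoch_ne_zero_of_norm_lt hP hP
  obtain ⟨B, hB⟩ := (Metric.isBounded_range_of_tendsto f hfl).exists_norm_le
  obtain ⟨C, hC⟩ := (Metric.isBounded_range_of_tendsto _ (hfl.inv₀ hne)).exists_norm_le
  have hB' (n : ℕ) : ‖f n‖ ≤ B := hB _ ⟨n, rfl⟩
  have hC' (n : ℕ) : ‖(f n)⁻¹‖ ≤ C := hC _ ⟨n, rfl⟩
  have hB0 := (norm_nonneg _).trans (hB' 0)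
  have hC0 := (norm_nonneg _).trans (hC' 0)
  -- The sum over the antidiagonal of `2N`, indexed by `l = p.1 - N` and extended by zero to `ℤ`.
  set F : ℕ → ℤ → ℂ := fun N l => if l.natAbs ≤ N then
    f (2 * N) * ((f (N + l).toNat)⁻¹ * (f (N - l).toNat)⁻¹) * t l else 0 with hF
  have hFs (N : ℕ) : ∑' l, F N l =
      (∏ k ∈ Finset.range N, (1 - Complex.exp (2 * Real.pi * Complex.I * z) * P ^ k)) *
      (∏ k ∈ Finset.range N, (1 - Complex.exp (2 * Real.pi * Complex.I * (τ - z)) * P ^ k)) := by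
    rw [hfin, tsum_eq_sum (s := Finset.Icc (-(N : ℤ)) N)]
    · symm
      refine Finset.sum_nbij' (fun p => (p.1 : ℤ) - N)
        (fun l => ((N + l).toNat, (N - l).toNat)) ?_ ?_ ?_ ?_ ?_
      · rintro ⟨m, n⟩ h
        rw [Finset.HasAntidiagonal.mem_antidiagonal] at h
        simp only [Finset.mem_Icc] at h ⊢
        omega
      · intro l h
        rw [Finset.mem_Icc] at h
        rw [Finset.HasAntidiagonal.mem_antidiagonal]
        simp only
        omega
      · rintro ⟨m, n⟩ h
        rw [Finset.HasAntidiagonal.mem_antidiagonal] at h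
        simp only [Prod.mk.injEq] at h ⊢
        omega
      · intro l h
        rw [Finset.mem_Icc] at h
        simp only
        omega
      · rintro ⟨m, n⟩ h
        rw [Finset.HasAntidiagonal.mem_antidiagonal] at h
        simp only at h
        have e1 : ((N : ℤ) + (m - N)).toNat = m := by omega
        have e2 : ((N : ℤ) - (m - N)).toNat = n := by omega
        have e3 : ((m : ℤ) - N).natAbs ≤ N := by omega
        simp only [hF, if_pos e3, e1, e2, h]
        rw [div_eq_mul_inv, mul_inv]
    · intro l hl
      refine if_neg fun h => hl ?_
      rw [Finset.mem_Icc]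
      omega
  have hlim : Tendsto (fun N => ∑' l, F N l) atTop (𝓝 (∑' l, (infPoch P P)⁻¹ * t l)) := by
    refine tendsto_tsum_of_dominated_convergence (bound := fun l => B * (C * C) * ‖t l‖)
      (hts.norm.mul_left _) (fun l => ?_) (Eventually.of_forall fun N l => ?_)
    · have h1 : Tendsto (fun N : ℕ => 2 * N) atTop atTop :=
        tendsto_atTop.2 fun b => by filter_upwards [eventually_ge_atTop b] with N hN; omega
      have h2 : Tendsto (fun N : ℕ => ((N : ℤ) + l).toNat) atTop atTop :=
        tendsto_atTop.2 fun b => by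
          filter_upwards [eventually_ge_atTop (b + l.natAbs)] with N hN; omega
      have h3 : Tendsto (fun N : ℕ => ((N : ℤ) - l).toNat) atTop atTop :=
        tendsto_atTop.2 fun b => by
          filter_upwards [eventually_ge_atTop (b + l.natAbs)] with N hN; omega
      have h4 := ((hfl.comp h1).mul (((hfl.inv₀ hne).comp h2).mul
        ((hfl.inv₀ hne).comp h3))).mul_const (t l)
      rw [mul_inv_cancel_left₀ hne] at h4
      refine h4.congr' ?_
      filter_upwards [eventually_ge_atTop l.natAbs] with N hN
      simp only [hF, if_pos hN, Function.comp]
    · simp only [hF]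
      split_ifs
      · rw [norm_mul, norm_mul, norm_mul]
        gcongr
        exacts [hB' _, hC' _, hC' _]
      · rw [norm_zero]
        positivity
  have hprod := (tendsto_infPoch hP (Complex.exp (2 * Real.pi * Complex.I * z))).mul
    (tendsto_infPoch hP (Complex.exp (2 * Real.pi * Complex.I * (τ - z))))
  rw [tendsto_nhds_unique hprod (hlim.congr hFs), tsum_mul_left, jacobiTheta₂]

/-- The product formula for the theta function, up to the value of the constant. -/
theorem exists_theta1_eq {τ : ℂ} (hτ : 0 < τ.im) : ∃ C : ℂ, ∀ z, theta1 τ z =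
    C * Complex.exp (-(Real.pi * Complex.I * z)) *
      (infPoch (Complex.exp (2 * Real.pi * Complex.I * τ))
        (Complex.exp (2 * Real.pi * Complex.I * z)) *
      infPoch (Complex.exp (2 * Real.pi * Complex.I * τ))
        (Complex.exp (2 * Real.pi * Complex.I * (τ - z)))) := by
  have hP := norm_exp_two_pi_lt hτ
  have hne := infPoch_ne_zero_of_norm_lt hP hP
  refine ⟨Complex.exp (Real.pi * Complex.I * (τ / 4 - 1 / 2)) *
    infPoch (Complex.exp (2 * Real.pi * Complex.I * τ))
      (Complex.exp (2 * Real.pi * Complex.I * τ)), fun z => ?_⟩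
  rw [tsum_jacobiTheta₂_term_eq hτ z, mul_assoc, mul_assoc, mul_left_comm (Complex.exp (-_)),
    mul_inv_cancel_left₀ hne, ← mul_assoc, ← Complex.exp_add, jacobiTheta₂, theta1,
    ← tsum_mul_left, ← (Equiv.subRight (1 : ℤ)).tsum_eq]
  refine tsum_congr fun n => ?_
  rw [Equiv.subRight_apply, jacobiTheta₂_term, ← Complex.exp_add, ← Complex.exp_add]
  congr 1
  push_cast
  ring

/-! ### The elliptic gamma function -/

/-- The double infinite product `∏ₙₘ (1 - x Pⁿ P'ᵐ)`. -/
def dblPoch (P P' x : ℂ) : ℂ := ∏' p : ℕ × ℕ, (1 - x * (P ^ p.1 * P' ^ p.2))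

section DblPoch

variable {P P' : ℂ}

theorem summable_norm_mul_pow_mul_pow (hP : ‖P‖ < 1) (hP' : ‖P'‖ < 1) (x : ℂ) :
    Summable fun p : ℕ × ℕ => ‖-(x * (P ^ p.1 * P' ^ p.2))‖ := by
  have h1 : Summable fun n : ℕ => ‖P ^ n‖ := by
    simpa only [norm_pow] using summable_geometric_of_lt_one (norm_nonneg _) hP
  have h2 : Summable fun n : ℕ => ‖P' ^ n‖ := by
    simpa only [norm_pow] using summable_geometric_of_lt_one (norm_nonneg _) hP'
  have h3 := (h1.mul_norm h2).mul_left ‖x‖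
  simpa only [norm_neg, norm_mul x] using h3

theorem multipliable_dblPoch (hP : ‖P‖ < 1) (hP' : ‖P'‖ < 1) (x : ℂ) :
    Multipliable fun p : ℕ × ℕ => 1 - x * (P ^ p.1 * P' ^ p.2) := by
  simpa only [sub_eq_add_neg] using
    multipliable_one_add_of_summable (summable_norm_mul_pow_mul_pow hP hP' x)

theorem dblPoch_ne_zero (hP : ‖P‖ < 1) (hP' : ‖P'‖ < 1) {x : ℂ}
    (hx : ∀ n m : ℕ, x * (P ^ n * P' ^ m) ≠ 1) : dblPoch P P' x ≠ 0 := by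
  have := tprod_one_add_ne_zero_of_summable (f := fun p : ℕ × ℕ => -(x * (P ^ p.1 * P' ^ p.2)))
    (fun p h => hx p.1 p.2 (by linear_combination -h)) (summable_norm_mul_pow_mul_pow hP hP' x)
  simp only [← sub_eq_add_neg] at this
  exact this

theorem hasProd_infPoch (hP : ‖P‖ < 1) (hP' : ‖P'‖ < 1) (x : ℂ) :
    HasProd (fun m : ℕ => infPoch P (x * P' ^ m)) (dblPoch P P' x) := by
  have h1 := (Equiv.prodComm ℕ ℕ).hasProd_iff.2 (multipliable_dblPoch hP hP' x).hasProd
  refine h1.prod_fiberwise fun m => ?_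
  have h2 := (multipliable_infPoch hP (x * P' ^ m)).hasProd
  simpa [mul_assoc, mul_comm, mul_left_comm, infPoch] using h2

theorem dblPoch_eq_mul (hP : ‖P‖ < 1) (hP' : ‖P'‖ < 1) (x : ℂ) :
    dblPoch P P' x = infPoch P x * dblPoch P P' (x * P') := by
  have h1 := hasProd_infPoch hP hP' (x * P')
  simp only [mul_assoc, ← pow_succ'] at h1
  have h2 := tprod_eq_zero_mul' (f := fun m : ℕ => infPoch P (x * P' ^ m)) h1.multipliable
  rw [(hasProd_infPoch hP hP' x).tprod_eq, h1.tprod_eq, pow_zero, mul_one] at h2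
  exact h2

end DblPoch

theorem ellGamma_eq {τ τ' : ℂ} (hτ : 0 < τ.im) (hτ' : 0 < τ'.im) {z : ℂ}
    (hz : dblPoch (Complex.exp (2 * Real.pi * Complex.I * τ))
      (Complex.exp (2 * Real.pi * Complex.I * τ'))
      (Complex.exp (2 * Real.pi * Complex.I * z)) ≠ 0) :
    ellGamma τ τ' z =
      dblPoch (Complex.exp (2 * Real.pi * Complex.I * τ))
        (Complex.exp (2 * Real.pi * Complex.I * τ'))
        (Complex.exp (2 * Real.pi * Complex.I * (τ + τ' - z))) /
      dblPoch (Complex.exp (2 * Real.pi * Complex.I * τ))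
        (Complex.exp (2 * Real.pi * Complex.I * τ'))
        (Complex.exp (2 * Real.pi * Complex.I * z)) := by
  have hP := norm_exp_two_pi_lt hτ
  have hP' := norm_exp_two_pi_lt hτ'
  rw [dblPoch, dblPoch, ← (multipliable_dblPoch hP hP' _).tprod_div₀
    (multipliable_dblPoch hP hP' _) hz, ellGamma]
  refine tprod_congr fun p => ?_
  rw [← Complex.exp_nat_mul, ← Complex.exp_nat_mul, ← Complex.exp_add, ← Complex.exp_add,
    ← Complex.exp_add]
  congr 3 <;> ring_nf

/-- The condition that `2ηv` lies off the lattice `ℤ + ℤτ + 2ηℤ`, which contains the zeros and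
poles of all the functions of `v + j`, `j ∈ ℤ`, in use. -/
def OffLattice (τ η v : ℂ) : Prop := ∀ k l m : ℤ, 2 * η * v + k * τ + 2 * η * l ≠ m

theorem OffLattice.add_int {τ η v : ℂ} (h : OffLattice τ η v) (j : ℤ) :
    OffLattice τ η (v + j) := fun k l m hm => h k (l + j) m (by rw [← hm]; push_cast; ring)

theorem OffLattice.neg {τ η v : ℂ} (h : OffLattice τ η v) :
    OffLattice τ η (-v) := fun k l m hm => h (-k) (-l) (-m) (by push_cast; rw [← hm]; ring)

theorem ell_neg (τ η x : ℂ) : ell τ η (-x) = -ell τ η x := by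
  rw [ell, mul_neg, theta1_neg, ell]

/-- The difference equation of the elliptic gamma function, in the form `γ(2v+2) ∼ [v] γ(2v)`. The
constant `e^l` is the one in the product formula for the theta function. -/
def GamShift (τ η l : ℂ) : Prop :=
  ∀ v, OffLattice τ η v → gam τ η (2 * v) ≠ 0 ∧
    gam τ η (2 * v + 2) =
      Complex.exp (2 * Real.pi * Complex.I * η * v - l) * ell τ η v * gam τ η (2 * v)

/-- Shifting the argument of the elliptic gamma function by its second period removes one row of
factors from each of its two double products; what remains is the theta function. -/
theorem exists_gamShift {τ η : ℂ} (hτ : 0 < τ.im) (hη : 0 < η.im) (h₁ : ell τ η 1 ≠ 0) :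
    ∃ l : ℂ, GamShift τ η l := by
  obtain ⟨C, hC⟩ := exists_theta1_eq hτ
  have hC0 : C ≠ 0 := fun h => h₁ (by rw [ell, hC, h, zero_mul, zero_mul])
  -- `C ≠ 0` is written as an exponential so that `gE₁` and `gE₂` can contain its complex powers.
  refine ⟨Complex.log C, fun v hv => ?_⟩
  have hη' : 0 < (2 * η).im := by simpa using hη
  have hP := norm_exp_two_pi_lt hτ
  have hP' := norm_exp_two_pi_lt hη'
  set P := Complex.exp (2 * Real.pi * Complex.I * τ) with hPdef
  set P' := Complex.exp (2 * Real.pi * Complex.I * (2 * η)) with hPdef'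
  have hne (c : ℂ) (hc : ∀ n m : ℕ, ∀ j : ℤ, c + n * τ + m * (2 * η) ≠ j) :
      dblPoch P P' (Complex.exp (2 * Real.pi * Complex.I * c)) ≠ 0 := by
    refine dblPoch_ne_zero hP hP' fun n m h => ?_
    rw [hPdef, hPdef', ← Complex.exp_nat_mul, ← Complex.exp_nat_mul, ← Complex.exp_add,
      ← Complex.exp_add, Complex.exp_eq_one_iff] at h
    obtain ⟨j, hj⟩ := h
    refine hc n m j (mul_left_cancel₀ Complex.two_pi_I_ne_zero ?_)
    linear_combination hj
  have h1 : dblPoch P P' (Complex.exp (2 * Real.pi * Complex.I * (η * (2 * v)))) ≠ 0 :=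
    hne _ fun n m j h => hv n m j (by push_cast; rw [← h]; ring)
  have h2 : dblPoch P P' (Complex.exp (2 * Real.pi * Complex.I * (η * (2 * v + 2)))) ≠ 0 :=
    hne _ fun n m j h => hv n (m + 1) j (by push_cast; rw [← h]; ring)
  have h3 : dblPoch P P' (Complex.exp (2 * Real.pi * Complex.I * (τ + 2 * η - η * (2 * v)))) ≠ 0 :=
    hne _ fun n m j h => hv (-n - 1) (-m - 1) (-j) (by push_cast; rw [← h]; ring)
  have g1 : gam τ η (2 * v) = _ := ellGamma_eq hτ hη' h1
  have g2 : gam τ η (2 * v + 2) = _ := ellGamma_eq hτ hη' h2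
  have d1 := dblPoch_eq_mul hP hP' (Complex.exp (2 * Real.pi * Complex.I * (η * (2 * v))))
  have d2 := dblPoch_eq_mul hP hP' (Complex.exp (2 * Real.pi * Complex.I * (τ - η * (2 * v))))
  rw [hPdef', ← Complex.exp_add, ← hPdef',
    show 2 * Real.pi * Complex.I * (η * (2 * v)) + 2 * Real.pi * Complex.I * (2 * η) =
      2 * Real.pi * Complex.I * (η * (2 * v + 2)) by ring] at d1
  rw [hPdef', ← Complex.exp_add, ← hPdef',
    show 2 * Real.pi * Complex.I * (τ - η * (2 * v)) + 2 * Real.pi * Complex.I * (2 * η) =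
      2 * Real.pi * Complex.I * (τ + 2 * η - η * (2 * v)) by ring] at d2
  rw [show τ + 2 * η - η * (2 * v + 2) = τ - η * (2 * v) by ring] at g2
  rw [← hPdef, ← hPdef'] at g1 g2
  refine ⟨by rw [g1]; exact div_ne_zero h3 h1, ?_⟩
  have ht : Complex.exp (2 * Real.pi * Complex.I * η * v - Complex.log C) * ell τ η v =
      infPoch P (Complex.exp (2 * Real.pi * Complex.I * (η * (2 * v)))) *
        infPoch P (Complex.exp (2 * Real.pi * Complex.I * (τ - η * (2 * v)))) := by
    rw [ell, hC, Complex.exp_sub, Complex.exp_log hC0, show 2 * η * v = η * (2 * v) by ring,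
      Complex.exp_neg, show 2 * Real.pi * Complex.I * η * v =
        Real.pi * Complex.I * (η * (2 * v)) by ring]
    have := Complex.exp_ne_zero (Real.pi * Complex.I * (η * (2 * v)))
    generalize Complex.exp (Real.pi * Complex.I * (η * (2 * v))) = e at *
    rw [div_mul_eq_mul_div, div_eq_iff hC0, mul_comm C, mul_assoc,
      mul_inv_cancel_left₀ this, mul_comm C]
  have h4 := h1
  rw [d1] at h4
  rw [ht, g1, g2, d1, d2]
  have h5 := left_ne_zero_of_mul h4
  generalize dblPoch P P' (Complex.exp (2 * Real.pi * Complex.I * (η * (2 * v + 2)))) = x₁ at *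
  generalize infPoch P (Complex.exp (2 * Real.pi * Complex.I * (η * (2 * v)))) = x₂ at *
  field_simp

/-! ### Elliptic deformation -/

/-- The solution of `g(v + 1) = [v] g(v)` built from `γ(2v)`. -/
def gE₁ (τ η l v : ℂ) : ℂ :=
  gam τ η (2 * v) * Complex.exp (-(Real.pi * Complex.I * η * (v ^ 2 - v)) + l * v)

/-- The solution of `g(v + 1) = [v] g(v)` built from `1 / γ(2 - 2v)`; the factor `e^{πi v}` makes up
for the sign in `[-v] = -[v]`. -/
def gE₂ (τ η l v : ℂ) : ℂ :=
  Complex.exp (Real.pi * Complex.I * η * (v ^ 2 - v) + (l + Real.pi * Complex.I) * v) /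
    gam τ η (2 - 2 * v)

theorem gammaLike_gE₁ {τ η l : ℂ} (hl : GamShift τ η l) {v : ℂ} (hv : OffLattice τ η v) :
    GammaLike (ell τ η) (gE₁ τ η l) v := by
  intro j
  obtain ⟨h1, h2⟩ := hl _ (hv.add_int j)
  generalize v + (j : ℂ) = u at *
  refine ⟨mul_ne_zero h1 (Complex.exp_ne_zero _), ?_⟩
  rw [gE₁, gE₁, mul_add, mul_one, h2]
  have : Complex.exp (-(Real.pi * Complex.I * η * (u ^ 2 - u)) + l * u) =
      Complex.exp (2 * Real.pi * Complex.I * η * u - l) *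
        Complex.exp (-(Real.pi * Complex.I * η * ((u + 1) ^ 2 - (u + 1))) + l * (u + 1)) := by
    rw [← Complex.exp_add]
    congr 1
    ring
  rw [this]
  ring

theorem gammaLike_gE₂ {τ η l : ℂ} (hl : GamShift τ η l) {v : ℂ} (hv : OffLattice τ η v) :
    GammaLike (ell τ η) (gE₂ τ η l) v := by
  intro j
  obtain ⟨h1, h2⟩ := hl _ (hv.add_int j).neg
  obtain ⟨h3, -⟩ := hl _ ((hv.add_int j).neg.add_int 1)
  generalize v + (j : ℂ) = u at *
  have e1 : 2 - 2 * (u + 1) = 2 * -u := by ring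
  have e2 : 2 - 2 * u = 2 * -u + 2 := by ring
  rw [show 2 * (-u + ((1 : ℤ) : ℂ)) = 2 * -u + 2 by push_cast; ring] at h3
  rw [gE₂, gE₂, e1, e2]
  refine ⟨div_ne_zero (Complex.exp_ne_zero _) h3, ?_⟩
  rw [div_eq_iff h1, mul_div_assoc', div_mul_eq_mul_div, eq_div_iff h3, h2, ell_neg]
  have : Complex.exp (Real.pi * Complex.I * η * (u ^ 2 - u) + (l + Real.pi * Complex.I) * u) =
      -(Complex.exp (Real.pi * Complex.I * η * ((u + 1) ^ 2 - (u + 1)) +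
        (l + Real.pi * Complex.I) * (u + 1)) *
      Complex.exp (2 * Real.pi * Complex.I * η * -u - l)) := by
    rw [neg_eq_neg_one_mul, ← Complex.exp_pi_mul_I, ← Complex.exp_add, ← Complex.exp_add,
      Complex.exp_eq_exp_iff_exists_int]
    refine ⟨-1, ?_⟩
    push_cast
    ring
  rw [this]
  ring

theorem ell_succ_ne_zero {τ η : ℂ} (hk : ∀ k : ℕ, 1 ≤ k → ell τ η k ≠ 0) (k : ℕ) :
    ell τ η (k + 1) ≠ 0 := by
  exact_mod_cast hk (k + 1) (Nat.succ_pos k)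

theorem ell_plucker {τ : ℂ} (hτ : 0 < τ.im) (η p q r s : ℂ) :
    ell τ η (p + q) * ell τ η (p - q) * (ell τ η (r + s) * ell τ η (r - s))
      - ell τ η (p + r) * ell τ η (p - r) * (ell τ η (q + s) * ell τ η (q - s))
      + ell τ η (p + s) * ell τ η (p - s) * (ell τ η (q + r) * ell τ η (q - r)) = 0 := by
  simp only [ell, mul_add, mul_sub]
  exact theta1_plucker hτ _ _ _ _

theorem coefE_eq (τ η a : ℂ) (k : ℕ) (z : ℂ) : coefE τ η a k z = coefW (ell τ η) a k z := by
  simp only [coefE, coefW, ellPoch, poch, ellFact, add_comm (1 : ℂ)]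

/-- The coefficients of the intertwiner, with the prefactor expressed by `gE₁`. -/
def coefWE (τ η l a : ℂ) (k : ℕ) (z : ℂ) : ℂ :=
  Complex.exp ((Real.pi * Complex.I * η + l) * a) *
    (gE₁ τ η l z / gE₁ τ η l (z + a) * coefW (ell τ η) a k z)

theorem WE_eq (τ η l : ℂ) (i : Fin 3) (a : ℂ) :
    WE τ η i a = FormalOp.series (ax i a) i fun k x => coefWE τ η l a k (x i) := by
  rw [WE, FormalOp.mulFn_mul_series]
  congr 1
  funext k x
  generalize x i = z
  have : Complex.exp (2 * Real.pi * Complex.I * a * η * z + Real.pi * Complex.I * η * a ^ 2) =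
      Complex.exp ((Real.pi * Complex.I * η + l) * a) *
        (Complex.exp (-(Real.pi * Complex.I * η * (z ^ 2 - z)) + l * z) /
          Complex.exp (-(Real.pi * Complex.I * η * ((z + a) ^ 2 - (z + a))) + l * (z + a))) := by
    rw [← Complex.exp_sub, ← Complex.exp_add]
    congr 1
    ring
  rw [coefE_eq, coefWE, gE₁, gE₁, mul_div_mul_comm, this, mul_add 2 z a]
  ring

theorem XE_eq_castSucc (τ η l : ℂ) (j : Fin 2) (a : ℂ) :
    XE τ η j a = FormalOp.mulFn fun x => Complex.exp (-(2 * l * a)) *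
      (gratio (gE₁ τ η l) a ((x j.castSucc + x j.succ) / 2) *
        gratio (gE₁ τ η l) a ((x j.castSucc - x j.succ) / 2)) := by
  unfold XE
  congr 1
  funext x
  generalize x j.castSucc = z
  generalize x j.succ = y
  have e (u v : ℂ) : 2 * (u / 2 + v / 2) = u + v := by ring
  have : Complex.exp (-2 * Real.pi * Complex.I * η * a * z) = Complex.exp (-(2 * l * a)) *
      ((Complex.exp (-(Real.pi * Complex.I * η * (((z + y) / 2 + (1 + a) / 2) ^ 2 -
          ((z + y) / 2 + (1 + a) / 2))) + l * ((z + y) / 2 + (1 + a) / 2)) /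
        Complex.exp (-(Real.pi * Complex.I * η * (((z + y) / 2 + (1 - a) / 2) ^ 2 -
          ((z + y) / 2 + (1 - a) / 2))) + l * ((z + y) / 2 + (1 - a) / 2))) *
      (Complex.exp (-(Real.pi * Complex.I * η * (((z - y) / 2 + (1 + a) / 2) ^ 2 -
          ((z - y) / 2 + (1 + a) / 2))) + l * ((z - y) / 2 + (1 + a) / 2)) /
        Complex.exp (-(Real.pi * Complex.I * η * (((z - y) / 2 + (1 - a) / 2) ^ 2 -
          ((z - y) / 2 + (1 - a) / 2))) + l * ((z - y) / 2 + (1 - a) / 2)))) := by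
    rw [← Complex.exp_sub, ← Complex.exp_sub, ← Complex.exp_add, ← Complex.exp_add]
    congr 1
    ring
  simp only [gratio, gE₁, mul_div_mul_comm]
  rw [this]
  simp only [e]
  rw [show z + y + (1 + a) = z + y + a + 1 by ring, show z + y + (1 - a) = z + y - a + 1 by ring,
    show z - y + (1 + a) = z - y + a + 1 by ring, show z - y + (1 - a) = z - y - a + 1 by ring]
  ring

theorem XE_eq_succ (τ η l : ℂ) (j : Fin 2) (a : ℂ) :
    XE τ η j a = FormalOp.mulFn fun x => Complex.exp (-((2 * l + Real.pi * Complex.I) * a)) *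
      (gratio (gE₁ τ η l) a ((x j.succ + x j.castSucc) / 2) *
        gratio (gE₂ τ η l) a ((x j.succ - x j.castSucc) / 2)) := by
  unfold XE
  congr 1
  funext x
  generalize x j.castSucc = y
  generalize x j.succ = z
  have e (u v : ℂ) : 2 * (u / 2 + v / 2) = u + v := by ring
  have : Complex.exp (-2 * Real.pi * Complex.I * η * a * y) =
      Complex.exp (-((2 * l + Real.pi * Complex.I) * a)) *
      ((Complex.exp (-(Real.pi * Complex.I * η * (((z + y) / 2 + (1 + a) / 2) ^ 2 -
          ((z + y) / 2 + (1 + a) / 2))) + l * ((z + y) / 2 + (1 + a) / 2)) /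
        Complex.exp (-(Real.pi * Complex.I * η * (((z + y) / 2 + (1 - a) / 2) ^ 2 -
          ((z + y) / 2 + (1 - a) / 2))) + l * ((z + y) / 2 + (1 - a) / 2))) *
      (Complex.exp (Real.pi * Complex.I * η * (((z - y) / 2 + (1 + a) / 2) ^ 2 -
          ((z - y) / 2 + (1 + a) / 2)) + (l + Real.pi * Complex.I) * ((z - y) / 2 + (1 + a) / 2)) /
        Complex.exp (Real.pi * Complex.I * η * (((z - y) / 2 + (1 - a) / 2) ^ 2 -
          ((z - y) / 2 + (1 - a) / 2)) +
            (l + Real.pi * Complex.I) * ((z - y) / 2 + (1 - a) / 2)))) := by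
    rw [← Complex.exp_sub, ← Complex.exp_sub, ← Complex.exp_add, ← Complex.exp_add]
    congr 1
    ring
  simp only [gratio, gE₁, gE₂, mul_div_mul_comm, div_div_div_eq]
  rw [this]
  simp only [e]
  rw [show z + y + (1 + a) = y + z + a + 1 by ring, show z + y + (1 - a) = y + z - a + 1 by ring,
    show 2 - (z - y + (1 + a)) = y - z - a + 1 by ring,
    show 2 - (z - y + (1 - a)) = y - z + a + 1 by ring]
  ring

/-- Off a null set the arguments avoid the lattice, which is countable. -/
theorem ae_offLattice {τ η : ℂ} (hη : 0 < η.im) (i : Fin 3) (c : ℂ) :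
    ∀ᵐ x : Fin 3 → ℂ, OffLattice τ η (x i + c) := by
  have h0 : η ≠ 0 := fun h0 => by simp [h0] at hη
  filter_upwards [ae_coord_ne i fun p : ℤ × ℤ × ℤ =>
    (p.2.2 - p.1 * τ - 2 * η * p.2.1) / (2 * η) - c] with x hx k l m h
  refine hx (k, l, m) ?_
  rw [← h]
  field_simp
  ring

theorem ae_offLattice_add {τ η : ℂ} (hη : 0 < η.im) {i j : Fin 3} (hij : i ≠ j) (c : ℂ) :
    ∀ᵐ x : Fin 3 → ℂ, OffLattice τ η ((x i + x j) / 2 + c) ∧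
      OffLattice τ η ((x i - x j) / 2 + c) := by
  have h0 : η ≠ 0 := fun h0 => by simp [h0] at hη
  filter_upwards [ae_coord_add_ne hij fun p : ℤ × ℤ × ℤ =>
    (p.2.2 - p.1 * τ - 2 * η * p.2.1) / η - 2 * c, ae_coord_sub_ne hij fun p : ℤ × ℤ × ℤ =>
    (p.2.2 - p.1 * τ - 2 * η * p.2.1) / η - 2 * c] with x hx hx'
  constructor
  · intro k l m h
    refine hx (k, l, m) ?_
    rw [← h]
    field_simp
    ring
  · intro k l m h
    refine hx' (k, l, m) ?_
    rw [← h]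
    field_simp
    ring

section Star

variable {τ η l : ℂ}

/-- The star-triangle relation for generic values of the two variables. -/
theorem star_E (hτ : 0 < τ.im) (hk : ∀ k : ℕ, 1 ≤ k → ell τ η k ≠ 0) (hl : GamShift τ η l)
    {g : ℂ → ℂ} (hg : ∀ v, OffLattice τ η v → GammaLike (ell τ η) g v) (c : ℂ) {a b y z : ℂ}
    (hz : OffLattice τ η z) (hza : OffLattice τ η (z + a)) (hzab : OffLattice τ η (z + (a + b)))
    (hP : OffLattice τ η ((z + y) / 2 + ((1 + b) / 2 + a)) ∧
      OffLattice τ η ((z - y) / 2 + ((1 + b) / 2 + a)))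
    (hQ : OffLattice τ η ((z + y) / 2 + (1 + b) / 2) ∧
      OffLattice τ η ((z - y) / 2 + (1 + b) / 2))
    (hR : OffLattice τ η ((z + y) / 2 + (1 - b) / 2) ∧
      OffLattice τ η ((z - y) / 2 + (1 - b) / 2)) (N : ℕ) :
    Complex.exp (-(c * b)) * (gratio (gE₁ τ η l) b ((z + y) / 2) * gratio g b ((z - y) / 2)) *
        coefWE τ η l (a + b) N z *
        (Complex.exp (-(c * a)) * (gratio (gE₁ τ η l) a ((z + (a + b) - 2 * N + y) / 2) *
          gratio g a ((z + (a + b) - 2 * N - y) / 2))) =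
      ∑ p ∈ Finset.HasAntidiagonal.antidiagonal N,
        coefWE τ η l a p.1 z *
          (Complex.exp (-(c * (a + b))) *
            (gratio (gE₁ τ η l) (a + b) ((z + a - 2 * p.1 + y) / 2) *
              gratio g (a + b) ((z + a - 2 * p.1 - y) / 2))) *
          coefWE τ η l b p.2 (z + a - 2 * p.1) := by
  have hg₁ : ∀ v, OffLattice τ η v → GammaLike (ell τ η) (gE₁ τ η l) v :=
    fun v hv => gammaLike_gE₁ hl hv
  have key := elliptic_star (g := gE₁ τ η l) (g₁ := gE₁ τ η l) (g₂ := g) (ell_neg τ η)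
    (ell_plucker hτ η) (ell_succ_ne_zero hk)
    (hg₁ _ hz) (hg₁ _ hza) (by rw [add_assoc]; exact hg₁ _ hzab)
    (by rw [add_assoc]; exact hg₁ _ hP.1) (hg₁ _ hQ.1) (hg₁ _ hR.1)
    (by rw [add_assoc]; exact hg _ hP.2) (hg _ hQ.2) (hg _ hR.2) N
  have e₁ (u : ℂ) (m : ℕ) : (z + u - 2 * m + y) / 2 = (z + y) / 2 + u / 2 - m := by ring
  have e₂ (u : ℂ) (m : ℕ) : (z + u - 2 * m - y) / 2 = (z - y) / 2 + u / 2 - m := by ring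
  have he : Complex.exp (-(c * (a + b))) = Complex.exp (-(c * a)) * Complex.exp (-(c * b)) := by
    rw [← Complex.exp_add]; congr 1; ring
  have he' : Complex.exp ((Real.pi * Complex.I * η + l) * (a + b)) =
      Complex.exp ((Real.pi * Complex.I * η + l) * a) *
        Complex.exp ((Real.pi * Complex.I * η + l) * b) := by
    rw [← Complex.exp_add]; congr 1; ring
  simp only [coefWE, e₁, e₂, he, he']
  trans Complex.exp (-(c * a)) * Complex.exp (-(c * b)) *
    (Complex.exp ((Real.pi * Complex.I * η + l) * a) *
        Complex.exp ((Real.pi * Complex.I * η + l) * b)) *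
    (gratio (gE₁ τ η l) b ((z + y) / 2) * gratio g b ((z - y) / 2) *
        (gE₁ τ η l z / gE₁ τ η l (z + (a + b)) * coefW (ell τ η) (a + b) N z) *
        (gratio (gE₁ τ η l) a ((z + y) / 2 + (a + b) / 2 - N) *
          gratio g a ((z - y) / 2 + (a + b) / 2 - N)))
  · ring
  rw [key, Finset.mul_sum]
  refine Finset.sum_congr rfl fun p _ => ?_
  ring

theorem star₁_E (hτ : 0 < τ.im) (hη : 0 < η.im) (hk : ∀ k : ℕ, 1 ≤ k → ell τ η k ≠ 0)
    (hl : GamShift τ η l) (j : Fin 2) (a b : ℂ) :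
    (WE τ η j.castSucc a * XE τ η j (a + b) * WE τ η j.castSucc b).Eqv
      (XE τ η j b * WE τ η j.castSucc (a + b) * XE τ η j a) := by
  simp only [XE_eq_castSucc τ η l, WE_eq τ η l, FormalOp.series_mul_mulFn,
    FormalOp.mulFn_mul_series, FormalOp.series_mul]
  refine FormalOp.series_eqv (by rw [← ax_add]) fun N => ?_
  have hne := castSucc_ne_succ j
  filter_upwards [ae_offLattice hη j.castSucc 0, ae_offLattice hη j.castSucc a,
    ae_offLattice hη j.castSucc (a + b), ae_offLattice_add hη hne ((1 + b) / 2 + a),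
    ae_offLattice_add hη hne ((1 + b) / 2), ae_offLattice_add hη hne ((1 - b) / 2)]
    with x h1 h2 h3 h4 h5 h6
  rw [add_zero] at h1
  have := (star_E hτ hk hl (fun v hv => gammaLike_gE₁ hl hv) (2 * l) h1 h2 h3 h4 h5 h6 N).symm
  have e (u : ℂ) (m : ℕ) : x j.castSucc + (u + m * -2) = x j.castSucc + u - 2 * m := by ring
  simp only [Pi.add_apply, Pi.smul_apply, ax_apply_self, stepE, ax_apply_of_ne hne.symm,
    smul_eq_mul, mul_zero, add_zero, e]
  exact this

theorem star₂_E (hτ : 0 < τ.im) (hη : 0 < η.im) (hk : ∀ k : ℕ, 1 ≤ k → ell τ η k ≠ 0)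
    (hl : GamShift τ η l) (j : Fin 2) (a b : ℂ) :
    (XE τ η j a * WE τ η j.succ (a + b) * XE τ η j b).Eqv
      (WE τ η j.succ b * XE τ η j (a + b) * WE τ η j.succ a) := by
  simp only [XE_eq_succ τ η l, WE_eq τ η l, FormalOp.series_mul_mulFn,
    FormalOp.mulFn_mul_series, FormalOp.series_mul]
  refine FormalOp.series_eqv (by rw [← ax_add, add_comm]) fun N => ?_
  have hne := (castSucc_ne_succ j).symm
  filter_upwards [ae_offLattice hη j.succ 0, ae_offLattice hη j.succ b,
    ae_offLattice hη j.succ (b + a), ae_offLattice_add hη hne ((1 + a) / 2 + b),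
    ae_offLattice_add hη hne ((1 + a) / 2), ae_offLattice_add hη hne ((1 - a) / 2)]
    with x h1 h2 h3 h4 h5 h6
  rw [add_zero] at h1
  have := star_E hτ hk hl (fun v hv => gammaLike_gE₂ hl hv) (2 * l + Real.pi * Complex.I)
    h1 h2 h3 h4 h5 h6 N
  have e (u : ℂ) (m : ℕ) : x j.succ + (u + m * -2) = x j.succ + u - 2 * m := by ring
  simp only [Pi.add_apply, Pi.smul_apply, ax_apply_self, stepE, ax_apply_of_ne hne.symm,
    smul_eq_mul, mul_zero, add_zero, e]
  rw [add_comm b a] at this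
  exact this

end Star

theorem yangBaxter_E {τ η : ℂ} (hτ : 0 < τ.im) (hη : 0 < η.im)
    (hk : ∀ k : ℕ, 1 ≤ k → ell τ η k ≠ 0) (u v w l₁ l₂ l₃ : ℂ) :
    YangBaxter (SE τ η) (2 * η) u v w l₁ l₂ l₃ := by
  obtain ⟨l, hl⟩ := exists_gamShift hτ hη (by simpa using hk 1 le_rfl)
  refine yangBaxter_of_eqv (WE τ η) (XE τ η) (fun i j hij a b => ?_) (fun a b => ?_)
    (fun a b => ?_) (fun a b => ?_) (star₁_E hτ hη hk hl) (star₂_E hτ hη hk hl) _ u v w l₁ l₂ l₃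
  · rw [WE_eq τ η l, WE_eq τ η l]
    refine FormalOp.series_mul_comm fun m n x => ?_
    simp [stepE, ax_apply_of_ne hij.ne, ax_apply_of_ne hij.ne', mul_comm]
  · rw [XE, XE, FormalOp.mulFn_comm]
    exact FormalOp.Eqv.equivalence.refl _
  · rw [WE_eq τ η l, XE, FormalOp.series_mul_mulFn_comm]
    · exact FormalOp.Eqv.equivalence.refl _
    · intro k x
      simp [stepE, ax]
  · rw [WE_eq τ η l, XE, FormalOp.series_mul_mulFn_comm]
    · exact FormalOp.Eqv.equivalence.refl _
    · intro k x
      simp [stepE, ax]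

end YBPerm

end

theorem mainTheorem2 :
    -- no deformation
    (∀ u v w l₁ l₂ l₃ : ℂ, YBPerm.YangBaxter YBPerm.SO 1 u v w l₁ l₂ l₃) ∧
    -- quantum deformation
    (∀ h : ℂ, h.re < 0 →
      ∀ u v w l₁ l₂ l₃ : ℂ, YBPerm.YangBaxter (YBPerm.SQ h) 1 u v w l₁ l₂ l₃) ∧
    -- elliptic deformation
    (∀ τ η : ℂ, 0 < τ.im → 0 < η.im → (∀ k : ℕ, 1 ≤ k → YBPerm.ell τ η k ≠ 0) →
      ∀ u v w l₁ l₂ l₃ : ℂ, YBPerm.YangBaxter (YBPerm.SE τ η) (2 * η) u v w l₁ l₂ l₃) := by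
  refine ⟨fun u v w l₁ l₂ l₃ => YBPerm.yangBaxter_O u v w l₁ l₂ l₃,
    fun h hh u v w l₁ l₂ l₃ => YBPerm.yangBaxter_Q hh u v w l₁ l₂ l₃,
    fun τ η hτ hη hk u v w l₁ l₂ l₃ => YBPerm.yangBaxter_E hτ hη hk u v w l₁ l₂ l₃⟩
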